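/- Let $n\ge 3$ and let $g=(g_{ij})$ be the metric, in the coordinates $x=(x_1,\dots,x_n)$, of the end of an asymptotically flat manifold: $g$ is a $C^2$ Riemannian metric on $\{x\in\mathbb R^n:|x|>r_0\}$ ($r_0>0$), and $h_{ij}=g_{ij}-\delta_{ij}$ satisfies $h_{ij}=O(|x|^{-p})$, $\partial h_{ij}=O(|x|^{-p-1})$, $\partial\partial h_{ij}=O(|x|^{-p-2})$ as $|x|\to\infty$, for some $p>\frac{n-2}{2}$. Let $\bar g=\delta_{ij}\,dx_i\,dx_j$ be the Euclidean metric. A polyhedron $P\subset\mathbb R^n$, not necessarily convex, is here a compact set that is the closure of its interior, whose boundary is contained in finitely many hyperplanes, and such that, outside finitely many affine subspaces of dimension at most $n-3$, every $x\in\partial P$ is either a face point (near $x$, $P$ coincides with a half-space bounded by a hyperplane through $x$) or an edge point (near $x$, $P$ coincides with the intersection, the convex case, or the union, the non-convex case, of two half-spaces bounded by two distinct hyperplanes through $x$). Let $\mathcal F$ and $\mathcal E$ be the sets of face points and of edge points (the union of the faces and the union of the edges), $|\mathcal F|_{\bar\gamma}$ and $|\mathcal E|_{\bar\gamma}$ their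 Euclidean $(n-1)$- and $(n-2)$-dimensional volumes, and $r_P=\min_{x\in\partial P}|x|$. Let $\bar\nu$ and $\nu$ be the outward unit normals of the faces with respect to $\bar g$ and $g$. Let $H=\gamma^{\alpha\beta}A_{\alpha\beta}$, $A_{\alpha\beta}=-g(D_{\partial_\alpha}\partial_\beta,\nu)$, be the mean curvature of the faces with respect to $g$ and $\nu$ ($D$ is the Levi-Civita connection of $g$ and $\gamma$ the induced metric). At an edge point at which two faces $F_A$, $F_B$ meet, let $\theta,\bar\theta\in(0,\pi)$ be the angles between their outward unit normals with respect to $g$ and $\bar g$, and let $\alpha,\bar\alpha$ be the corresponding dihedral angles of $P$: $\alpha=\pi-\theta$, $\bar\alpha=\pi-\bar\theta$ in the convex case, and $\alpha=\pi+\theta$, $\bar\alpha=\pi+\bar\theta$ in the non-convex case. Let $d\bar\sigma$ be the Euclidean volume element on $\partial P$, and $d\sigma$, $d\mu$ the volume elements induced by $g$ on $\mathcal F$ and $\mathcal E$. Then there is a constant $C$, depending only on $g$ (with $n$, $r_0$ and $p$), such that for every $c\in(0,1)$ there is an $R$, depending only on $g$ (with $n$, $r_0$ and $p$) and $c$, with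 the following property. For every polyhedron $P$ whose interior contains $B_{r_0}(0)=\{|x|<r_0\}$, which satisfies $\sin\bar\theta\ge c$ along every edge, and for which $r_P\ge R$, the three integrals below converge absolutely and $$\left|\int_{\partial P}(g_{ij,i}-g_{ii,j})\,\bar\nu^j\,d\bar\sigma-\left(-2\int_{\mathcal F}H\,d\sigma+2\int_{\mathcal E}(\alpha-\bar\alpha)\,d\mu\right)\right|\le C\left(c^{-3}\,|\mathcal E|_{\bar\gamma}\,r_P^{-2p}+|\mathcal F|_{\bar\gamma}\,r_P^{-2p-1}\right),$$ with summation over repeated indices. -/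

import Mathlib

open MeasureTheory Set Filter Topology
open scoped Matrix

namespace PolyhedralMass

noncomputable section

/-- The coordinate space `ℝⁿ` with its Euclidean norm. -/
abbrev E (n : ℕ) : Type := EuclideanSpace ℝ (Fin n)

/-- Partial derivative `∂f/∂xᵢ` at `x`. -/
def pd {n : ℕ} (i : Fin n) (f : E n → ℝ) (x : E n) : ℝ :=
  fderiv ℝ f x (EuclideanSpace.single i 1)

/-- The component `h_ij = g_ij - δ_ij`. -/
def pert {n : ℕ} (g : E n → Matrix (Fin n) (Fin n) ℝ) (i j : Fin n) (x : E n) : ℝ :=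
  g x i j - (1 : Matrix (Fin n) (Fin n) ℝ) i j

/-- `g = (g_ij)` is a `C²` Riemannian metric on the exterior region `{|x| > r₀}` of `ℝⁿ`, and
`g_ij - δ_ij` decays at the rate `|x|^{-p}` with `p > (n-2)/2`, together with two derivatives:
the end of an asymptotically flat manifold, in its coordinate chart. -/
structure IsAsymptoticallyFlatEnd {n : ℕ} (g : E n → Matrix (Fin n) (Fin n) ℝ)
    (r₀ p : ℝ) : Prop where
  radius_pos : 0 < r₀
  contDiffOn : ∀ i j, ContDiffOn ℝ 2 (fun x => g x i j) {x | r₀ < ‖x‖}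
  posDef : ∀ x, r₀ < ‖x‖ → (g x).PosDef
  order : ((n : ℝ) - 2) / 2 < p
  decay : ∀ i j, pert g i j =O[Bornology.cobounded (E n)] fun x => ‖x‖ ^ (-p)
  decay_deriv : ∀ i j k,
    pd k (pert g i j) =O[Bornology.cobounded (E n)] fun x => ‖x‖ ^ (-p - 1)
  decay_deriv2 : ∀ i j k l,
    pd l (pd k (pert g i j)) =O[Bornology.cobounded (E n)] fun x => ‖x‖ ^ (-p - 2)

/-! ### Linear algebra of a constant metric `G` -/

/-- `G(u, v) = G_ij uⁱ vʲ`. -/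
def metricInner {n : ℕ} (G : Matrix (Fin n) (Fin n) ℝ) (u v : E n) : ℝ :=
  ∑ i, ∑ j, G i j * u i * v j

/-- The unit normal, with respect to `G`, of the hyperplane `{a_i xⁱ = const}`, on the side into
which `a` points: `νⁱ = Gⁱʲ a_j / (Gᵏˡ a_k a_l)^{1/2}`. -/
def unitNormal {n : ℕ} (G : Matrix (Fin n) (Fin n) ℝ) (a : E n) : E n :=
  WithLp.toLp 2 fun i =>
    (∑ j, G⁻¹ i j * a j) / Real.sqrt (∑ k, ∑ l, G⁻¹ k l * a k * a l)

/-- The angle, with respect to `G`, between the unit normals of the hyperplanes given by `a` and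
`b`; for `G = 1` it is the Euclidean angle of `a` and `b`. -/
def normalAngle {n : ℕ} (G : Matrix (Fin n) (Fin n) ℝ) (a b : E n) : ℝ :=
  Real.arccos (metricInner G (unitNormal G a) (unitNormal G b))

/-- The metric induced by `G` on a linear subspace `W`, in a Euclidean orthonormal basis of `W`. -/
def inducedMetric {n : ℕ} (G : Matrix (Fin n) (Fin n) ℝ) (W : Submodule ℝ (E n)) :
    Matrix (Fin (Module.finrank ℝ W)) (Fin (Module.finrank ℝ W)) ℝ :=
  Matrix.of fun α β =>
    metricInner G (stdOrthonormalBasis ℝ W α : E n) (stdOrthonormalBasis ℝ W β : E n)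

/-- The density of the volume element of the metric induced by `G` on `W` with respect to the
Euclidean volume element of `W`. -/
def volDensity {n : ℕ} (G : Matrix (Fin n) (Fin n) ℝ) (W : Submodule ℝ (E n)) : ℝ :=
  Real.sqrt (inducedMetric G W).det

/-! ### Mean curvature of hyperplanes -/

/-- `D_u v` at `x` for constant vector fields `u`, `v` and the Levi-Civita connection `D` of `g`,
i.e. the vector with components `Γᵏ_ij uⁱ vʲ`. -/
def christoffel {n : ℕ} (g : E n → Matrix (Fin n) (Fin n) ℝ) (x : E n) (u v : E n) : E n :=
  WithLp.toLp 2 fun k =>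
    ∑ i, ∑ j, (∑ l, (1 / 2 : ℝ) * (g x)⁻¹ k l *
      (pd i (fun y => g y l j) x + pd j (fun y => g y i l) x - pd l (fun y => g y i j) x))
        * u i * v j

/-- Second fundamental form `A(u, v) = -g(D_u v, ν)` at `x` of the hyperplane through `x` with
Euclidean normal `a`, for vectors `u`, `v` tangent to it. -/
def secondFundamentalForm {n : ℕ} (g : E n → Matrix (Fin n) (Fin n) ℝ) (a x : E n)
    (u v : E n) : ℝ :=
  - metricInner (g x) (christoffel g x u v) (unitNormal (g x) a)

/-- Mean curvature `H = γ^{αβ} A_{αβ}` at `x` of the hyperplane through `x` with Euclidean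
normal `a`. -/
def meanCurvature {n : ℕ} (g : E n → Matrix (Fin n) (Fin n) ℝ) (a x : E n) : ℝ :=
  ∑ α, ∑ β, (inducedMetric (g x) (ℝ ∙ a)ᗮ)⁻¹ α β *
    secondFundamentalForm g a x
      (stdOrthonormalBasis ℝ (ℝ ∙ a)ᗮ α : E n) (stdOrthonormalBasis ℝ (ℝ ∙ a)ᗮ β : E n)

/-! ### Polyhedra -/

/-- `x` is an (interior) point of a face of `P` with outward unit normal `a`: near `x` the set `P`
is the half-space `{y | ⟨a, y - x⟩ ≤ 0}`. -/
def IsFacePoint {n : ℕ} (P : Set (E n)) (x a : E n) : Prop :=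
  ‖a‖ = 1 ∧ ∀ᶠ y in 𝓝 x, (y ∈ P ↔ inner ℝ a (y - x) ≤ 0)

/-- `x` is an (interior) point of an edge at which two faces with outward unit normals `a`, `b`
meet and `P` is convex: near `x`, `P` is the intersection of two half-spaces. -/
def IsConvexEdgePoint {n : ℕ} (P : Set (E n)) (x a b : E n) : Prop :=
  ‖a‖ = 1 ∧ ‖b‖ = 1 ∧ a ≠ b ∧ a ≠ -b ∧
    ∀ᶠ y in 𝓝 x, (y ∈ P ↔ inner ℝ a (y - x) ≤ 0 ∧ inner ℝ b (y - x) ≤ 0)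

/-- `x` is an (interior) point of an edge at which two faces with outward unit normals `a`, `b`
meet and `P` is non-convex: near `x`, `P` is the union of two half-spaces. -/
def IsConcaveEdgePoint {n : ℕ} (P : Set (E n)) (x a b : E n) : Prop :=
  ‖a‖ = 1 ∧ ‖b‖ = 1 ∧ a ≠ b ∧ a ≠ -b ∧
    ∀ᶠ y in 𝓝 x, (y ∈ P ↔ inner ℝ a (y - x) ≤ 0 ∨ inner ℝ b (y - x) ≤ 0)

/-- `x` is an edge point of `P` at which two faces with outward unit normals `a`, `b` meet. -/
def IsEdgePoint {n : ℕ} (P : Set (E n)) (x a b : E n) : Prop :=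
  IsConvexEdgePoint P x a b ∨ IsConcaveEdgePoint P x a b

/-- The union of the (relatively open) faces of `P`. -/
def faces {n : ℕ} (P : Set (E n)) : Set (E n) := {x | ∃ a, IsFacePoint P x a}

/-- The union of the (relatively open) edges of `P`. -/
def edges {n : ℕ} (P : Set (E n)) : Set (E n) := {x | ∃ a b, IsEdgePoint P x a b}

/-- Euclidean polyhedra in `ℝⁿ`, convex or not: compact sets that are the closure of their
interior, whose boundary consists of finitely many flat faces (it lies in finitely many
hyperplanes), exactly two faces meeting along every edge: apart from finitely many pieces of
dimension at most `n - 3`, every boundary point is an interior point of a face or of an edge. -/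
structure IsPolyhedron {n : ℕ} (P : Set (E n)) : Prop where
  isCompact : IsCompact P
  closure_interior : closure (interior P) = P
  finite_faces : ∃ T : Set (AffineSubspace ℝ (E n)), T.Finite ∧
    (∀ L ∈ T, Module.finrank ℝ L.direction + 1 = n) ∧
    frontier P ⊆ ⋃ L ∈ T, (L : Set (E n))
  two_faces : ∃ T : Set (AffineSubspace ℝ (E n)), T.Finite ∧
    (∀ L ∈ T, Module.finrank ℝ L.direction + 3 ≤ n) ∧
    frontier P \ (faces P ∪ edges P) ⊆ ⋃ L ∈ T, (L : Set (E n))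

/-- `r_P = min {|x| : x ∈ ∂P}`. -/
def boundaryRadius {n : ℕ} (P : Set (E n)) : ℝ := sInf (norm '' frontier P)

open Classical in
/-- The Euclidean outward unit normal of `P` at the points of its faces (`0` elsewhere). -/
def outwardNormal {n : ℕ} (P : Set (E n)) (x : E n) : E n :=
  if h : ∃ a, IsFacePoint P x a then h.choose else 0

open Classical in
/-- The (unordered) pair of Euclidean outward unit normals of the two faces that meet at an edge
point (`0` elsewhere). -/
def edgeNormals {n : ℕ} (P : Set (E n)) (x : E n) : E n × E n :=
  if h : ∃ q : E n × E n, IsEdgePoint P x q.1 q.2 then h.choose else 0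

open Classical in
/-- The dihedral angle of `P` at an edge point `x`, with respect to a metric whose value at `x` is
`G`: it is `π - θ` (in `(0, π)`) if `P` is convex at `x`, and `π + θ` (in `(π, 2π)`) otherwise,
where `θ` is the angle between the outward unit normals of the two faces. -/
def dihedralAngle {n : ℕ} (P : Set (E n)) (G : Matrix (Fin n) (Fin n) ℝ) (x : E n) : ℝ :=
  if IsConvexEdgePoint P x (edgeNormals P x).1 (edgeNormals P x).2 then
    Real.pi - normalAngle G (edgeNormals P x).1 (edgeNormals P x).2
  else
    Real.pi + normalAngle G (edgeNormals P x).1 (edgeNormals P x).2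

/-- The tangent space of a face at the face point `x`. -/
def faceDirection {n : ℕ} (P : Set (E n)) (x : E n) : Submodule ℝ (E n) :=
  (ℝ ∙ outwardNormal P x)ᗮ

/-- The tangent space of an edge at the edge point `x`. -/
def edgeDirection {n : ℕ} (P : Set (E n)) (x : E n) : Submodule ℝ (E n) :=
  (Submodule.span ℝ {(edgeNormals P x).1, (edgeNormals P x).2})ᗮ

/-! ### The quantities in the formula

`μHE[d]` is the `d`-dimensional Hausdorff measure normalized to agree with Euclidean `d`-volume. -/

/-- The integrand `(g_{ij,i} - g_{ii,j}) ν̄ʲ` of the flux. -/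
def fluxDensity {n : ℕ} (g : E n → Matrix (Fin n) (Fin n) ℝ) (P : Set (E n)) (x : E n) : ℝ :=
  ∑ i, ∑ j, (pd i (fun y => g y i j) x - pd j (fun y => g y i i) x) * outwardNormal P x j

/-- `H dσ / dσ̄` on the faces. -/
def curvatureDensity {n : ℕ} (g : E n → Matrix (Fin n) (Fin n) ℝ) (P : Set (E n))
    (x : E n) : ℝ :=
  meanCurvature g (outwardNormal P x) x * volDensity (g x) (faceDirection P x)

/-- `(α - ᾱ) dμ / dμ̄` on the edges. -/
def angleDefectDensity {n : ℕ} (g : E n → Matrix (Fin n) (Fin n) ℝ) (P : Set (E n))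
    (x : E n) : ℝ :=
  (dihedralAngle P (g x) x - dihedralAngle P 1 x) * volDensity (g x) (edgeDirection P x)

/-- `∫_{∂P} (g_{ij,i} - g_{ii,j}) ν̄ʲ dσ̄`. -/
def flux {n : ℕ} (g : E n → Matrix (Fin n) (Fin n) ℝ) (P : Set (E n)) : ℝ :=
  ∫ x in frontier P, fluxDensity g P x ∂μHE[n - 1]

/-- `∫_𝓕 H dσ`. -/
def totalMeanCurvature {n : ℕ} (g : E n → Matrix (Fin n) (Fin n) ℝ) (P : Set (E n)) : ℝ :=
  ∫ x in faces P, curvatureDensity g P x ∂μHE[n - 1]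

/-- `∫_𝓔 (α - ᾱ) dμ`. -/
def totalAngleDefect {n : ℕ} (g : E n → Matrix (Fin n) (Fin n) ℝ) (P : Set (E n)) : ℝ :=
  ∫ x in edges P, angleDefectDensity g P x ∂μHE[n - 2]

/-- Euclidean `(n-1)`-volume of the union of the faces. -/
def faceVolume {n : ℕ} (P : Set (E n)) : ℝ := (μHE[n - 1] : Measure (E n)).real (faces P)

/-- Euclidean `(n-2)`-volume of the union of the edges. -/
def edgeVolume {n : ℕ} (P : Set (E n)) : ℝ := (μHE[n - 2] : Measure (E n)).real (edges P)

end

end PolyhedralMass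

open PolyhedralMass

/-!
Write `h = g - δ`, and let `ν`, `θ` denote the Euclidean outward normals and the Euclidean angles
between them. The formula is the first-order expansion in `h` of the mean curvature of the faces
and of the dihedral angles, combined with the divergence theorem on the faces.

On a face, `ν` is constant, and the linearization of `2 H` is minus the sum of the flux density
`(∂ᵢ gᵢⱼ - ∂ⱼ gᵢᵢ) νʲ` and of the tangential divergence of the tangential part `X` of the vector
`h(ν, ·)`; this is `linearized_identity`, an identity between sums of first derivatives of `g`.
The error of the linearization is `O(|h| |∂h|)` (`exists_curvature_estimate`), which is
`O(r_P^{-2p-1})` on the boundary of `P`. At an edge with face normals `a` and `b`, the outward conormals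
`η_a`, `η_b` of the two faces lie in the plane of `a` and `b`, and `h(a, η_a) + h(b, η_b)`, which
is the total flux of `X` through the edge, is twice the linearization of minus the dihedral angle;
here the error is `O((sin θ)⁻³ |h|²)` (`exists_angleDefect_estimate`). Integration over the faces
and the edges gives the estimate (`IsPolyhedron.flux_estimate`).

The remaining part is the divergence theorem `IsPolyhedron.divergence` for the piecewise smooth
field `X` on the boundary of a polyhedron. Near a face point the boundary is a hyperplane, near an
edge point it consists of two half-hyperplanes, and a partition of unity gives the theorem for
functions supported away from the corners. The corners lie in finitely many affine subspaces `L`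
of codimension at least three. A cutoff function near `L`, at scale `δ`, has a gradient of size
`O(δ⁻¹)`, while the part of the boundary within distance `δ` of `L` has area `O(δ²)`, because a
hyperplane meets the directions orthogonal to `L` in dimension at least two
(`measure_hyperplane_tube_le`); hence the corners do not contribute
(`IsPolyhedron.divergence_of_cutoff`).

The integrals with respect to Hausdorff measure are finite since the boundary lies in finitely
many hyperplanes, and the edges in the intersections of pairs of them
(`IsPolyhedron.measure_edges_lt_top`).
-/

namespace PolyhedralMass

/-! ### Flat pieces and their Hausdorff measure -/

section Flats

theorem isometry_const_add {n : ℕ} {V : Type*} [NormedAddCommGroup V] [InnerProductSpace ℝ V]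
    (x₀ : E n) (L : V →ₗᵢ[ℝ] E n) : Isometry fun v => x₀ + L v :=
  (isometry_add_left x₀).comp L.isometry

section Parametrization

variable {n : ℕ} {V : Type*} [NormedAddCommGroup V] [InnerProductSpace ℝ V]
  [FiniteDimensional ℝ V] [MeasurableSpace V] [BorelSpace V]

theorem measurableEmbedding_const_add (x₀ : E n) (L : V →ₗᵢ[ℝ] E n) :
    MeasurableEmbedding fun v => x₀ + L v :=
  (isometry_const_add x₀ L).isClosedEmbedding.measurableEmbedding

/-- An isometric parametrization of a flat carries Lebesgue measure to normalized Hausdorff measure,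
which turns integrals over flat pieces into integrals over a Euclidean space. -/
theorem map_volume_const_add (x₀ : E n) (L : V →ₗᵢ[ℝ] E n) :
    (volume : Measure V).map (fun v => x₀ + L v) =
      (μHE[Module.finrank ℝ V] : Measure (E n)).restrict (range fun v => x₀ + L v) := by
  rw [← InnerProductSpace.euclideanHausdorffMeasure_eq_volume,
    (isometry_const_add x₀ L).map_euclideanHausdorffMeasure]

theorem setIntegral_eq_integral_preimage (x₀ : E n) (L : V →ₗᵢ[ℝ] E n) {d : ℕ}
    (hd : Module.finrank ℝ V = d) {s : Set (E n)} (hs : s ⊆ range fun v => x₀ + L v)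
    (f : E n → ℝ) :
    ∫ x in s, f x ∂μHE[d] = ∫ v in (fun v => x₀ + L v) ⁻¹' s, f (x₀ + L v) := by
  have h := map_volume_const_add x₀ L
  rw [hd] at h
  have he := measurableEmbedding_const_add x₀ L
  rw [← he.setIntegral_map, h, Measure.restrict_restrict_of_subset hs]

theorem measure_eq_volume_preimage (x₀ : E n) (L : V →ₗᵢ[ℝ] E n) {d : ℕ}
    (hd : Module.finrank ℝ V = d) {s : Set (E n)} (hs : s ⊆ range fun v => x₀ + L v) :
    μHE[d] s = volume ((fun v => x₀ + L v) ⁻¹' s) := by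
  have h := map_volume_const_add x₀ L
  rw [hd] at h
  have he := measurableEmbedding_const_add x₀ L
  rw [← he.map_apply, h, Measure.restrict_eq_self _ hs]

/-- An affine subspace of dimension less than `d` is a null set for the `d`-dimensional measure. -/
theorem measure_range_eq_zero (x₀ : E n) (L : V →ₗᵢ[ℝ] E n) {d : ℕ}
    (hd : Module.finrank ℝ V < d) : μHE[d] (range fun v => x₀ + L v) = 0 := by
  rw [← image_univ, (isometry_const_add x₀ L).euclideanHausdorffMeasure_image,
    Measure.euclideanHausdorffMeasure_def]
  have : (μH[(d : ℝ)] : Measure V) univ = 0 := by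
    have h := hausdorffMeasure_of_dimH_lt (X := V) (s := univ) (d := d) (by
      rw [Real.dimH_univ_eq_finrank]; exact_mod_cast hd)
    simpa using h
  simp [this]

end Parametrization

variable {n : ℕ}

theorem affineSubspace_eq_range (L : AffineSubspace ℝ (E n)) {x₀ : E n} (hx : x₀ ∈ L) :
    (L : Set (E n)) = range fun v => x₀ + L.direction.subtypeₗᵢ v := by
  ext y
  constructor
  · intro hy
    exact ⟨⟨y - x₀, AffineSubspace.vsub_mem_direction hy hx⟩, by simp⟩
  · rintro ⟨v, rfl⟩
    have := AffineSubspace.vadd_mem_of_mem_direction v.2 hx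
    simpa [add_comm] using this

theorem measure_affineSubspace_eq_zero (L : AffineSubspace ℝ (E n)) {d : ℕ}
    (hd : Module.finrank ℝ L.direction < d) : μHE[d] (L : Set (E n)) = 0 := by
  rcases (L : Set (E n)).eq_empty_or_nonempty with h | ⟨x₀, hx⟩
  · simp [h]
  · rw [affineSubspace_eq_range L hx]
    exact measure_range_eq_zero x₀ _ hd

theorem measure_affineSubspace_inter_lt_top (L : AffineSubspace ℝ (E n)) {d : ℕ}
    (hd : Module.finrank ℝ L.direction ≤ d) {s : Set (E n)} (hs : Bornology.IsBounded s) :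
    μHE[d] ((L : Set (E n)) ∩ s) < ⊤ := by
  rcases hd.lt_or_eq with hd | hd
  · rw [measure_mono_null inter_subset_left (measure_affineSubspace_eq_zero L hd)]
    simp
  rcases (L : Set (E n)).eq_empty_or_nonempty with h | ⟨x₀, hx⟩
  · simp [h]
  · rw [measure_eq_volume_preimage x₀ L.direction.subtypeₗᵢ hd
      (inter_subset_left.trans (affineSubspace_eq_range L hx).subset)]
    refine Bornology.IsBounded.measure_lt_top ?_
    have := (isometry_const_add x₀ L.direction.subtypeₗᵢ)
    exact this.antilipschitz.isBounded_preimage (hs.subset inter_subset_right)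

/-- The points of an inner product space whose distance from `v₀` is at most `M`, and at most `ρ`
in the directions of a subspace `U`, have volume at most `C ρ ^ dim U`. -/
theorem volume_tube_le {V : Type*} [NormedAddCommGroup V] [InnerProductSpace ℝ V]
    [FiniteDimensional ℝ V] [MeasurableSpace V] [BorelSpace V] (U : Submodule ℝ V) (v₀ : V)
    {ρ : ℝ} (hρ : 0 ≤ ρ) (M : ℝ) :
    volume {v : V | ‖U.orthogonalProjectionOnto (v - v₀)‖ ≤ ρ ∧ ‖v - v₀‖ ≤ M} ≤
      ENNReal.ofReal (ρ ^ Module.finrank ℝ U) * volume (Metric.closedBall (0 : U) 1) *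
        volume (Metric.closedBall (0 : Uᗮ) M) := by
  have h := U.measurePreserving_measurableEquivProd v₀
  rw [InnerProductSpace.euclideanHausdorffMeasure_eq_volume] at h
  have hsub : {v : V | ‖U.orthogonalProjectionOnto (v - v₀)‖ ≤ ρ ∧ ‖v - v₀‖ ≤ M} ⊆
      (U.measurableEquivProd v₀) ⁻¹' (Metric.closedBall (0 : U) ρ ×ˢ
        Metric.closedBall (0 : Uᗮ) M) := by
    rintro v ⟨h1, h2⟩
    simp only [mem_preimage, Submodule.measurableEquivProd_apply, mem_prod,
      mem_closedBall_zero_iff, vsub_eq_sub]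
    exact ⟨h1, (Submodule.norm_orthogonalProjectionOnto_apply_le _ _).trans h2⟩
  refine (measure_mono hsub).trans ?_
  rw [h.measure_preimage_equiv, Measure.volume_eq_prod, Measure.prod_prod]
  gcongr
  rw [← Measure.addHaar_closedBall_mul volume (0 : U) hρ zero_le_one, mul_one]

/-- Near an affine subspace of codimension three, hyperplanes have little area: the part of a
hyperplane in a bounded set, at distance at most `δ` from the subspace, has area `O(δ²)`. -/
theorem measure_hyperplane_tube_le (L : AffineSubspace ℝ (E n))
    (hL : Module.finrank ℝ L.direction + 1 = n) (S : Submodule ℝ (E n))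
    (hS : 3 ≤ Module.finrank ℝ S) (z : E n) (M : ℝ) :
    ∃ C : ℝ, ∀ δ : ℝ, 0 < δ → δ ≤ 1 →
      μHE[n - 1] ((L : Set (E n)) ∩
        {x | ‖x‖ ≤ M ∧ ‖S.orthogonalProjectionOnto (x - z)‖ ≤ δ}) ≤ ENNReal.ofReal (C * δ ^ 2) := by
  rcases (L : Set (E n)).eq_empty_or_nonempty with h | ⟨x₀, hx⟩
  · exact ⟨0, fun δ _ _ => by simp [h]⟩
  set D := L.direction
  let U : Submodule ℝ D := S.comap D.subtype
  -- `S` has dimension three, so it meets the direction of a hyperplane in dimension two at least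
  have hU : 2 ≤ Module.finrank ℝ U := by
    have h1 := Submodule.finrank_sup_add_finrank_inf_eq S D
    have h4 := Submodule.finrank_le (S ⊔ D)
    have h2 : Module.finrank ℝ U = Module.finrank ℝ (S ⊓ D : Submodule ℝ (E n)) := by
      have : (S ⊓ D : Submodule ℝ (E n)) = U.map D.subtype := by
        rw [Submodule.map_comap_subtype, inf_comm]
      rw [this]
      exact (LinearEquiv.finrank_eq (Submodule.equivMapOfInjective D.subtype
        D.injective_subtype U))
    have h3 : Module.finrank ℝ (E n) = n := by simp
    omega
  set A := volume (Metric.closedBall (0 : U) 1) * volume (Metric.closedBall (0 : Uᗮ) (2 * M))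
    with hA
  have hAtop : A ≠ ⊤ := ENNReal.mul_ne_top measure_closedBall_lt_top.ne
    measure_closedBall_lt_top.ne
  refine ⟨2 ^ Module.finrank ℝ U * A.toReal, fun δ hδ hδ1 => ?_⟩
  rw [measure_eq_volume_preimage x₀ D.subtypeₗᵢ (by omega)
    (inter_subset_left.trans (affineSubspace_eq_range L hx).subset)]
  set s := (fun v => x₀ + D.subtypeₗᵢ v) ⁻¹' ((L : Set (E n)) ∩
    {x | ‖x‖ ≤ M ∧ ‖S.orthogonalProjectionOnto (x - z)‖ ≤ δ}) with hs
  rcases s.eq_empty_or_nonempty with h0 | ⟨v₀, hv₀⟩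
  · simp [h0]
  have hsub : s ⊆ {v : D | ‖U.orthogonalProjectionOnto (v - v₀)‖ ≤ 2 * δ ∧ ‖v - v₀‖ ≤ 2 * M} := by
    intro v hv
    have hv1 := hv.2.1
    have hv2 := hv.2.2
    have hw1 := hv₀.2.1
    have hw2 := hv₀.2.2
    simp only [Submodule.coe_subtypeₗᵢ, Submodule.subtype_apply] at hv1 hv2 hw1 hw2
    constructor
    · have h2 : ‖S.orthogonalProjectionOnto ((v : E n) - v₀)‖ ≤ 2 * δ := by
        have : (v : E n) - v₀ = (x₀ + v - z) - (x₀ + v₀ - z) := by abel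
        rw [this, map_sub]
        exact (norm_sub_le _ _).trans (by linarith)
      refine le_trans ?_ h2
      set y := U.orthogonalProjectionOnto (v - v₀) with hy
      have hyS : ((y : D) : E n) ∈ S := y.2
      have e1 : ‖y‖ ^ 2 =
          inner ℝ (S.orthogonalProjectionOnto ((v : E n) - v₀)) ⟨((y : D) : E n), hyS⟩ := by
        rw [Submodule.inner_orthogonalProjectionOnto_eq_of_mem_right]
        have : inner ℝ y y = inner ℝ (v - v₀) (y : D) := by
          conv_lhs => rw [hy]
          exact Submodule.inner_orthogonalProjectionOnto_eq_of_mem_right _ _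
        exact (real_inner_self_eq_norm_sq y).symm.trans this
      have e2 := real_inner_le_norm (S.orthogonalProjectionOnto ((v : E n) - v₀))
        (⟨((y : D) : E n), hyS⟩ : S)
      rw [← e1] at e2
      have e3 : ‖(⟨((y : D) : E n), hyS⟩ : S)‖ = ‖y‖ := rfl
      rw [e3, pow_two] at e2
      rcases (norm_nonneg y).eq_or_lt with h | h
      · rw [← h]; positivity
      · exact le_of_mul_le_mul_right e2 h
    · have : ‖v - v₀‖ = ‖(x₀ + v) - (x₀ + v₀ : E n)‖ := by
        rw [add_sub_add_left_eq_sub]; rfl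
      rw [this]
      exact (norm_sub_le _ _).trans (by linarith)
  refine (measure_mono hsub).trans ((volume_tube_le U v₀ (by positivity) _).trans ?_)
  rw [mul_assoc, ← hA, ← ENNReal.ofReal_toReal hAtop, ← ENNReal.ofReal_mul (by positivity),
    ENNReal.toReal_ofReal ENNReal.toReal_nonneg]
  refine ENNReal.ofReal_le_ofReal ?_
  rw [mul_pow, mul_right_comm]
  have := pow_le_pow_of_le_one hδ.le hδ1 hU
  gcongr

/-! ### The divergence theorem on hyperplanes and half-hyperplanes -/

theorem integral_fderiv_apply_eq_zero {V : Type*} [NormedAddCommGroup V] [InnerProductSpace ℝ V]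
    [FiniteDimensional ℝ V] [MeasurableSpace V] [BorelSpace V] {f : V → ℝ}
    (hf : ContDiff ℝ 1 f) (hc : HasCompactSupport f) (v : V) :
    ∫ x, fderiv ℝ f x v = 0 := by
  have i1 : Integrable fun z => fderiv ℝ f z v := Continuous.integrable_of_hasCompactSupport
    ((hf.continuous_fderiv one_ne_zero).clm_apply continuous_const) (hc.fderiv_apply ℝ v)
  have i2 : Integrable f := hf.continuous.integrable_of_hasCompactSupport hc
  have := integral_mul_fderiv_eq_neg_fderiv_mul_of_integrable (𝕜 := ℝ) (E := V) (μ := volume)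
    (f := fun _ => (1 : ℝ)) (g := f) (v := v) (by simp) (by simpa using i1)
    (by simpa using i2) (fun x _ => differentiableAt_const _)
    (fun x _ => hf.differentiable one_ne_zero x)
  simpa using this

/-- The divergence theorem on a half-space, for a constant direction: only the component normal to
the boundary contributes. -/
theorem integral_halfSpace_fderiv {U : Type*} [NormedAddCommGroup U] [InnerProductSpace ℝ U]
    [FiniteDimensional ℝ U] [MeasurableSpace U] [BorelSpace U] {F : ℝ × U → ℝ}
    (hF : ContDiff ℝ 1 F) (hc : HasCompactSupport F) (t₀ : ℝ) (z₀ : U) :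
    ∫ q in Iio 0 ×ˢ univ, fderiv ℝ F q (t₀, z₀) ∂((volume : Measure ℝ).prod (volume : Measure U)) =
      t₀ * ∫ z, F (0, z) := by
  have hcont : Continuous (fun q => fderiv ℝ F q) := hF.continuous_fderiv one_ne_zero
  have hint : ∀ w : ℝ × U, Integrable (fun q => fderiv ℝ F q w)
      ((volume : Measure ℝ).prod (volume : Measure U)) := fun w =>
    Continuous.integrable_of_hasCompactSupport (by fun_prop) (hc.fderiv_apply ℝ w)
  have hsplit : ∀ q, fderiv ℝ F q (t₀, z₀) =
      t₀ * fderiv ℝ F q (1, 0) + fderiv ℝ F q (0, z₀) := by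
    intro q
    have : ((t₀, z₀) : ℝ × U) = t₀ • ((1, 0) : ℝ × U) + (0, z₀) := by simp
    rw [this, map_add, map_smul, smul_eq_mul]
  simp_rw [hsplit]
  rw [integral_add ((hint _).integrableOn.const_mul t₀) (hint _).integrableOn,
    integral_const_mul]
  have hdiff : ∀ q, HasFDerivAt F (fderiv ℝ F q) q := fun q =>
    (hF.differentiable one_ne_zero q).hasFDerivAt
  -- the tangential part integrates to zero on every slice parallel to the boundary
  have htan : ∫ q in Iio 0 ×ˢ univ, fderiv ℝ F q (0, z₀)
      ∂((volume : Measure ℝ).prod (volume : Measure U)) = 0 := by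
    rw [setIntegral_prod _ (hint _).integrableOn]
    refine integral_eq_zero_of_ae (Eventually.of_forall fun t => ?_)
    have hz : ∀ z, fderiv ℝ F (t, z) (0, z₀) = fderiv ℝ (fun z => F (t, z)) z z₀ := by
      intro z
      have : HasFDerivAt (F ∘ fun z => (t, z))
          ((fderiv ℝ F (t, z)).comp (ContinuousLinearMap.inr ℝ ℝ U)) z :=
        (hdiff (t, z)).comp z (hasFDerivAt_prodMk_right t z)
      change _ = fderiv ℝ (F ∘ fun z => (t, z)) z z₀
      rw [this.fderiv]; simp
    simp_rw [hz, setIntegral_univ]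
    have hFt : ContDiff ℝ 1 (fun z => F (t, z)) := hF.comp (by fun_prop)
    have hemb : IsClosedEmbedding (fun z : U => (t, z)) :=
      (Isometry.of_dist_eq fun x y => by simp [Prod.dist_eq]).isClosedEmbedding
    have hct : HasCompactSupport (fun z => F (t, z)) := hc.comp_isClosedEmbedding hemb
    exact integral_fderiv_apply_eq_zero hFt hct z₀
  rw [htan, add_zero]
  congr 1
  rw [← Measure.restrict_univ (μ := (volume : Measure U)), ← setIntegral_prod_swap,
    Measure.restrict_univ,
    setIntegral_prod (fun q : U × ℝ => fderiv ℝ F q.swap (1, 0)) (hint (1, 0)).swap.integrableOn,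
    setIntegral_univ]
  refine integral_congr_ae (Eventually.of_forall fun z => ?_)
  have ht : ∀ t, fderiv ℝ F (t, z) (1, 0) = deriv (fun t => F (t, z)) t := by
    intro t
    have : HasFDerivAt (F ∘ fun t => (t, z))
        ((fderiv ℝ F (t, z)).comp (ContinuousLinearMap.inl ℝ ℝ U)) t :=
      (hdiff (t, z)).comp t (hasFDerivAt_prodMk_left t z)
    change _ = deriv (F ∘ fun t => (t, z)) t
    rw [this.hasDerivAt.deriv]; simp
  simp only [Prod.swap_prod_mk, ht]
  rw [← integral_Iic_eq_integral_Iio]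
  have hemb : IsClosedEmbedding (fun t : ℝ => (t, z)) :=
    (Isometry.of_dist_eq fun x y => by simp [Prod.dist_eq]).isClosedEmbedding
  exact HasCompactSupport.integral_Iic_deriv_eq (hF.comp (by fun_prop))
    (hc.comp_isClosedEmbedding hemb) 0

theorem finrank_orthogonal_singleton {a : E n} (ha : ‖a‖ = 1) :
    Module.finrank ℝ (ℝ ∙ a)ᗮ = n - 1 := by
  have h := (ℝ ∙ a).finrank_add_finrank_orthogonal
  rw [finrank_span_singleton (by intro h; simp [h] at ha), finrank_euclideanSpace_fin] at h
  omega

theorem setIntegral_hyperplane_fderiv {a x₀ : E n} (ha : ‖a‖ = 1) {f : E n → ℝ}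
    (hf : ContDiff ℝ 1 f) (hc : HasCompactSupport f) {v : E n} (hv : inner ℝ a v = 0) :
    ∫ x in {x | inner ℝ a (x - x₀) = 0}, fderiv ℝ f x v ∂μHE[n - 1] = 0 := by
  have hmem : ∀ w : E n, w ∈ (ℝ ∙ a)ᗮ ↔ inner ℝ a w = 0 := fun w =>
    Submodule.mem_orthogonal_singleton_iff_inner_right
  have hpre : (fun w => x₀ + (ℝ ∙ a)ᗮ.subtypeₗᵢ w) ⁻¹' {x | inner ℝ a (x - x₀) = 0} = univ := by
    ext w
    simpa using (hmem w).1 w.2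
  rw [setIntegral_eq_integral_preimage x₀ (ℝ ∙ a)ᗮ.subtypeₗᵢ (finrank_orthogonal_singleton ha),
    hpre, setIntegral_univ]
  · have hd : ∀ w : (ℝ ∙ a)ᗮ, fderiv ℝ f (x₀ + (ℝ ∙ a)ᗮ.subtypeₗᵢ w) v =
        fderiv ℝ (f ∘ fun w => x₀ + (ℝ ∙ a)ᗮ.subtypeₗᵢ w) w ⟨v, (hmem v).2 hv⟩ := by
      intro w
      have h1 : HasFDerivAt (fun w => x₀ + (ℝ ∙ a)ᗮ.subtypeₗᵢ w) (ℝ ∙ a)ᗮ.subtypeL w :=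
        ((ℝ ∙ a)ᗮ.subtypeL.hasFDerivAt).const_add x₀
      have := (hf.differentiable one_ne_zero _).hasFDerivAt.comp w h1
      rw [this.fderiv]; rfl
    simp_rw [hd]
    refine integral_fderiv_apply_eq_zero ?_ ?_ _
    · exact hf.comp (contDiff_const.add (ℝ ∙ a)ᗮ.subtypeₗᵢ.contDiff)
    · exact hc.comp_isClosedEmbedding (isometry_const_add x₀ _).isClosedEmbedding
  · intro x hx
    exact ⟨⟨x - x₀, (hmem _).2 hx⟩, by simp⟩

/-- The parametrization `(t, z) ↦ t m + z` of the subspace spanned by a unit vector `m` and a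
subspace `U` orthogonal to it. -/
noncomputable def consIsometry (m : E n) (hm : ‖m‖ = 1) (U : Submodule ℝ (E n)) (hU : m ∈ Uᗮ) :
    WithLp 2 (ℝ × U) →ₗᵢ[ℝ] E n where
  toFun q := q.fst • m + q.snd
  map_add' q r := by simp [add_smul]; abel
  map_smul' c q := by simp [mul_smul]
  norm_map' q := by
    have h : inner ℝ (q.fst • m) (q.snd : E n) = 0 := by
      rw [inner_smul_left, Submodule.inner_left_of_mem_orthogonal q.snd.2 hU, mul_zero]
    have h1 := norm_add_sq_eq_norm_sq_add_norm_sq_real h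
    have h2 := WithLp.prod_norm_sq_eq_of_L2 q
    have h3 : ‖q.fst • m‖ = ‖q.fst‖ := by rw [norm_smul, hm, mul_one]
    simp only [LinearMap.coe_mk, AddHom.coe_mk]
    rw [← sq_eq_sq₀ (norm_nonneg _) (norm_nonneg _), h2, sq, h1, h3, Submodule.norm_coe]
    ring

theorem consIsometry_apply (m : E n) (hm : ‖m‖ = 1) (U : Submodule ℝ (E n)) (hU : m ∈ Uᗮ)
    (q : WithLp 2 (ℝ × U)) : consIsometry m hm U hU q = q.fst • m + q.snd := rfl

/-- The divergence theorem on a half-hyperplane `{⟨a, x - x₀⟩ = 0, ⟨m, x - x₀⟩ < 0}`, with outward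
unit conormal `m`, for a constant tangential direction. -/
theorem setIntegral_halfHyperplane_fderiv {a m x₀ : E n} (ha : ‖a‖ = 1) (hm : ‖m‖ = 1)
    (ham : inner ℝ a m = 0) {f : E n → ℝ} (hf : ContDiff ℝ 1 f) (hc : HasCompactSupport f)
    {v : E n} (hv : inner ℝ a v = 0) :
    ∫ x in {x | inner ℝ a (x - x₀) = 0 ∧ inner ℝ m (x - x₀) < 0}, fderiv ℝ f x v ∂μHE[n - 1] =
      inner ℝ m v *
        ∫ x in {x | inner ℝ a (x - x₀) = 0 ∧ inner ℝ m (x - x₀) = 0}, f x ∂μHE[n - 2] := by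
  set U : Submodule ℝ (E n) := (Submodule.span ℝ {a, m})ᗮ with hUdef
  have hmemU : ∀ w : E n, w ∈ U ↔ inner ℝ a w = 0 ∧ inner ℝ m w = 0 := by
    intro w
    rw [hUdef, Submodule.mem_orthogonal]
    constructor
    · intro h
      exact ⟨h a (Submodule.subset_span (by simp)), h m (Submodule.subset_span (by simp))⟩
    · rintro ⟨h1, h2⟩ u hu
      obtain ⟨r, s, rfl⟩ := Submodule.mem_span_pair.1 hu
      simp [inner_add_left, inner_smul_left, h1, h2]
  have hmm : inner ℝ m m = (1 : ℝ) := by rw [real_inner_self_eq_norm_sq, hm]; norm_num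
  have haa : inner ℝ a a = (1 : ℝ) := by rw [real_inner_self_eq_norm_sq, ha]; norm_num
  have hU : m ∈ Uᗮ := by
    rw [Submodule.mem_orthogonal]
    intro u hu
    rw [real_inner_comm]
    exact ((hmemU u).1 hu).2
  have hli : LinearIndependent ℝ ![a, m] := by
    rw [LinearIndependent.pair_iff]
    intro s t h
    constructor
    · simpa [inner_add_right, inner_smul_right, ham, ha] using congrArg (inner ℝ a) h
    · simpa [inner_add_right, inner_smul_right, (real_inner_comm a m).trans ham, hm] using
        congrArg (inner ℝ m) h
  have hrank : Module.finrank ℝ U + 2 = n := by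
    have h := (Submodule.span ℝ {a, m}).finrank_add_finrank_orthogonal
    rw [← hUdef] at h
    have h2 := finrank_span_eq_card hli
    rw [Matrix.range_cons, Matrix.range_cons, Matrix.range_empty, union_empty,
      singleton_union, Fintype.card_fin] at h2
    rw [h2, finrank_euclideanSpace_fin] at h
    omega
  set L := consIsometry m hm U hU
  have hLrank : Module.finrank ℝ (WithLp 2 (ℝ × U)) = n - 1 := by
    rw [LinearEquiv.finrank_eq (WithLp.linearEquiv 2 ℝ (ℝ × U)), Module.finrank_prod]
    simp; omega
  have hinL : ∀ q, inner ℝ a (L q) = 0 ∧ inner ℝ m (L q) = q.fst := by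
    intro q
    have := (hmemU q.snd).1 q.snd.2
    simp only [L, consIsometry_apply, inner_add_right, inner_smul_right, ham, hmm, this.1, this.2]
    simp
  have hdecomp : ∀ w : E n, inner ℝ a w = 0 → w - (inner ℝ m w : ℝ) • m ∈ U := by
    intro w hw
    rw [hmemU]
    simp [inner_sub_right, inner_smul_right, hw, ham, hm]
  rw [setIntegral_eq_integral_preimage x₀ L hLrank,
    setIntegral_eq_integral_preimage x₀ U.subtypeₗᵢ (d := n - 2) (by omega)]
  · have hpre : (fun w => x₀ + L w) ⁻¹'
        {x | inner ℝ a (x - x₀) = 0 ∧ inner ℝ m (x - x₀) < 0} = {q | q.fst < 0} := by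
      ext q
      simp [hinL q]
    have hpre2 : (fun w => x₀ + U.subtypeₗᵢ w) ⁻¹'
        {x | inner ℝ a (x - x₀) = 0 ∧ inner ℝ m (x - x₀) = 0} = univ := by
      ext q
      simpa using (hmemU q).1 q.2
    rw [hpre, hpre2, setIntegral_univ]
    set z₀ : U := ⟨v - (inner ℝ m v : ℝ) • m, hdecomp v hv⟩ with hz₀
    set F : ℝ × U → ℝ := fun q => f (x₀ + L (WithLp.toLp 2 q)) with hF
    have hto : ContDiff ℝ 1 (fun q : ℝ × U => x₀ + L (WithLp.toLp 2 q)) :=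
      contDiff_const.add (L.contDiff.comp (WithLp.prodContinuousLinearEquiv 2 ℝ ℝ U).symm.contDiff)
    have hFc : HasCompactSupport F :=
      hc.comp_isClosedEmbedding ((isometry_const_add x₀ L).isClosedEmbedding.comp
        (WithLp.prodContinuousLinearEquiv 2 ℝ ℝ U).symm.toHomeomorph.isClosedEmbedding)
    have key := integral_halfSpace_fderiv (hf.comp hto) hFc (inner ℝ m v) z₀
    have hmp := WithLp.volume_preserving_toLp ℝ U
    rw [← (hmp.setIntegral_preimage_emb
      (MeasurableEquiv.toLp 2 (ℝ × U)).measurableEmbedding)]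
    have hset : WithLp.toLp 2 ⁻¹' {q : WithLp 2 (ℝ × U) | q.fst < 0} = Iio 0 ×ˢ univ := by
      ext q; simp
    rw [hset]
    have hval : ∀ q : ℝ × U, fderiv ℝ f (x₀ + L (WithLp.toLp 2 q)) v =
        fderiv ℝ (f ∘ fun q : ℝ × U => x₀ + L (WithLp.toLp 2 q)) q (inner ℝ m v, z₀) := by
      intro q
      have h1 : HasFDerivAt (fun q : ℝ × U => x₀ + L (WithLp.toLp 2 q))
          (L.toContinuousLinearMap.comp
            (WithLp.prodContinuousLinearEquiv 2 ℝ ℝ U).symm.toContinuousLinearMap) q :=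
        ((L.toContinuousLinearMap.comp
            (WithLp.prodContinuousLinearEquiv 2 ℝ ℝ U).symm.toContinuousLinearMap
              ).hasFDerivAt).const_add x₀
      have h2 := (hf.differentiable one_ne_zero _).hasFDerivAt.comp q h1
      rw [h2.fderiv]
      have h3 : L (WithLp.toLp 2 (inner ℝ m v, z₀)) = v := by
        simp [L, consIsometry_apply, hz₀]
      conv_lhs => rw [← h3]
      rfl
    simp_rw [hval]
    refine key.trans ?_
    congr 1
    refine integral_congr_ae (Eventually.of_forall fun z => ?_)
    simp [L, consIsometry_apply]
  · intro x hx
    exact ⟨⟨x - x₀, (hmemU _).2 hx⟩, by simp⟩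
  · rintro x ⟨hx, -⟩
    exact ⟨WithLp.toLp 2 (inner ℝ m (x - x₀), ⟨_, hdecomp _ hx⟩),
      by simp [L, consIsometry_apply]⟩

end Flats

/-! ### Local cones -/

section LocalStructure

variable {n : ℕ} {P : Set (E n)} {x y a b c d : E n} {s s' : ℝ}

theorem abs_inner_lt_one (ha : ‖a‖ = 1) (hb : ‖b‖ = 1) (h1 : a ≠ b) (h2 : a ≠ -b) :
    |inner ℝ a b| < 1 := by
  have hle : inner ℝ a b < (1 : ℝ) := inner_lt_one_iff_real_of_norm_eq_one ha hb |>.2 h1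
  have hge := inner_lt_one_iff_real_of_norm_eq_one ha (by rwa [norm_neg] : ‖-b‖ = 1) |>.2 h2
  rw [inner_neg_right] at hge
  exact abs_lt.2 ⟨by linarith, hle⟩

theorem mul_nonpos_iff_right_of_pos {t r : ℝ} (ht : 0 < t) : t * r ≤ 0 ↔ r ≤ 0 :=
  ⟨fun h => not_lt.1 fun hr => h.not_gt (mul_pos ht hr), mul_nonpos_of_nonneg_of_nonpos ht.le⟩

theorem inner_self_of_norm_one (ha : ‖a‖ = 1) : inner ℝ a a = (1 : ℝ) := by
  rw [real_inner_self_eq_norm_sq, ha, one_pow]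

/-- A property of `y - x` invariant under positive dilations that holds for `y` near `x` holds
everywhere. -/
theorem forall_of_eventually_sub {p : E n → Prop} (hp : ∀ t : ℝ, 0 < t → ∀ z, p (t • z) → p z)
    (h : ∀ᶠ y in 𝓝 x, p (y - x)) (z : E n) : p z := by
  have hlim : Tendsto (fun t : ℝ => x + t • z) (𝓝[>] 0) (𝓝 x) := by
    have : Continuous fun t : ℝ => x + t • z := by fun_prop
    simpa using (this.tendsto 0).mono_left nhdsWithin_le_nhds
  obtain ⟨t, ht, ht0⟩ := ((hlim.eventually h).and self_mem_nhdsWithin).exists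
  rw [add_sub_cancel_left] at ht
  exact hp t ht0 z ht

theorem eventually_inner_lt {r : ℝ} (h : inner ℝ a (y - x) < r) :
    ∀ᶠ z in 𝓝 y, inner ℝ a (z - x) < r :=
  (Continuous.tendsto (by fun_prop : Continuous fun z : E n => inner ℝ a (z - x))
    y).eventually_lt_const h

theorem eventually_lt_inner {r : ℝ} (h : r < inner ℝ a (y - x)) :
    ∀ᶠ z in 𝓝 y, r < inner ℝ a (z - x) :=
  (Continuous.tendsto (by fun_prop : Continuous fun z : E n => inner ℝ a (z - x))
    y).eventually_const_lt h

theorem inner_sub_eq_of_inner_sub_eq_zero (h : inner ℝ a (y - x) = 0) (z : E n) :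
    inner ℝ a (z - x) = inner ℝ a (z - y) := by
  have : z - x = (z - y) + (y - x) := by abel
  rw [this, inner_add_right, h, add_zero]

theorem notMem_frontier_of_eventually_mem (h : ∀ᶠ z in 𝓝 y, z ∈ P) : y ∉ frontier P := fun hy =>
  hy.2 (mem_interior_iff_mem_nhds.2 h)

theorem notMem_frontier_of_eventually_notMem (h : ∀ᶠ z in 𝓝 y, z ∉ P) : y ∉ frontier P := by
  intro hy
  obtain ⟨z, hz1, hz2⟩ := ((mem_closure_iff_frequently.1 hy.1).and_eventually h).exists
  exact hz2 hz1

/-! ### Face points -/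

/-- The outward normal at a face point is unique: distinct unit vectors define distinct
half-spaces. -/
theorem IsFacePoint.unique (h : IsFacePoint P x a) (h' : IsFacePoint P x b) : a = b := by
  have key : ∀ z : E n, (inner ℝ a z ≤ 0 ↔ inner ℝ b z ≤ 0) := by
    refine forall_of_eventually_sub (x := x)
      (p := fun z => inner ℝ a z ≤ 0 ↔ inner ℝ b z ≤ 0) ?_ ?_
    · intro t ht z hz
      simpa only [inner_smul_right, mul_nonpos_iff_right_of_pos ht] using hz
    · filter_upwards [h.2, h'.2] with y h1 h2
      rw [← h1, h2]
  by_contra hne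
  by_cases hneg : a = -b
  · have := key (-a)
    rw [hneg] at this
    simp [h'.1] at this
    linarith
  have hlt := abs_inner_lt_one h.1 h'.1 hne hneg
  -- the component of `b` orthogonal to `a` lies in one closed half-space but not in the other
  have := key (b - (inner ℝ a b : ℝ) • a)
  simp only [inner_sub_right, inner_smul_right, inner_self_of_norm_one h.1,
    inner_self_of_norm_one h'.1, real_inner_comm a b, mul_one, sub_self, le_refl, true_iff] at this
  nlinarith [abs_lt.1 hlt]

/-- Near a face point, the boundary is a hyperplane made of face points. -/
theorem IsFacePoint.exists_ball (h : IsFacePoint P x a) :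
    ∃ r > 0, ∀ y ∈ Metric.ball x r, (inner ℝ a (y - x) = 0 → IsFacePoint P y a) ∧
      (y ∈ frontier P → inner ℝ a (y - x) = 0) := by
  obtain ⟨r, hr, hball⟩ := Metric.eventually_nhds_iff_ball.1 h.2
  refine ⟨r, hr, fun y hy => ⟨fun h0 => ⟨h.1, ?_⟩, fun hf => ?_⟩⟩
  · filter_upwards [Metric.isOpen_ball.mem_nhds hy] with z hz
    rw [hball z hz, inner_sub_eq_of_inner_sub_eq_zero h0]
  · by_contra hne
    rcases lt_or_gt_of_ne hne with hlt | hgt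
    · refine notMem_frontier_of_eventually_mem ?_ hf
      filter_upwards [Metric.isOpen_ball.mem_nhds hy, eventually_inner_lt hlt] with z hz h1
      exact (hball z hz).2 h1.le
    · refine notMem_frontier_of_eventually_notMem ?_ hf
      filter_upwards [Metric.isOpen_ball.mem_nhds hy, eventually_lt_inner hgt] with z hz h1 h2
      exact ((hball z hz).1 h2).not_gt h1

/-- Points at which `P` is locally a half-space or a wedge are boundary points. -/
theorem mem_frontier_of_cone {Q : E n → Prop} (h : ∀ᶠ y in 𝓝 x, (y ∈ P ↔ Q (y - x)))
    (hQ : ∀ t : ℝ, 0 < t → ∀ z, Q (t • z) ↔ Q z) {v w : E n} (hv : Q v) (hw : ¬ Q w) :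
    x ∈ frontier P := by
  have hlim : ∀ z : E n, Tendsto (fun t : ℝ => x + t • z) (𝓝[>] 0) (𝓝 x) := fun z => by
    have : Continuous fun t : ℝ => x + t • z := by fun_prop
    simpa using (this.tendsto 0).mono_left nhdsWithin_le_nhds
  have key : ∀ z : E n, ∀ᶠ t : ℝ in 𝓝[>] 0, (x + t • z ∈ P ↔ Q z) := fun z => by
    filter_upwards [(hlim z).eventually h, self_mem_nhdsWithin] with t h1 h2
    rw [h1, add_sub_cancel_left, hQ t h2]
  constructor
  · refine mem_closure_of_tendsto (hlim v) ?_
    filter_upwards [key v] with t ht using ht.2 hv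
  · intro hint
    obtain ⟨t, h1, h2⟩ := ((key w).and ((hlim w).eventually
      (mem_interior_iff_mem_nhds.1 hint))).exists
    exact hw (h1.1 h2)

theorem IsFacePoint.mem_frontier (h : IsFacePoint P x a) : x ∈ frontier P := by
  refine mem_frontier_of_cone (Q := fun z => inner ℝ a z ≤ 0) h.2 (fun t ht z => ?_) (v := 0)
    (w := a) (by simp) (by simp [h.1])
  rw [inner_smul_right, mul_nonpos_iff_right_of_pos ht]

theorem outwardNormal_eq (h : IsFacePoint P x a) : outwardNormal P x = a := by
  have hex : ∃ a, IsFacePoint P x a := ⟨a, h⟩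
  rw [outwardNormal, dif_pos hex]
  exact hex.choose_spec.unique h

theorem IsFacePoint.eventually_eq (h : IsFacePoint P x a) :
    ∀ᶠ y in 𝓝 x, ∀ d, IsFacePoint P y d → d = a := by
  obtain ⟨r, hr, hball⟩ := h.exists_ball
  filter_upwards [Metric.ball_mem_nhds x hr] with y hy d hd
  exact hd.unique ((hball y hy).1 ((hball y hy).2 hd.mem_frontier))

/-! ### Edge points -/

/-- `x` is an edge point with outward normals `a`, `b`, at which `P` is convex if `s = 1` and
non-convex if `s = -1`. -/
def IsSignedEdgePoint (P : Set (E n)) (s : ℝ) (x a b : E n) : Prop :=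
  (s = 1 ∧ IsConvexEdgePoint P x a b) ∨ (s = -1 ∧ IsConcaveEdgePoint P x a b)

theorem isEdgePoint_iff : IsEdgePoint P x a b ↔ ∃ s, IsSignedEdgePoint P s x a b := by
  simp [IsEdgePoint, IsSignedEdgePoint, exists_or]

namespace IsSignedEdgePoint

theorem symm (h : IsSignedEdgePoint P s x a b) : IsSignedEdgePoint P s x b a := by
  rcases h with ⟨hs, h1, h2, h3, h4, h5⟩ | ⟨hs, h1, h2, h3, h4, h5⟩
  · refine Or.inl ⟨hs, h2, h1, h3.symm, fun h => h4 (by rw [h, neg_neg]), ?_⟩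
    simpa only [and_comm] using h5
  · refine Or.inr ⟨hs, h2, h1, h3.symm, fun h => h4 (by rw [h, neg_neg]), ?_⟩
    simpa only [or_comm] using h5

theorem norm_left (h : IsSignedEdgePoint P s x a b) : ‖a‖ = 1 := by
  rcases h with ⟨-, h⟩ | ⟨-, h⟩ <;> exact h.1

theorem norm_right (h : IsSignedEdgePoint P s x a b) : ‖b‖ = 1 := h.symm.norm_left

theorem abs_inner_lt_one (h : IsSignedEdgePoint P s x a b) : |inner ℝ a b| < 1 := by
  rcases h with ⟨-, h1, h2, h3, h4, -⟩ | ⟨-, h1, h2, h3, h4, -⟩ <;>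
  exact PolyhedralMass.abs_inner_lt_one h1 h2 h3 h4

theorem ne (h : IsSignedEdgePoint P s x a b) : a ≠ b := by
  rcases h with ⟨-, h⟩ | ⟨-, h⟩ <;> exact h.2.2.1

theorem sign_eq (h : IsSignedEdgePoint P s x a b) : s = 1 ∨ s = -1 := h.imp And.left And.left

theorem mem_frontier (h : IsSignedEdgePoint P s x a b) : x ∈ frontier P := by
  have hlt := abs_lt.1 h.abs_inner_lt_one
  have haa := inner_self_of_norm_one h.norm_left
  have hbb := inner_self_of_norm_one h.norm_right
  rcases h with ⟨-, -, -, -, -, h5⟩ | ⟨-, -, -, -, -, h5⟩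
  · refine mem_frontier_of_cone (Q := fun z => inner ℝ a z ≤ 0 ∧ inner ℝ b z ≤ 0) h5
      (fun t ht z => ?_) (v := 0) (w := a) (by simp) (by rw [haa]; norm_num)
    rw [inner_smul_right, inner_smul_right, mul_nonpos_iff_right_of_pos ht,
      mul_nonpos_iff_right_of_pos ht]
  · refine mem_frontier_of_cone (Q := fun z => inner ℝ a z ≤ 0 ∨ inner ℝ b z ≤ 0) h5
      (fun t ht z => ?_) (v := 0) (w := a + b) (by simp) ?_
    · rw [inner_smul_right, inner_smul_right, mul_nonpos_iff_right_of_pos ht,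
        mul_nonpos_iff_right_of_pos ht]
    · simp only [inner_add_right, haa, hbb, real_inner_comm a b]
      rintro (h | h) <;> linarith

/-- Near an edge point, the boundary is the union of two half-hyperplanes, whose relative
interiors consist of face points, and whose common boundary consists of edge points. -/
theorem exists_ball (h : IsSignedEdgePoint P s x a b) :
    ∃ r > 0, ∀ y ∈ Metric.ball x r,
      (inner ℝ a (y - x) = 0 → s * inner ℝ b (y - x) < 0 → IsFacePoint P y a) ∧
      (inner ℝ b (y - x) = 0 → s * inner ℝ a (y - x) < 0 → IsFacePoint P y b) ∧
      (inner ℝ a (y - x) = 0 → inner ℝ b (y - x) = 0 → IsSignedEdgePoint P s y a b) ∧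
      (y ∈ frontier P → (inner ℝ a (y - x) = 0 ∧ s * inner ℝ b (y - x) ≤ 0) ∨
        (inner ℝ b (y - x) = 0 ∧ s * inner ℝ a (y - x) ≤ 0)) := by
  rcases h with ⟨rfl, h1, h2, h3, h4, h5⟩ | ⟨rfl, h1, h2, h3, h4, h5⟩
  · obtain ⟨r, hr, hball⟩ := Metric.eventually_nhds_iff_ball.1 h5
    refine ⟨r, hr, fun y hy => ⟨fun e1 e2 => ⟨h1, ?_⟩, fun e1 e2 => ⟨h2, ?_⟩, fun e1 e2 =>
      Or.inl ⟨rfl, h1, h2, h3, h4, ?_⟩, fun hf => ?_⟩⟩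
    · rw [one_mul] at e2
      filter_upwards [Metric.isOpen_ball.mem_nhds hy, eventually_inner_lt e2] with z hz hz2
      rw [hball z hz, ← inner_sub_eq_of_inner_sub_eq_zero e1, and_iff_left hz2.le]
    · rw [one_mul] at e2
      filter_upwards [Metric.isOpen_ball.mem_nhds hy, eventually_inner_lt e2] with z hz hz2
      rw [hball z hz, ← inner_sub_eq_of_inner_sub_eq_zero e1, and_iff_right hz2.le]
    · filter_upwards [Metric.isOpen_ball.mem_nhds hy] with z hz
      rw [hball z hz, inner_sub_eq_of_inner_sub_eq_zero e1, inner_sub_eq_of_inner_sub_eq_zero e2]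
    · simp only [one_mul]
      have hna : ¬ 0 < inner ℝ a (y - x) := fun hlt => by
        refine notMem_frontier_of_eventually_notMem ?_ hf
        filter_upwards [Metric.isOpen_ball.mem_nhds hy, eventually_lt_inner hlt] with z hz g1 g2
        exact ((hball z hz).1 g2).1.not_gt g1
      have hnb : ¬ 0 < inner ℝ b (y - x) := fun hlt => by
        refine notMem_frontier_of_eventually_notMem ?_ hf
        filter_upwards [Metric.isOpen_ball.mem_nhds hy, eventually_lt_inner hlt] with z hz g1 g2
        exact ((hball z hz).1 g2).2.not_gt g1
      have hnab : ¬ (inner ℝ a (y - x) < 0 ∧ inner ℝ b (y - x) < 0) := fun ⟨l1, l2⟩ => by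
        refine notMem_frontier_of_eventually_mem ?_ hf
        filter_upwards [Metric.isOpen_ball.mem_nhds hy, eventually_inner_lt l1,
          eventually_inner_lt l2] with z hz g1 g2
        exact (hball z hz).2 ⟨g1.le, g2.le⟩
      clear hball hf h5
      generalize inner ℝ a (y - x) = p at *
      generalize inner ℝ b (y - x) = q at *
      grind
  · obtain ⟨r, hr, hball⟩ := Metric.eventually_nhds_iff_ball.1 h5
    refine ⟨r, hr, fun y hy => ⟨fun e1 e2 => ⟨h1, ?_⟩, fun e1 e2 => ⟨h2, ?_⟩, fun e1 e2 =>
      Or.inr ⟨rfl, h1, h2, h3, h4, ?_⟩, fun hf => ?_⟩⟩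
    · have e2 : 0 < inner ℝ b (y - x) := by linarith
      filter_upwards [Metric.isOpen_ball.mem_nhds hy, eventually_lt_inner e2] with z hz hz2
      rw [hball z hz, ← inner_sub_eq_of_inner_sub_eq_zero e1, or_iff_left hz2.not_ge]
    · have e2 : 0 < inner ℝ a (y - x) := by linarith
      filter_upwards [Metric.isOpen_ball.mem_nhds hy, eventually_lt_inner e2] with z hz hz2
      rw [hball z hz, ← inner_sub_eq_of_inner_sub_eq_zero e1, or_iff_right hz2.not_ge]
    · filter_upwards [Metric.isOpen_ball.mem_nhds hy] with z hz
      rw [hball z hz, inner_sub_eq_of_inner_sub_eq_zero e1, inner_sub_eq_of_inner_sub_eq_zero e2]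
    · have hna : ¬ inner ℝ a (y - x) < 0 := fun hlt => by
        refine notMem_frontier_of_eventually_mem ?_ hf
        filter_upwards [Metric.isOpen_ball.mem_nhds hy, eventually_inner_lt hlt] with z hz g1
        exact (hball z hz).2 (Or.inl g1.le)
      have hnb : ¬ inner ℝ b (y - x) < 0 := fun hlt => by
        refine notMem_frontier_of_eventually_mem ?_ hf
        filter_upwards [Metric.isOpen_ball.mem_nhds hy, eventually_inner_lt hlt] with z hz g1
        exact (hball z hz).2 (Or.inr g1.le)
      have hnab : ¬ (0 < inner ℝ a (y - x) ∧ 0 < inner ℝ b (y - x)) := fun ⟨l1, l2⟩ => by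
        refine notMem_frontier_of_eventually_notMem ?_ hf
        filter_upwards [Metric.isOpen_ball.mem_nhds hy, eventually_lt_inner l1,
          eventually_lt_inner l2] with z hz g1 g2 g3
        rcases (hball z hz).1 g3 with g | g
        · exact g.not_gt g1
        · exact g.not_gt g2
      clear hball hf h5
      generalize inner ℝ a (y - x) = p at *
      generalize inner ℝ b (y - x) = q at *
      grind

/-- Both faces at an edge accumulate at every point of the edge, so that the local structure of
`P` determines their normals. -/
theorem frequently_isFacePoint (h : IsSignedEdgePoint P s x a b) :
    ∃ᶠ y in 𝓝 x, IsFacePoint P y a ∧ inner ℝ a (y - x) = 0 := by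
  obtain ⟨r, hr, hball⟩ := h.exists_ball
  have hlt := abs_lt.1 h.abs_inner_lt_one
  have haa := inner_self_of_norm_one h.norm_left
  have hbb := inner_self_of_norm_one h.norm_right
  -- the direction in the face with normal `a` that points away from the edge
  set v : E n := s • ((inner ℝ a b : ℝ) • a - b) with hv
  have hav : inner ℝ a v = 0 := by
    rw [hv, inner_smul_right, inner_sub_right, inner_smul_right, haa]; ring
  have hbv : s * inner ℝ b v < 0 := by
    rw [hv, inner_smul_right, inner_sub_right, inner_smul_right, hbb, real_inner_comm a b]
    rcases h.sign_eq with rfl | rfl <;> nlinarith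
  have hlim : Tendsto (fun t : ℝ => x + t • v) (𝓝[>] 0) (𝓝 x) := by
    have : Continuous fun t : ℝ => x + t • v := by fun_prop
    simpa using (this.tendsto 0).mono_left nhdsWithin_le_nhds
  refine hlim.frequently (Eventually.frequently ?_)
  filter_upwards [hlim.eventually (Metric.ball_mem_nhds x hr), self_mem_nhdsWithin] with t h1 h2
  have h0 : inner ℝ a (x + t • v - x) = 0 := by
    rw [add_sub_cancel_left, inner_smul_right, hav, mul_zero]
  refine ⟨(hball _ h1).1 h0 ?_, h0⟩
  rw [add_sub_cancel_left, inner_smul_right, mul_left_comm]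
  exact mul_neg_of_pos_of_neg h2 hbv

theorem not_isFacePoint (h : IsSignedEdgePoint P s x a b) : ¬ IsFacePoint P x c := by
  intro hc
  obtain ⟨y, hy1, hy2⟩ := (h.frequently_isFacePoint.and_eventually hc.eventually_eq).exists
  obtain ⟨z, hz1, hz2⟩ := (h.symm.frequently_isFacePoint.and_eventually hc.eventually_eq).exists
  exact h.ne ((hy2 _ hy1.1).trans (hz2 _ hz1.1).symm)

theorem eventually_eq (h : IsSignedEdgePoint P s x a b) :
    ∀ᶠ y in 𝓝 x, ∀ d, IsFacePoint P y d → d = a ∨ d = b := by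
  obtain ⟨r, hr, hball⟩ := h.exists_ball
  filter_upwards [Metric.ball_mem_nhds x hr] with y hy d hd
  obtain ⟨h1, h2, h3, h4⟩ := hball y hy
  rcases h4 hd.mem_frontier with ⟨e, e'⟩ | ⟨e, e'⟩
  · rcases e'.lt_or_eq with e' | e'
    · exact Or.inl (hd.unique (h1 e e'))
    · have : inner ℝ b (y - x) = (0 : ℝ) := by rcases h.sign_eq with rfl | rfl <;> linarith
      exact absurd hd (h3 e this).not_isFacePoint
  · rcases e'.lt_or_eq with e' | e'
    · exact Or.inr (hd.unique (h2 e e'))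
    · have : inner ℝ a (y - x) = (0 : ℝ) := by rcases h.sign_eq with rfl | rfl <;> linarith
      exact absurd hd (h3 this e).not_isFacePoint

/-- A normal at an edge point is the normal of nearby face points, hence one of any other pair of
normals at that point. -/
theorem left_mem (h : IsSignedEdgePoint P s x a b) (h' : IsSignedEdgePoint P s' x c d) :
    a = c ∨ a = d := by
  obtain ⟨y, hy1, hy2⟩ := (h.frequently_isFacePoint.and_eventually h'.eventually_eq).exists
  exact hy2 _ hy1.1

theorem pair_eq (h : IsSignedEdgePoint P s x a b) (h' : IsSignedEdgePoint P s' x c d) :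
    (c = a ∧ d = b) ∨ (c = b ∧ d = a) := by
  have h1 := h.left_mem h'
  have h2 := h.symm.left_mem h'
  have h3 := h.ne
  grind

/-- No set is locally both the intersection and the union of two half-spaces: the direction
`b - a` leads into the union but not into the intersection. -/
theorem not_convex_and_concave (h : IsConvexEdgePoint P x a b) :
    ¬ IsConcaveEdgePoint P x a b := by
  intro h'
  have hlt := abs_lt.1 (PolyhedralMass.abs_inner_lt_one h.1 h.2.1 h.2.2.1 h.2.2.2.1)
  have haa := inner_self_of_norm_one h.1
  have hbb := inner_self_of_norm_one h.2.1
  have hlim : Tendsto (fun t : ℝ => x + t • (b - a)) (𝓝[>] 0) (𝓝 x) := by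
    have : Continuous fun t : ℝ => x + t • (b - a) := by fun_prop
    simpa using (this.tendsto 0).mono_left nhdsWithin_le_nhds
  obtain ⟨t, h1, h2, ht⟩ := ((hlim.eventually h.2.2.2.2).and ((hlim.eventually h'.2.2.2.2).and
    self_mem_nhdsWithin)).exists
  have ht : 0 < t := ht
  rw [h1] at h2
  simp only [add_sub_cancel_left, inner_smul_right, inner_sub_right, haa, hbb,
    real_inner_comm a b] at h2
  have := (h2.2 (Or.inl (by nlinarith))).2
  nlinarith

theorem sign_unique (h : IsSignedEdgePoint P s x a b) (h' : IsSignedEdgePoint P s' x c d) :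
    s = s' := by
  have key : ∀ {a b c d}, IsConvexEdgePoint P x a b → IsConcaveEdgePoint P x c d → False := by
    intro a b c d h1 h2
    have e1 : IsSignedEdgePoint P 1 x a b := Or.inl ⟨rfl, h1⟩
    have e2 : IsSignedEdgePoint P (-1) x c d := Or.inr ⟨rfl, h2⟩
    rcases e1.pair_eq e2 with ⟨rfl, rfl⟩ | ⟨rfl, rfl⟩
    · exact not_convex_and_concave h1 h2
    · rcases e2.symm with ⟨h, -⟩ | ⟨-, h⟩
      · norm_num at h
      · exact not_convex_and_concave h1 h
  rcases h with ⟨rfl, h⟩ | ⟨rfl, h⟩ <;> rcases h' with ⟨rfl, h'⟩ | ⟨rfl, h'⟩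
  · rfl
  · exact (key h h').elim
  · exact (key h' h).elim
  · rfl

theorem isEdgePoint_iff (h : IsSignedEdgePoint P s x a b) :
    IsEdgePoint P x c d ↔ (c = a ∧ d = b) ∨ (c = b ∧ d = a) := by
  rw [PolyhedralMass.isEdgePoint_iff]
  constructor
  · rintro ⟨s', h'⟩
    exact h.pair_eq h'
  · rintro (⟨rfl, rfl⟩ | ⟨rfl, rfl⟩)
    · exact ⟨s, h⟩
    · exact ⟨s, h.symm⟩

/-- Along an edge, `edgeNormals` chooses the same ordered pair: the choice depends only on the
predicate that the pair satisfies. -/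
theorem edgeNormals_congr (hx : IsSignedEdgePoint P s x a b) (hy : IsSignedEdgePoint P s' y a b) :
    edgeNormals P x = edgeNormals P y := by
  have : (fun q : E n × E n => IsEdgePoint P x q.1 q.2) = fun q => IsEdgePoint P y q.1 q.2 := by
    funext q
    rw [hx.isEdgePoint_iff, hy.isEdgePoint_iff]
  have e : ∀ p p' : E n × E n → Prop, p = p' →
      (open Classical in if h : ∃ q, p q then h.choose else 0) =
      (open Classical in if h : ∃ q, p' q then h.choose else 0) := by
    rintro p _ rfl; rfl
  exact e _ _ this

theorem edgeNormals_eq (h : IsSignedEdgePoint P s x a b) :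
    edgeNormals P x = (a, b) ∨ edgeNormals P x = (b, a) := by
  have hex : ∃ q : E n × E n, IsEdgePoint P x q.1 q.2 :=
    ⟨(a, b), PolyhedralMass.isEdgePoint_iff.2 ⟨s, h⟩⟩
  have hq := hex.choose_spec
  have e : edgeNormals P x = hex.choose := by rw [edgeNormals, dif_pos hex]
  rw [h.isEdgePoint_iff, ← e] at hq
  rcases hq with ⟨h1, h2⟩ | ⟨h1, h2⟩
  · exact Or.inl (Prod.ext h1 h2)
  · exact Or.inr (Prod.ext h1 h2)

theorem at_edgeNormals (h : IsSignedEdgePoint P s x a b) :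
    IsSignedEdgePoint P s x (edgeNormals P x).1 (edgeNormals P x).2 := by
  rcases h.edgeNormals_eq with e | e <;> rw [e]
  · exact h
  · exact h.symm

end IsSignedEdgePoint

open Classical in
/-- `1` at edge points where `P` is convex, `-1` at the others. -/
noncomputable def edgeSign (P : Set (E n)) (x : E n) : ℝ :=
  if IsConvexEdgePoint P x (edgeNormals P x).1 (edgeNormals P x).2 then 1 else -1

theorem IsSignedEdgePoint.edgeSign_eq (h : IsSignedEdgePoint P s x a b) : edgeSign P x = s := by
  unfold edgeSign
  split_ifs with hc
  · exact IsSignedEdgePoint.sign_unique (Or.inl ⟨rfl, hc⟩) h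
  · rcases h.at_edgeNormals with ⟨-, h'⟩ | ⟨h', -⟩
    · exact absurd h' hc
    · exact h'.symm

/-- The two cases of the dihedral angle, `π - θ` and `π + θ`, in terms of the sign of the edge. -/
theorem dihedralAngle_eq (P : Set (E n)) (G : Matrix (Fin n) (Fin n) ℝ) (x : E n) :
    dihedralAngle P G x =
      Real.pi - edgeSign P x * normalAngle G (edgeNormals P x).1 (edgeNormals P x).2 := by
  unfold dihedralAngle edgeSign
  split_ifs <;> ring

end LocalStructure

/-! ### The measure of the boundary and of the edges -/

section Boundary

variable {n : ℕ} {P : Set (E n)} {x y a b c d : E n} {s s' : ℝ}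

theorem faces_subset_frontier (P : Set (E n)) : faces P ⊆ frontier P :=
  fun _ ⟨_, h⟩ => h.mem_frontier

theorem edges_subset_frontier (P : Set (E n)) : edges P ⊆ frontier P := by
  rintro x ⟨a, b, h⟩
  obtain ⟨s, h⟩ := isEdgePoint_iff.1 h
  exact h.mem_frontier

theorem IsSignedEdgePoint.mem_edges (h : IsSignedEdgePoint P s x a b) : x ∈ edges P :=
  ⟨a, b, PolyhedralMass.isEdgePoint_iff.2 ⟨s, h⟩⟩

theorem exists_of_mem_edges (h : x ∈ edges P) : ∃ s a b, IsSignedEdgePoint P s x a b := by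
  obtain ⟨a, b, h⟩ := h
  obtain ⟨s, h⟩ := isEdgePoint_iff.1 h
  exact ⟨s, a, b, h⟩

theorem disjoint_faces_edges (P : Set (E n)) : Disjoint (faces P) (edges P) := by
  rw [Set.disjoint_left]
  rintro x ⟨c, hc⟩ hx
  obtain ⟨s, a, b, h⟩ := exists_of_mem_edges hx
  exact h.not_isFacePoint hc

/-- A relatively open subset of a closed set is measurable. -/
theorem measurableSet_of_relatively_open {F S : Set (E n)} (hF : IsClosed F) (hS : S ⊆ F)
    (h : ∀ x ∈ S, ∃ r > 0, Metric.ball x r ∩ F ⊆ S) : MeasurableSet S := by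
  choose! r hr hsub using h
  have : S = F ∩ ⋃ x ∈ S, Metric.ball x (r x) := by
    ext y
    simp only [mem_inter_iff, mem_iUnion]
    constructor
    · exact fun hy => ⟨hS hy, y, hy, Metric.mem_ball_self (hr y hy)⟩
    · rintro ⟨hy, x, hx, hyx⟩
      exact hsub x hx ⟨hyx, hy⟩
  rw [this]
  exact hF.measurableSet.inter (isOpen_biUnion fun _ _ => Metric.isOpen_ball).measurableSet

theorem exists_ball_inter_subset_faces (h : x ∈ faces P) :
    ∃ r > 0, Metric.ball x r ∩ frontier P ⊆ faces P := by
  obtain ⟨a, h⟩ := h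
  obtain ⟨r, hr, hb⟩ := h.exists_ball
  exact ⟨r, hr, fun y hy => ⟨a, (hb y hy.1).1 ((hb y hy.1).2 hy.2)⟩⟩

theorem exists_ball_inter_subset_edges (h : x ∈ edges P) :
    ∃ r > 0, Metric.ball x r ∩ frontier P ⊆ faces P ∪ edges P := by
  obtain ⟨s, a, b, h⟩ := exists_of_mem_edges h
  obtain ⟨r, hr, hb⟩ := h.exists_ball
  refine ⟨r, hr, fun y ⟨hy, hyf⟩ => ?_⟩
  obtain ⟨h1, h2, h3, h4⟩ := hb y hy
  have hs : ∀ {t : ℝ}, s * t = 0 → t = 0 := fun {t} ht => by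
    rcases h.sign_eq with rfl | rfl <;> linarith
  rcases h4 hyf with ⟨e, e'⟩ | ⟨e, e'⟩ <;> rcases e'.lt_or_eq with e' | e'
  · exact Or.inl ⟨a, h1 e e'⟩
  · exact Or.inr (h3 e (hs e')).mem_edges
  · exact Or.inl ⟨b, h2 e e'⟩
  · exact Or.inr (h3 (hs e') e).mem_edges

theorem exists_ball_inter_subset_faces_union_edges (h : x ∈ faces P ∪ edges P) :
    ∃ r > 0, Metric.ball x r ∩ frontier P ⊆ faces P ∪ edges P := by
  rcases h with h | h
  · obtain ⟨r, hr, h⟩ := exists_ball_inter_subset_faces h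
    exact ⟨r, hr, h.trans subset_union_left⟩
  · exact exists_ball_inter_subset_edges h

theorem measurableSet_faces (P : Set (E n)) : MeasurableSet (faces P) :=
  measurableSet_of_relatively_open isClosed_frontier (faces_subset_frontier P)
    fun _ => exists_ball_inter_subset_faces

theorem measurableSet_edges (P : Set (E n)) : MeasurableSet (edges P) := by
  have h : MeasurableSet (faces P ∪ edges P) :=
    measurableSet_of_relatively_open isClosed_frontier
      (union_subset (faces_subset_frontier P) (edges_subset_frontier P))
      fun _ => exists_ball_inter_subset_faces_union_edges
  rw [← (disjoint_faces_edges P).sup_sdiff_cancel_left]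
  exact h.diff (measurableSet_faces P)

theorem eventually_outwardNormal_eq (h : x ∈ faces P) :
    ∀ᶠ y in 𝓝[faces P] x, outwardNormal P y = outwardNormal P x := by
  obtain ⟨a, h⟩ := h
  filter_upwards [nhdsWithin_le_nhds h.eventually_eq, self_mem_nhdsWithin] with y hy ⟨d, hd⟩
  rw [outwardNormal_eq hd, outwardNormal_eq h, hy d hd]

theorem eventually_isSignedEdgePoint (h : IsSignedEdgePoint P s x a b) :
    ∀ᶠ y in 𝓝[edges P] x, IsSignedEdgePoint P s y a b := by
  obtain ⟨r, hr, hb⟩ := h.exists_ball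
  filter_upwards [nhdsWithin_le_nhds (Metric.ball_mem_nhds x hr), self_mem_nhdsWithin] with y hy hye
  obtain ⟨h1, h2, h3, h4⟩ := hb y hy
  have hs : ∀ {t : ℝ}, s * t = 0 → t = 0 := fun {t} ht => by
    rcases h.sign_eq with rfl | rfl <;> linarith
  have hd := Set.disjoint_left.1 (disjoint_faces_edges P)
  rcases h4 (edges_subset_frontier P hye) with ⟨e, e'⟩ | ⟨e, e'⟩ <;>
    rcases e'.lt_or_eq with e' | e'
  · exact absurd hye (hd ⟨a, h1 e e'⟩)
  · exact h3 e (hs e')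
  · exact absurd hye (hd ⟨b, h2 e e'⟩)
  · exact h3 (hs e') e

theorem eventually_edgeNormals_eq (h : x ∈ edges P) :
    ∀ᶠ y in 𝓝[edges P] x, edgeNormals P y = edgeNormals P x ∧ edgeSign P y = edgeSign P x := by
  obtain ⟨s, a, b, h⟩ := exists_of_mem_edges h
  filter_upwards [eventually_isSignedEdgePoint h] with y hy
  exact ⟨hy.edgeNormals_congr h, by rw [hy.edgeSign_eq, h.edgeSign_eq]⟩

theorem finrank_direction_inf_add_two_le {L L' : AffineSubspace ℝ (E n)}
    (hL : Module.finrank ℝ L.direction + 1 = n) (hL' : Module.finrank ℝ L'.direction + 1 = n)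
    (hne : L ≠ L') (h : ((L : Set (E n)) ∩ L').Nonempty) :
    Module.finrank ℝ (L ⊓ L').direction + 2 ≤ n := by
  obtain ⟨x, hx, hx'⟩ := h
  by_contra hcon
  rw [AffineSubspace.direction_inf_of_mem hx hx'] at hcon
  have e1 : L.direction ⊓ L'.direction = L.direction :=
    Submodule.eq_of_le_of_finrank_le inf_le_left (by omega)
  have e2 : L.direction ⊓ L'.direction = L'.direction :=
    Submodule.eq_of_le_of_finrank_le inf_le_right (by omega)
  exact hne (AffineSubspace.ext_of_direction_eq (e1.symm.trans e2) ⟨x, hx, hx'⟩)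

theorem measure_inter_lt_top {L L' : AffineSubspace ℝ (E n)}
    (hL : Module.finrank ℝ L.direction + 1 = n) (hL' : Module.finrank ℝ L'.direction + 1 = n)
    (hne : L ≠ L') {B : Set (E n)} (hB : Bornology.IsBounded B) :
    μHE[n - 2] ((L : Set (E n)) ∩ L' ∩ B) < ⊤ := by
  rcases ((L : Set (E n)) ∩ L').eq_empty_or_nonempty with h | h
  · simp [h]
  · have := finrank_direction_inf_add_two_le hL hL' hne h
    exact measure_affineSubspace_inter_lt_top (d := n - 2) (L ⊓ L') (by omega) hB

theorem measure_inter_eq_zero {L L' : AffineSubspace ℝ (E n)}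
    (hL : Module.finrank ℝ L.direction + 1 = n) (hL' : Module.finrank ℝ L'.direction + 1 = n)
    (hne : L ≠ L') : μHE[n - 1] ((L : Set (E n)) ∩ L') = 0 := by
  rcases ((L : Set (E n)) ∩ L').eq_empty_or_nonempty with h | h
  · simp [h]
  · have := finrank_direction_inf_add_two_le hL hL' hne h
    exact measure_affineSubspace_eq_zero (d := n - 1) (L ⊓ L') (by omega)

/-- The hyperplane through `x` orthogonal to `a`. -/
noncomputable def hyperplane (x a : E n) : AffineSubspace ℝ (E n) := AffineSubspace.mk' x (ℝ ∙ a)ᗮ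

theorem mem_hyperplane : y ∈ hyperplane x a ↔ inner ℝ a (y - x) = 0 := by
  rw [hyperplane, AffineSubspace.mem_mk', Submodule.mem_orthogonal_singleton_iff_inner_right,
    vsub_eq_sub]

/-- If the boundary lies in finitely many hyperplanes, they include those spanned by the faces:
a ball in a hyperplane is not covered by finitely many other hyperplanes. -/
theorem IsFacePoint.hyperplane_mem (h : IsFacePoint P x a) {T : Set (AffineSubspace ℝ (E n))}
    (hT : T.Finite) (hrank : ∀ L ∈ T, Module.finrank ℝ L.direction + 1 = n)
    (hsub : frontier P ⊆ ⋃ L ∈ T, (L : Set (E n))) : hyperplane x a ∈ T := by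
  obtain ⟨r, hr, hb⟩ := h.exists_ball
  have hdir : (hyperplane x a).direction = (ℝ ∙ a)ᗮ := AffineSubspace.direction_mk' _ _
  have hn : Module.finrank ℝ (hyperplane x a).direction + 1 = n := by
    rw [hdir, finrank_orthogonal_singleton h.1]
    have : n ≠ 0 := by
      rintro rfl
      have := h.1
      rw [Subsingleton.elim a 0, norm_zero] at this
      norm_num at this
    omega
  by_contra hcon
  have hnull : μHE[n - 1] ((hyperplane x a : Set (E n)) ∩ Metric.ball x r) = 0 := by
    refine measure_mono_null (t := ⋃ L ∈ T, (hyperplane x a : Set (E n)) ∩ L) ?_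
      ((measure_biUnion_null_iff hT.countable).2 fun L hL =>
        measure_inter_eq_zero hn (hrank L hL) (fun e => hcon (e ▸ hL)))
    rintro y ⟨hy, hyr⟩
    have := hsub ((hb y hyr).1 (mem_hyperplane.1 hy)).mem_frontier
    rw [← inter_iUnion₂]
    exact ⟨hy, this⟩
  have hx : x ∈ hyperplane x a := by rw [mem_hyperplane]; simp
  rw [measure_eq_volume_preimage x (hyperplane x a).direction.subtypeₗᵢ (by omega)
    (inter_subset_left.trans (affineSubspace_eq_range _ hx).subset)] at hnull
  have hpre : (fun v => x + (hyperplane x a).direction.subtypeₗᵢ v) ⁻¹'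
      ((hyperplane x a : Set (E n)) ∩ Metric.ball x r) = Metric.ball 0 r := by
    ext v
    have : x + (v : E n) ∈ hyperplane x a := by
      have := AffineSubspace.vadd_mem_of_mem_direction v.2 hx
      rwa [vadd_eq_add, add_comm] at this
    simp [this]
  rw [hpre] at hnull
  exact (Metric.measure_ball_pos volume (0 : (hyperplane x a).direction) hr).ne' hnull

theorem IsPolyhedron.measure_frontier_lt_top (hP : IsPolyhedron P) :
    μHE[n - 1] (frontier P) < ⊤ := by
  obtain ⟨T, hT, hrank, hsub⟩ := hP.finite_faces
  have hb : Bornology.IsBounded (frontier P) :=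
    hP.isCompact.isBounded.subset hP.isCompact.isClosed.frontier_subset
  have : frontier P ⊆ ⋃ L ∈ T, (L : Set (E n)) ∩ frontier P := by
    rw [← iUnion₂_inter]
    exact subset_inter hsub subset_rfl
  refine (measure_mono this).trans_lt (measure_biUnion_lt_top hT fun L hL => ?_)
  exact measure_affineSubspace_inter_lt_top L (by have := hrank L hL; omega) hb

/-- The edges have finite measure: at an edge point two of the finitely many hyperplanes that
contain the boundary intersect transversally, so the edges lie in finitely many bounded flat pieces
of codimension two. -/
theorem IsPolyhedron.measure_edges_lt_top (hP : IsPolyhedron P) :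
    μHE[n - 2] (edges P) < ⊤ := by
  obtain ⟨T, hT, hrank, hsub⟩ := hP.finite_faces
  have hb : Bornology.IsBounded (frontier P) :=
    hP.isCompact.isBounded.subset hP.isCompact.isClosed.frontier_subset
  have hfin : {q : AffineSubspace ℝ (E n) × AffineSubspace ℝ (E n) |
      q ∈ T ×ˢ T ∧ q.1 ≠ q.2}.Finite := (hT.prod hT).subset fun q hq => hq.1
  have hmem : ∀ {s x a b}, IsSignedEdgePoint P s x a b → hyperplane x a ∈ T := by
    intro s x a b h
    obtain ⟨y, hy, hyx⟩ := h.frequently_isFacePoint.exists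
    have e : hyperplane x a = hyperplane y a := by
      ext z
      rw [mem_hyperplane, mem_hyperplane, inner_sub_eq_of_inner_sub_eq_zero hyx]
    rw [e]
    exact hy.hyperplane_mem hT hrank hsub
  have hcov : edges P ⊆ ⋃ q ∈ {q : AffineSubspace ℝ (E n) × AffineSubspace ℝ (E n) |
      q ∈ T ×ˢ T ∧ q.1 ≠ q.2}, (q.1 : Set (E n)) ∩ q.2 ∩ frontier P := by
    intro x hx
    obtain ⟨s, a, b, h⟩ := exists_of_mem_edges hx
    refine mem_iUnion₂.2 ⟨(hyperplane x a, hyperplane x b),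
      ⟨⟨hmem h, hmem h.symm⟩, fun e => ?_⟩, ⟨?_, ?_⟩, h.mem_frontier⟩
    · have hlt := abs_lt.1 h.abs_inner_lt_one
      have haa := inner_self_of_norm_one h.norm_left
      have hbb := inner_self_of_norm_one h.norm_right
      have h1 : x + (b - (inner ℝ a b : ℝ) • a) ∈ hyperplane x a := by
        rw [mem_hyperplane, add_sub_cancel_left, inner_sub_right, inner_smul_right, haa]; ring
      have e : hyperplane x a = hyperplane x b := e
      rw [e, mem_hyperplane, add_sub_cancel_left, inner_sub_right, inner_smul_right, hbb,
        real_inner_comm a b] at h1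
      nlinarith
    · exact mem_hyperplane.2 (by simp)
    · exact mem_hyperplane.2 (by simp)
  refine (measure_mono hcov).trans_lt (measure_biUnion_lt_top hfin fun q hq => ?_)
  exact measure_inter_lt_top (hrank _ hq.1.1) (hrank _ hq.1.2) hq.2 hb

theorem integrableOn_of_continuousOn_of_bounded {d : ℕ} {S : Set (E n)} (hS : MeasurableSet S)
    (hfin : μHE[d] S < ⊤) {f : E n → ℝ} (hf : ContinuousOn f S) {M : ℝ}
    (hM : ∀ x ∈ S, |f x| ≤ M) : IntegrableOn f S μHE[d] := by
  have : IsFiniteMeasure ((μHE[d] : Measure (E n)).restrict S) := ⟨by simpa using hfin⟩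
  refine Integrable.of_bound (hf.aestronglyMeasurable hS) M ?_
  filter_upwards [ae_restrict_mem hS] with x hx
  exact hM x hx

end Boundary

/-! ### Functions of the normals -/

section FaceDivergence

variable {n : ℕ} {P : Set (E n)} {x y a b c d u w : E n} {s s' : ℝ}

/-- The outward normal is locally constant on the faces, so a function of the point and the normal
is continuous on the faces if it is continuous for every fixed normal. -/
theorem continuousOn_faces {F : E n → E n → ℝ}
    (h : ∀ x ∈ faces P, ∀ a, IsFacePoint P x a → ContinuousWithinAt (F a) (faces P) x) :
    ContinuousOn (fun x => F (outwardNormal P x) x) (faces P) := by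
  rintro x ⟨a, ha⟩
  refine (h x ⟨a, ha⟩ a ha).congr_of_eventuallyEq ?_ (by rw [outwardNormal_eq ha])
  filter_upwards [eventually_outwardNormal_eq ⟨a, ha⟩] with y hy
  rw [hy, outwardNormal_eq ha]

theorem continuousOn_edges {F : ℝ → E n × E n → E n → ℝ}
    (h : ∀ x ∈ edges P, ∀ s a b, IsSignedEdgePoint P s x a b →
      ContinuousWithinAt (F s (a, b)) (edges P) x) :
    ContinuousOn (fun x => F (edgeSign P x) (edgeNormals P x) x) (edges P) := by
  intro x hx
  obtain ⟨s, a, b, hs⟩ := exists_of_mem_edges hx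
  have hs' := hs.at_edgeNormals
  refine (h x hx s _ _ hs').congr_of_eventuallyEq ?_ (by rw [hs.edgeSign_eq])
  filter_upwards [eventually_edgeNormals_eq hx] with y hy
  rw [hy.1, hy.2, hs.edgeSign_eq]

/-! ### The divergence theorem on the faces -/

/-- For unit vectors `a`, `b`, the unit vector orthogonal to `a` in the plane of `a` and `b`, on
the side of `b`: at a convex edge, the outward conormal of the face with normal `a`, and at a
non-convex edge its opposite. -/
noncomputable def conormal (a b : E n) : E n :=
  (Real.sqrt (1 - (inner ℝ a b : ℝ) ^ 2))⁻¹ • (b - (inner ℝ a b : ℝ) • a)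

theorem inner_conormal (ha : ‖a‖ = 1) : inner ℝ a (conormal a b) = 0 := by
  rw [conormal, inner_smul_right, inner_sub_right, inner_smul_right, inner_self_of_norm_one ha]
  ring

theorem norm_conormal (ha : ‖a‖ = 1) (hb : ‖b‖ = 1) (hab : |inner ℝ a b| < 1) :
    ‖conormal a b‖ = 1 := by
  have hpos : 0 < 1 - (inner ℝ a b : ℝ) ^ 2 := by
    have := (sq_lt_one_iff_abs_lt_one (inner ℝ a b)).2 hab
    linarith
  have h2 : ‖b - (inner ℝ a b : ℝ) • a‖ ^ 2 = 1 - (inner ℝ a b : ℝ) ^ 2 := by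
    rw [norm_sub_sq_real, norm_smul, ha, hb, inner_smul_right, real_inner_comm a b, mul_one,
      Real.norm_eq_abs, sq_abs]
    ring
  have h3 : ‖b - (inner ℝ a b : ℝ) • a‖ = Real.sqrt (1 - (inner ℝ a b : ℝ) ^ 2) := by
    rw [← h2, Real.sqrt_sq (norm_nonneg _)]
  rw [conormal, norm_smul, h3, norm_inv, Real.norm_of_nonneg (Real.sqrt_nonneg _)]
  exact inv_mul_cancel₀ (Real.sqrt_pos.2 hpos).ne'

/-- The divergence, on a face with normal `ν`, of the tangential part of the vector field
`⟨ν, w⟩ f u`. -/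
noncomputable def faceDiv (P : Set (E n)) (u w : E n) (f : E n → ℝ) (x : E n) : ℝ :=
  inner ℝ (outwardNormal P x) w *
    fderiv ℝ f x (u - (inner ℝ (outwardNormal P x) u : ℝ) • outwardNormal P x)

/-- The total flux of `⟨ν, w⟩ u` out of the two faces with normals `a` and `b` through an edge
at which `P` is convex. -/
noncomputable def edgeKernel (a b u w : E n) : ℝ :=
  inner ℝ (conormal a b) u * inner ℝ a w + inner ℝ (conormal b a) u * inner ℝ b w

/-- The boundary term, on the edges, of the divergence `faceDiv`.  At a non-convex edge the outward
conormals of both faces are reversed, whence the factor `edgeSign`. -/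
noncomputable def edgeTerm (P : Set (E n)) (u w : E n) (f : E n → ℝ) (x : E n) : ℝ :=
  edgeSign P x * edgeKernel (edgeNormals P x).1 (edgeNormals P x).2 u w * f x

theorem edgeKernel_comm (a b u w : E n) : edgeKernel a b u w = edgeKernel b a u w :=
  add_comm _ _

theorem IsSignedEdgePoint.edgeTerm_eq (h : IsSignedEdgePoint P s x a b) (u w : E n)
    (f : E n → ℝ) : edgeTerm P u w f x = s * edgeKernel a b u w * f x := by
  rw [edgeTerm, h.edgeSign_eq]
  rcases h.edgeNormals_eq with e | e <;> rw [e]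
  rw [edgeKernel_comm]

theorem abs_faceDiv_le (hx : x ∈ faces P) (u w : E n) (f : E n → ℝ) :
    |faceDiv P u w f x| ≤ ‖fderiv ℝ f x‖ * (2 * ‖u‖ * ‖w‖) := by
  obtain ⟨a, h⟩ := hx
  rw [faceDiv, outwardNormal_eq h, abs_mul]
  have h1 : |inner ℝ a w| ≤ ‖w‖ := by
    simpa [h.1] using abs_real_inner_le_norm a w
  have h2 : |inner ℝ a u| ≤ ‖u‖ := by
    simpa [h.1] using abs_real_inner_le_norm a u
  have h3 : ‖u - (inner ℝ a u : ℝ) • a‖ ≤ 2 * ‖u‖ := by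
    refine (norm_sub_le _ _).trans ?_
    rw [norm_smul, h.1, Real.norm_eq_abs]
    linarith
  have h4 := (fderiv ℝ f x).le_opNorm (u - (inner ℝ a u : ℝ) • a)
  rw [Real.norm_eq_abs] at h4
  calc _ ≤ ‖w‖ * (‖fderiv ℝ f x‖ * (2 * ‖u‖)) := by
        gcongr
        exact h4.trans (by gcongr)
    _ = _ := by ring

theorem abs_edgeTerm_le (hx : x ∈ edges P) (u w : E n) (f : E n → ℝ) :
    |edgeTerm P u w f x| ≤ 2 * ‖u‖ * ‖w‖ * |f x| := by
  obtain ⟨s, a, b, h⟩ := exists_of_mem_edges hx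
  have key : ∀ {a b}, IsSignedEdgePoint P s x a b →
      |inner ℝ (conormal a b) u * inner ℝ a w| ≤ ‖u‖ * ‖w‖ := by
    intro a b h
    rw [abs_mul]
    have h1 : |inner ℝ a w| ≤ ‖w‖ := by
      simpa [h.norm_left] using abs_real_inner_le_norm a w
    have h2 : |inner ℝ (conormal a b) u| ≤ ‖u‖ := by
      simpa [norm_conormal h.norm_left h.norm_right h.abs_inner_lt_one] using
        abs_real_inner_le_norm (conormal a b) u
    gcongr
  have hs : |s| = 1 := by rcases h.sign_eq with rfl | rfl <;> simp
  rw [h.edgeTerm_eq, abs_mul, abs_mul, hs, one_mul]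
  refine mul_le_mul_of_nonneg_right ((abs_add_le _ _).trans ?_) (abs_nonneg _)
  linarith [key h, key h.symm]

theorem continuousOn_faceDiv {f : E n → ℝ} (hf : ContDiff ℝ 1 f) :
    ContinuousOn (faceDiv P u w f) (faces P) :=
  continuousOn_faces (F := fun a x => inner ℝ a w * fderiv ℝ f x (u - (inner ℝ a u : ℝ) • a))
    fun _ _ _ _ => (continuous_const.mul ((hf.continuous_fderiv one_ne_zero).clm_apply
      continuous_const)).continuousWithinAt

theorem continuousOn_edgeTerm {f : E n → ℝ} (hf : Continuous f) :
    ContinuousOn (edgeTerm P u w f) (edges P) :=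
  continuousOn_edges (F := fun s q x => s * edgeKernel q.1 q.2 u w * f x)
    fun _ _ _ _ _ _ => (continuous_const.mul hf).continuousWithinAt

theorem IsPolyhedron.isCompact_frontier (hP : IsPolyhedron P) : IsCompact (frontier P) :=
  hP.isCompact.of_isClosed_subset isClosed_frontier hP.isCompact.isClosed.frontier_subset

theorem IsPolyhedron.measure_faces_lt_top (hP : IsPolyhedron P) : μHE[n - 1] (faces P) < ⊤ :=
  (measure_mono (faces_subset_frontier P)).trans_lt hP.measure_frontier_lt_top

theorem IsPolyhedron.integrableOn_faceDiv (hP : IsPolyhedron P) {f : E n → ℝ}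
    (hf : ContDiff ℝ 1 f) (u w : E n) : IntegrableOn (faceDiv P u w f) (faces P) μHE[n - 1] := by
  obtain ⟨M, hM⟩ := hP.isCompact_frontier.exists_bound_of_continuousOn
    (hf.continuous_fderiv one_ne_zero).continuousOn
  refine integrableOn_of_continuousOn_of_bounded (measurableSet_faces P) hP.measure_faces_lt_top
    (continuousOn_faceDiv hf) (M := M * (2 * ‖u‖ * ‖w‖)) fun x hx => ?_
  refine (abs_faceDiv_le hx u w f).trans ?_
  have := hM x (faces_subset_frontier P hx)
  gcongr

theorem IsPolyhedron.integrableOn_edgeTerm (hP : IsPolyhedron P) {f : E n → ℝ}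
    (hf : Continuous f) (u w : E n) : IntegrableOn (edgeTerm P u w f) (edges P) μHE[n - 2] := by
  obtain ⟨M, hM⟩ := hP.isCompact_frontier.exists_bound_of_continuousOn hf.continuousOn
  refine integrableOn_of_continuousOn_of_bounded (measurableSet_edges P) hP.measure_edges_lt_top
    (continuousOn_edgeTerm hf) (M := 2 * ‖u‖ * ‖w‖ * M) fun x hx => ?_
  refine (abs_edgeTerm_le hx u w f).trans ?_
  have := hM x (edges_subset_frontier P hx)
  rw [Real.norm_eq_abs] at this
  gcongr

/-- Integrals over two sets agree if the integrands agree wherever one of them is nonzero. -/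
theorem setIntegral_congr_indicator {μ : Measure (E n)} {S S' : Set (E n)}
    (hS : MeasurableSet S) (hS' : MeasurableSet S') {F F' : E n → ℝ}
    (h1 : ∀ x ∈ S, F x ≠ 0 → x ∈ S' ∧ F x = F' x)
    (h2 : ∀ x ∈ S', F' x ≠ 0 → x ∈ S ∧ F x = F' x) :
    ∫ x in S, F x ∂μ = ∫ x in S', F' x ∂μ := by
  rw [← integral_indicator hS, ← integral_indicator hS']
  congr 1
  ext x
  by_cases hx : x ∈ S <;> by_cases hx' : x ∈ S' <;>
    simp only [indicator, hx, hx', if_true, if_false]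
  · by_cases h : F x = 0
    · by_cases h' : F' x = 0
      · rw [h, h']
      · exact (h2 x hx' h').2
    · exact (h1 x hx h).2
  · by_contra h
    exact hx' (h1 x hx h).1
  · by_contra h
    exact hx (h2 x hx' (Ne.symm h)).1

theorem measurableSet_inner_eq (a x : E n) : MeasurableSet {y : E n | inner ℝ a (y - x) = 0} :=
  (isClosed_eq (by fun_prop) continuous_const).measurableSet

theorem measurableSet_inner_lt (a x : E n) : MeasurableSet {y : E n | inner ℝ a (y - x) < 0} :=
  (isOpen_lt (by fun_prop) continuous_const).measurableSet

theorem fderiv_eq_zero_of_notMem {f : E n → ℝ} {S : Set (E n)} (h : tsupport f ⊆ S) (hx : x ∉ S) :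
    fderiv ℝ f x = 0 := by
  by_contra hne
  exact hx (h (support_fderiv_subset ℝ hne))

theorem mem_of_faceDiv_ne_zero {f : E n → ℝ} {S : Set (E n)} (h : tsupport f ⊆ S)
    (hx : faceDiv P u w f x ≠ 0) : x ∈ S := by
  by_contra hne
  refine hx ?_
  rw [faceDiv, fderiv_eq_zero_of_notMem h hne]
  simp

theorem mem_of_edgeTerm_ne_zero {f : E n → ℝ} {S : Set (E n)} (h : tsupport f ⊆ S)
    (hx : edgeTerm P u w f x ≠ 0) : x ∈ S := by
  by_contra hne
  refine hx ?_
  rw [edgeTerm, image_eq_zero_of_notMem_tsupport fun h' => hne (h h'), mul_zero]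

/-- Near a face point the boundary is a hyperplane, on which the tangential divergence of a
compactly supported field integrates to zero. -/
theorem IsFacePoint.local_divergence (h : IsFacePoint P x a) :
    ∃ r > 0, ∀ f : E n → ℝ, ContDiff ℝ 1 f → HasCompactSupport f → tsupport f ⊆ Metric.ball x r →
      ∫ y in faces P, faceDiv P u w f y ∂μHE[n - 1] =
        ∫ y in edges P, edgeTerm P u w f y ∂μHE[n - 2] := by
  obtain ⟨r, hr, hb⟩ := h.exists_ball
  refine ⟨r, hr, fun f hf hc hsupp => ?_⟩
  have hedge : ∫ y in edges P, edgeTerm P u w f y ∂μHE[n - 2] = 0 := by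
    refine setIntegral_eq_zero_of_forall_eq_zero fun y hy => ?_
    by_contra hne
    have hyb := mem_of_edgeTerm_ne_zero hsupp hne
    exact Set.disjoint_left.1 (disjoint_faces_edges P)
      ⟨a, (hb y hyb).1 ((hb y hyb).2 (edges_subset_frontier P hy))⟩ hy
  have hv : inner ℝ a (u - (inner ℝ a u : ℝ) • a) = 0 := by
    rw [inner_sub_right, inner_smul_right, inner_self_of_norm_one h.1]; ring
  rw [hedge, ← mul_zero (inner ℝ a w), ← setIntegral_hyperplane_fderiv h.1 hf hc hv (x₀ := x),
    ← integral_const_mul]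
  refine setIntegral_congr_indicator (measurableSet_faces P) (measurableSet_inner_eq a x)
    (fun y hy hne => ?_) fun y hy hne => ?_
  · have hyb := mem_of_faceDiv_ne_zero hsupp hne
    have h0 := (hb y hyb).2 (faces_subset_frontier P hy)
    refine ⟨h0, ?_⟩
    rw [faceDiv, outwardNormal_eq ((hb y hyb).1 h0)]
  · have hyb : y ∈ Metric.ball x r := by
      by_contra hcon
      rw [fderiv_eq_zero_of_notMem hsupp hcon] at hne
      simp at hne
    refine ⟨⟨a, (hb y hyb).1 hy⟩, ?_⟩
    rw [faceDiv, outwardNormal_eq ((hb y hyb).1 hy)]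

/-- Near an edge point the boundary consists of two half-hyperplanes, each of which contributes the
flux through its boundary. -/
theorem IsSignedEdgePoint.local_divergence (hP : IsPolyhedron P) (h : IsSignedEdgePoint P s x a b) :
    ∃ r > 0, ∀ f : E n → ℝ, ContDiff ℝ 1 f → HasCompactSupport f → tsupport f ⊆ Metric.ball x r →
      ∫ y in faces P, faceDiv P u w f y ∂μHE[n - 1] =
        ∫ y in edges P, edgeTerm P u w f y ∂μHE[n - 2] := by
  obtain ⟨r, hr, hb⟩ := h.exists_ball
  refine ⟨r, hr, fun f hf hc hsupp => ?_⟩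
  have hs2 : s * s = 1 := by rcases h.sign_eq with rfl | rfl <;> norm_num
  have hs0 : ∀ {t : ℝ}, s * t = 0 → t = 0 := fun {t} ht => by
    rcases h.sign_eq with rfl | rfl <;> linarith
  -- the face with normal `a` is, near `x`, the half-hyperplane with outward conormal
  -- `s • conormal a b`
  have half : ∀ {a b : E n}, IsSignedEdgePoint P s x a b → ∀ S : Set (E n), MeasurableSet S →
      (∀ y ∈ Metric.ball x r, (y ∈ S ↔ inner ℝ a (y - x) = 0 ∧ s * inner ℝ b (y - x) < 0)) →
      (∀ y ∈ Metric.ball x r, y ∈ S → outwardNormal P y = a) →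
      ∫ y in S, faceDiv P u w f y ∂μHE[n - 1] =
        s * (inner ℝ (conormal a b) u * inner ℝ a w) *
          ∫ y in {y | inner ℝ a (y - x) = 0 ∧ inner ℝ b (y - x) = 0}, f y ∂μHE[n - 2] := by
    intro a b h S hS hmem hnu
    have ha := h.norm_left
    have hpos : 0 < 1 - (inner ℝ a b : ℝ) ^ 2 := by
      have := (sq_lt_one_iff_abs_lt_one (inner ℝ a b)).2 h.abs_inner_lt_one
      linarith
    set m := s • conormal a b with hm
    have hm1 : ‖m‖ = 1 := by
      rw [hm, norm_smul, norm_conormal ha h.norm_right h.abs_inner_lt_one]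
      rcases h.sign_eq with rfl | rfl <;> simp
    have ham : inner ℝ a m = 0 := by rw [hm, inner_smul_right, inner_conormal ha, mul_zero]
    have hmy : ∀ z : E n, inner ℝ a z = 0 →
        inner ℝ m z = (Real.sqrt (1 - (inner ℝ a b : ℝ) ^ 2))⁻¹ * (s * inner ℝ b z) := by
      intro z hz
      rw [hm, conormal, real_inner_smul_left, real_inner_smul_left, inner_sub_left,
        real_inner_smul_left, hz]
      ring
    have hq := inv_pos.2 (Real.sqrt_pos.2 hpos)
    have hv : inner ℝ a (u - (inner ℝ a u : ℝ) • a) = 0 := by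
      rw [inner_sub_right, inner_smul_right, inner_self_of_norm_one ha]; ring
    have key := setIntegral_halfHyperplane_fderiv (x₀ := x) ha hm1 ham hf hc hv
    have hset : {y : E n | inner ℝ a (y - x) = 0 ∧ inner ℝ m (y - x) = 0} =
        {y | inner ℝ a (y - x) = 0 ∧ inner ℝ b (y - x) = 0} := by
      ext y
      refine and_congr_right fun h0 => ?_
      rw [hmy _ h0, mul_eq_zero, or_iff_right hq.ne']
      exact ⟨hs0, fun h => by rw [h, mul_zero]⟩
    have hmv : inner ℝ m (u - (inner ℝ a u : ℝ) • a) = s * inner ℝ (conormal a b) u := by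
      rw [inner_sub_right, inner_smul_right, real_inner_comm a m, ham, hm, real_inner_smul_left]
      ring
    rw [hset, hmv] at key
    have e : s * (inner ℝ (conormal a b) u * inner ℝ a w) *
          ∫ y in {y | inner ℝ a (y - x) = 0 ∧ inner ℝ b (y - x) = 0}, f y ∂μHE[n - 2] =
        inner ℝ a w * (s * inner ℝ (conormal a b) u *
          ∫ y in {y | inner ℝ a (y - x) = 0 ∧ inner ℝ b (y - x) = 0}, f y ∂μHE[n - 2]) := by ring
    rw [e, ← key, ← integral_const_mul]
    have hiff : ∀ y : E n, (inner ℝ a (y - x) = 0 ∧ inner ℝ m (y - x) < 0) ↔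
        (inner ℝ a (y - x) = 0 ∧ s * inner ℝ b (y - x) < 0) := by
      intro y
      refine and_congr_right fun h0 => ?_
      rw [hmy _ h0]
      exact ⟨fun h => by by_contra hcon; exact h.not_ge (mul_nonneg hq.le (not_lt.1 hcon)),
        fun h => mul_neg_of_pos_of_neg hq h⟩
    refine setIntegral_congr_indicator hS
      ((measurableSet_inner_eq a x).inter (measurableSet_inner_lt m x))
      (fun y hy hne => ?_) fun y hy hne => ?_
    · have hyb := mem_of_faceDiv_ne_zero hsupp hne
      refine ⟨(hiff y).2 ((hmem y hyb).1 hy), ?_⟩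
      rw [faceDiv, hnu y hyb hy]
    · have hyb : y ∈ Metric.ball x r := by
        by_contra hcon
        rw [fderiv_eq_zero_of_notMem hsupp hcon] at hne
        simp at hne
      have hyS := (hmem y hyb).2 ((hiff y).1 hy)
      refine ⟨hyS, ?_⟩
      rw [faceDiv, hnu y hyb hyS]
  set t := {y : E n | inner ℝ a (y - x) = 0} with ht
  have htm : MeasurableSet t := measurableSet_inner_eq a x
  have hcase : ∀ y ∈ Metric.ball x r, y ∈ faces P →
      (inner ℝ a (y - x) = 0 ∧ s * inner ℝ b (y - x) < 0) ∨
      (inner ℝ b (y - x) = 0 ∧ s * inner ℝ a (y - x) < 0) := by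
    intro y hy hyf
    obtain ⟨h1, h2, h3, h4⟩ := hb y hy
    have hd := Set.disjoint_left.1 (disjoint_faces_edges P) hyf
    rcases h4 (faces_subset_frontier P hyf) with ⟨e, e'⟩ | ⟨e, e'⟩ <;>
      rcases e'.lt_or_eq with e' | e'
    · exact Or.inl ⟨e, e'⟩
    · exact absurd (h3 e (hs0 e')).mem_edges hd
    · exact Or.inr ⟨e, e'⟩
    · exact absurd (h3 (hs0 e') e).mem_edges hd
  have hA := half h (faces P ∩ t) ((measurableSet_faces P).inter htm)
    (fun y hy => by
      refine ⟨fun hyS => ⟨hyS.2, ?_⟩, fun hyS => ⟨⟨a, (hb y hy).1 hyS.1 hyS.2⟩, hyS.1⟩⟩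
      rcases hcase y hy hyS.1 with h' | h'
      · exact h'.2
      · have : inner ℝ a (y - x) = 0 := hyS.2
        rw [this] at h'
        simp at h')
    (fun y hy hyS => by
      rcases hcase y hy hyS.1 with h' | h'
      · exact outwardNormal_eq ((hb y hy).1 h'.1 h'.2)
      · have : inner ℝ a (y - x) = 0 := hyS.2
        rw [this] at h'
        simp at h')
  have hB := half h.symm (faces P \ t) ((measurableSet_faces P).diff htm)
    (fun y hy => by
      refine ⟨fun hyS => ?_, fun hyS => ⟨⟨b, (hb y hy).2.1 hyS.1 hyS.2⟩, fun h0 => ?_⟩⟩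
      · rcases hcase y hy hyS.1 with h' | h'
        · exact absurd h'.1 hyS.2
        · exact h'
      · have : inner ℝ a (y - x) = 0 := h0
        rw [this] at hyS
        simp at hyS)
    (fun y hy hyS => by
      rcases hcase y hy hyS.1 with h' | h'
      · exact absurd h'.1 hyS.2
      · exact outwardNormal_eq ((hb y hy).2.1 h'.1 h'.2))
  have hcomm : {y : E n | inner ℝ b (y - x) = 0 ∧ inner ℝ a (y - x) = 0} =
      {y | inner ℝ a (y - x) = 0 ∧ inner ℝ b (y - x) = 0} := by
    ext y; exact and_comm
  rw [← integral_inter_add_sdiff htm (hP.integrableOn_faceDiv hf u w), hA, hB, hcomm, ← add_mul,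
    ← mul_add, ← edgeKernel, ← integral_const_mul]
  refine setIntegral_congr_indicator
    ((measurableSet_inner_eq a x).inter (measurableSet_inner_eq b x)) (measurableSet_edges P)
    (fun y hy hne => ?_) fun y hy hne => ?_
  · have hyb : y ∈ Metric.ball x r := by
      by_contra hcon
      rw [image_eq_zero_of_notMem_tsupport fun h' => hcon (hsupp h'), mul_zero] at hne
      exact hne rfl
    have := (hb y hyb).2.2.1 hy.1 hy.2
    exact ⟨this.mem_edges, (this.edgeTerm_eq u w f).symm⟩
  · have hyb := mem_of_edgeTerm_ne_zero hsupp hne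
    obtain ⟨h1, h2, h3, h4⟩ := hb y hyb
    have hd := fun h' => Set.disjoint_left.1 (disjoint_faces_edges P) h' hy
    have h0 : inner ℝ a (y - x) = 0 ∧ inner ℝ b (y - x) = 0 := by
      rcases h4 (edges_subset_frontier P hy) with ⟨e, e'⟩ | ⟨e, e'⟩ <;>
        rcases e'.lt_or_eq with e' | e'
      · exact absurd ⟨a, h1 e e'⟩ hd
      · exact ⟨e, hs0 e'⟩
      · exact absurd ⟨b, h2 e e'⟩ hd
      · exact ⟨hs0 e', e⟩
    exact ⟨h0, ((h3 h0.1 h0.2).edgeTerm_eq u w f).symm⟩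

theorem exists_local_divergence (hP : IsPolyhedron P)
    (hx : x ∈ frontier P → x ∈ faces P ∪ edges P) (u w : E n) :
    ∃ r > 0, ∀ f : E n → ℝ, ContDiff ℝ 1 f → HasCompactSupport f → tsupport f ⊆ Metric.ball x r →
      ∫ y in faces P, faceDiv P u w f y ∂μHE[n - 1] =
        ∫ y in edges P, edgeTerm P u w f y ∂μHE[n - 2] := by
  by_cases hxf : x ∈ frontier P
  · rcases hx hxf with ⟨a, h⟩ | h
    · exact h.local_divergence
    · obtain ⟨s, a, b, h⟩ := exists_of_mem_edges h
      exact h.local_divergence hP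
  · obtain ⟨r, hr, hsub⟩ := Metric.isOpen_iff.1 isClosed_frontier.isOpen_compl x hxf
    refine ⟨r, hr, fun f _ _ hsupp => ?_⟩
    rw [setIntegral_eq_zero_of_forall_eq_zero, setIntegral_eq_zero_of_forall_eq_zero]
    · intro y hy
      by_contra hne
      exact hsub (mem_of_edgeTerm_ne_zero hsupp hne) (edges_subset_frontier P hy)
    · intro y hy
      by_contra hne
      exact hsub (mem_of_faceDiv_ne_zero hsupp hne) (faces_subset_frontier P hy)

end FaceDivergence

/-! ### Removal of the corners -/

section Corners

variable {n : ℕ} {P : Set (E n)} {x y a b c d u w : E n} {s s' : ℝ}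

theorem faceDiv_sum {ι : Type*} (t : Finset ι) {f : ι → E n → ℝ} (hf : ∀ i, ContDiff ℝ 1 (f i))
    (x : E n) : faceDiv P u w (fun y => ∑ i ∈ t, f i y) x = ∑ i ∈ t, faceDiv P u w (f i) x := by
  rw [faceDiv, fderiv_fun_sum fun i _ => (hf i).differentiable one_ne_zero x,
    sum_apply, Finset.mul_sum]
  rfl

theorem edgeTerm_sum {ι : Type*} (t : Finset ι) {f : ι → E n → ℝ} (x : E n) :
    edgeTerm P u w (fun y => ∑ i ∈ t, f i y) x = ∑ i ∈ t, edgeTerm P u w (f i) x := by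
  simp only [edgeTerm, Finset.mul_sum]

open scoped Manifold ContDiff in
/-- The divergence theorem for functions supported away from the corners, by a partition of
unity. -/
theorem divergence_of_tsupport (hP : IsPolyhedron P) {f : E n → ℝ} (hf : ContDiff ℝ 1 f)
    (hc : HasCompactSupport f) (hsupp : tsupport f ∩ frontier P ⊆ faces P ∪ edges P) (u w : E n) :
    ∫ y in faces P, faceDiv P u w f y ∂μHE[n - 1] =
      ∫ y in edges P, edgeTerm P u w f y ∂μHE[n - 2] := by
  have hloc := fun x (hx : x ∈ tsupport f) =>
    exists_local_divergence hP (fun hxf => hsupp ⟨hx, hxf⟩) u w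
  choose! r hr hdiv using hloc
  obtain ⟨t, hcov⟩ := IsCompact.elim_nhds_subcover' (show IsCompact (tsupport f) from hc)
    (fun x _ => Metric.ball x (r x)) (fun x hx => Metric.ball_mem_nhds x (hr x hx))
  obtain ⟨ρ, hρ⟩ := SmoothPartitionOfUnity.exists_isSubordinate 𝓘(ℝ, E n) (isClosed_tsupport f)
    (fun i : t => Metric.ball ((i : tsupport f) : E n) (r i)) (fun _ => Metric.isOpen_ball)
    (by simpa [iUnion_subtype] using hcov)
  have hρd : ∀ i, ContDiff ℝ 1 (fun y => ρ i y * f y) := fun i =>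
    ((ρ i).contMDiff.contDiff.of_le (by simp)).mul hf
  have hsum : f = fun y => ∑ i : t, ρ i y * f y := by
    ext y
    by_cases hy : y ∈ tsupport f
    · rw [← Finset.sum_mul, ← finsum_eq_sum_of_fintype, ρ.sum_eq_one hy, one_mul]
    · simp [image_eq_zero_of_notMem_tsupport hy]
  have e1 : ∀ y, faceDiv P u w f y = ∑ i : t, faceDiv P u w (fun y => ρ i y * f y) y := by
    intro y
    conv_lhs => rw [hsum]
    exact faceDiv_sum _ hρd y
  have e2 : ∀ y, edgeTerm P u w f y = ∑ i : t, edgeTerm P u w (fun y => ρ i y * f y) y := by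
    intro y
    conv_lhs => rw [hsum]
    exact edgeTerm_sum _ y
  simp_rw [e1, e2]
  rw [integral_finsetSum _ fun i _ => hP.integrableOn_faceDiv (hρd i) u w,
    integral_finsetSum _ fun i _ => hP.integrableOn_edgeTerm (hρd i).continuous u w]
  refine Finset.sum_congr rfl fun i _ => ?_
  refine hdiv _ (i : tsupport f).2 _ (hρd i) hc.mul_left ?_
  exact (tsupport_mul_subset_left).trans (hρ i)

/-- A smooth function equal to `0` at distance at most `δ` from the affine subspace `z + Sᗮ`, and
to `1` at distance at least `2 δ`. -/
noncomputable def cutoff (S : Submodule ℝ (E n)) (z : E n) (δ : ℝ) (x : E n) : ℝ :=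
  Real.smoothTransition (δ⁻¹ ^ 2 * ‖S.orthogonalProjectionOnto (x - z)‖ ^ 2 - 1)

section Cutoff

variable (S : Submodule ℝ (E n)) (z : E n) (δ : ℝ)

theorem contDiff_cutoff : ContDiff ℝ 1 (cutoff S z δ) := by
  refine Real.smoothTransition.contDiff.comp ?_
  refine ContDiff.sub (contDiff_const.mul (ContDiff.norm_sq ℝ ?_)) contDiff_const
  exact S.orthogonalProjectionOnto.contDiff.comp (contDiff_id.sub contDiff_const)

theorem cutoff_nonneg (x : E n) : 0 ≤ cutoff S z δ x := Real.smoothTransition.nonneg _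

theorem cutoff_le_one (x : E n) : cutoff S z δ x ≤ 1 := Real.smoothTransition.le_one _

theorem abs_cutoff_le_one (x : E n) : |cutoff S z δ x| ≤ 1 := by
  rw [abs_of_nonneg (cutoff_nonneg S z δ x)]
  exact cutoff_le_one S z δ x

variable {S z δ}

theorem cutoff_eq_one (hδ : 0 < δ) (h : 2 * δ < ‖S.orthogonalProjectionOnto (x - z)‖) :
    cutoff S z δ x = 1 := by
  refine Real.smoothTransition.one_of_one_le ?_
  have h1 : 2 < δ⁻¹ * ‖S.orthogonalProjectionOnto (x - z)‖ := by
    rw [inv_mul_eq_div, lt_div_iff₀ hδ]; exact h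
  rw [← mul_pow]
  nlinarith

theorem tsupport_cutoff_subset (hδ : 0 < δ) :
    tsupport (cutoff S z δ) ⊆ {x | δ ≤ ‖S.orthogonalProjectionOnto (x - z)‖} := by
  refine closure_minimal (fun x hx => ?_) (isClosed_le continuous_const (by fun_prop))
  by_contra hcon
  refine hx (Real.smoothTransition.zero_of_nonpos ?_)
  have h1 : δ⁻¹ * ‖S.orthogonalProjectionOnto (x - z)‖ ≤ 1 := by
    rw [inv_mul_eq_div, div_le_one hδ]
    exact (not_le.1 hcon).le
  have h0 : 0 ≤ δ⁻¹ * ‖S.orthogonalProjectionOnto (x - z)‖ := by positivity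
  rw [← mul_pow]
  nlinarith

theorem fderiv_cutoff_eq_zero (hδ : 0 < δ) (h : 2 * δ < ‖S.orthogonalProjectionOnto (x - z)‖) :
    fderiv ℝ (cutoff S z δ) x = 0 := by
  have : cutoff S z δ =ᶠ[𝓝 x] fun _ => 1 := by
    have hcont : Continuous fun x : E n => ‖S.orthogonalProjectionOnto (x - z)‖ := by fun_prop
    filter_upwards [hcont.continuousAt.eventually_const_lt h] with y hy
    exact cutoff_eq_one hδ hy
  rw [this.fderiv_eq, fderiv_fun_const]
  rfl

/-- The derivative of `Real.smoothTransition` is bounded on half-lines `t ≤ 3`, which is all that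
the cutoff function needs. -/
theorem exists_abs_deriv_smoothTransition_le :
    ∃ K : ℝ, 0 ≤ K ∧ ∀ t ≤ 3, |deriv Real.smoothTransition t| ≤ K := by
  have hcont : Continuous (deriv Real.smoothTransition) :=
    (Real.smoothTransition.contDiff (n := 1)).continuous_deriv le_rfl
  obtain ⟨K, hK⟩ := (isCompact_Icc (a := (-1 : ℝ)) (b := 3)).exists_bound_of_continuousOn
    hcont.continuousOn
  have hK0 : 0 ≤ K := (norm_nonneg _).trans (hK 0 ⟨by norm_num, by norm_num⟩)
  refine ⟨K, hK0, fun t ht => ?_⟩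
  by_cases h : -1 ≤ t
  · exact hK t ⟨h, ht⟩
  · have : Real.smoothTransition =ᶠ[𝓝 t] fun _ => 0 := by
      filter_upwards [Iio_mem_nhds (not_le.1 h)] with y hy
      have : y < -1 := hy
      exact Real.smoothTransition.zero_of_nonpos (by linarith)
    rw [this.deriv_eq]
    simpa using hK0

theorem exists_norm_fderiv_cutoff_le (S : Submodule ℝ (E n)) (z : E n) :
    ∃ K : ℝ, 0 ≤ K ∧ ∀ δ > 0, ∀ x : E n, ‖fderiv ℝ (cutoff S z δ) x‖ ≤ K * δ⁻¹ := by
  obtain ⟨K, hK0, hK⟩ := exists_abs_deriv_smoothTransition_le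
  refine ⟨K * 4, by positivity, fun δ hδ x => ?_⟩
  by_cases h : 2 * δ < ‖S.orthogonalProjectionOnto (x - z)‖
  · rw [fderiv_cutoff_eq_zero hδ h, norm_zero]
    positivity
  set A := S.orthogonalProjectionOnto
  have h1 : HasFDerivAt (fun x => A (x - z)) A x := by
    have := A.hasFDerivAt.comp x ((hasFDerivAt_id x).sub_const z)
    exact this
  have h2 := ((h1.norm_sq).const_mul (δ⁻¹ ^ 2)).sub_const 1
  have h3 := (((Real.smoothTransition.contDiff (n := 1)).differentiable one_ne_zero
    (δ⁻¹ ^ 2 * ‖A (x - z)‖ ^ 2 - 1)).hasDerivAt).comp_hasFDerivAt x h2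
  have h4 : cutoff S z δ = Real.smoothTransition ∘ fun x => δ⁻¹ ^ 2 * ‖A (x - z)‖ ^ 2 - 1 := rfl
  have hle : δ⁻¹ * ‖A (x - z)‖ ≤ 2 := by
    rw [inv_mul_eq_div, div_le_iff₀ hδ]
    exact not_lt.1 h
  have h0 : 0 ≤ δ⁻¹ * ‖A (x - z)‖ := by positivity
  have ht : |deriv Real.smoothTransition (δ⁻¹ ^ 2 * ‖A (x - z)‖ ^ 2 - 1)| ≤ K := by
    apply hK
    rw [← mul_pow]
    nlinarith
  have hA : ‖A‖ ≤ 1 := S.orthogonalProjectionOnto_norm_le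
  have hn : ‖(innerSL ℝ (A (x - z))).comp A‖ ≤ ‖A (x - z)‖ := by
    refine (ContinuousLinearMap.opNorm_comp_le _ _).trans ?_
    rw [innerSL_apply_norm]
    exact mul_le_of_le_one_right (norm_nonneg _) hA
  have hn2 : ‖2 • (innerSL ℝ (A (x - z))).comp A‖ ≤ 2 * ‖A (x - z)‖ := by
    rw [two_smul, two_mul]
    exact (norm_add_le _ _).trans (add_le_add hn hn)
  rw [h4, h3.fderiv, norm_smul, norm_smul, Real.norm_eq_abs,
    Real.norm_of_nonneg (by positivity : (0 : ℝ) ≤ δ⁻¹ ^ 2)]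
  calc _ ≤ K * (δ⁻¹ ^ 2 * (2 * ‖A (x - z)‖)) := by gcongr
    _ = K * (2 * (δ⁻¹ * ‖A (x - z)‖)) * δ⁻¹ := by ring
    _ ≤ _ := by gcongr; linarith

end Cutoff

/-- The area of the boundary within distance `δ` of an affine subspace of codimension three is
`O(δ²)`. -/
theorem IsPolyhedron.measure_tube_le (hP : IsPolyhedron P) (S : Submodule ℝ (E n))
    (hS : 3 ≤ Module.finrank ℝ S) (z : E n) :
    ∃ C : ℝ, ∀ δ : ℝ, 0 < δ → δ ≤ 1 →
      (μHE[n - 1] : Measure (E n)).real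
        (frontier P ∩ {x | ‖S.orthogonalProjectionOnto (x - z)‖ ≤ δ}) ≤ C * δ ^ 2 := by
  obtain ⟨T, hT, hrank, hsub⟩ := hP.finite_faces
  obtain ⟨M, hM⟩ := hP.isCompact_frontier.isBounded.exists_norm_le
  have h := fun L (hL : L ∈ T) => measure_hyperplane_tube_le L (hrank L hL) S hS z M
  choose! C hC using h
  lift T to Finset (AffineSubspace ℝ (E n)) using hT
  refine ⟨∑ L ∈ T, |C L|, fun δ hδ hδ1 => ?_⟩
  have hle : μHE[n - 1] (frontier P ∩ {x | ‖S.orthogonalProjectionOnto (x - z)‖ ≤ δ}) ≤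
      ENNReal.ofReal ((∑ L ∈ T, |C L|) * δ ^ 2) := by
    have hcov : frontier P ∩ {x | ‖S.orthogonalProjectionOnto (x - z)‖ ≤ δ} ⊆
        ⋃ L ∈ T, (L : Set (E n)) ∩
          {x | ‖x‖ ≤ M ∧ ‖S.orthogonalProjectionOnto (x - z)‖ ≤ δ} := by
      rw [← iUnion₂_inter]
      exact fun x hx => ⟨hsub hx.1, hM x hx.1, hx.2⟩
    refine (measure_mono hcov).trans ((measure_biUnion_finset_le _ _).trans ?_)
    rw [Finset.sum_mul, ENNReal.ofReal_sum_of_nonneg fun _ _ => by positivity]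
    refine Finset.sum_le_sum fun L hL => (hC L hL δ hδ hδ1).trans (ENNReal.ofReal_le_ofReal ?_)
    gcongr
    exact le_abs_self _
  exact ENNReal.toReal_le_of_le_ofReal (by positivity) hle

theorem faceDiv_mul {f η : E n → ℝ} (hf : ContDiff ℝ 1 f) (hη : ContDiff ℝ 1 η) (x : E n) :
    faceDiv P u w (fun y => η y * f y) x = η x * faceDiv P u w f x + f x * faceDiv P u w η x := by
  rw [faceDiv, fderiv_fun_mul (hη.differentiable one_ne_zero x) (hf.differentiable one_ne_zero x)]
  simp only [faceDiv, add_apply, smul_apply, smul_eq_mul]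
  ring

/-- Removability of an affine subspace of codimension three in the divergence theorem: the cutoff
function has a gradient of size `O(δ⁻¹)`, on a part of the boundary whose area is `O(δ²)`. -/
theorem IsPolyhedron.divergence_of_cutoff (hP : IsPolyhedron P) (S : Submodule ℝ (E n))
    (hS : 3 ≤ Module.finrank ℝ S) (z u w : E n)
    (hnull : μHE[n - 2] (edges P ∩ {x | S.orthogonalProjectionOnto (x - z) = 0}) = 0)
    {f : E n → ℝ} (hf : ContDiff ℝ 1 f)
    (h : ∀ δ > 0, ∫ y in faces P, faceDiv P u w (fun y => cutoff S z δ y * f y) y ∂μHE[n - 1] =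
      ∫ y in edges P, edgeTerm P u w (fun y => cutoff S z δ y * f y) y ∂μHE[n - 2]) :
    ∫ y in faces P, faceDiv P u w f y ∂μHE[n - 1] =
      ∫ y in edges P, edgeTerm P u w f y ∂μHE[n - 2] := by
  obtain ⟨C, hC⟩ := hP.measure_tube_le S hS z
  obtain ⟨K, hK0, hK⟩ := exists_norm_fderiv_cutoff_le S z
  obtain ⟨M, hM⟩ := hP.isCompact_frontier.exists_bound_of_continuousOn hf.continuous.continuousOn
  set δ : ℕ → ℝ := fun k => 1 / ((k : ℝ) + 1) / 2 with hδ
  have hδ0 : ∀ k, 0 < δ k := fun k => by positivity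
  have hδ1 : ∀ k, 2 * δ k ≤ 1 := fun k => by
    have : 1 / ((k : ℝ) + 1) ≤ 1 := by
      rw [div_le_one (by positivity)]; linarith [k.cast_nonneg (α := ℝ)]
    simp only [hδ]; linarith
  have hδlim : Tendsto δ atTop (𝓝 0) := by
    have := (tendsto_one_div_add_atTop_nhds_zero_nat (𝕜 := ℝ)).div_const 2
    rwa [zero_div] at this
  have hone : ∀ x, S.orthogonalProjectionOnto (x - z) ≠ 0 →
      Tendsto (fun k => cutoff S z (δ k) x) atTop (𝓝 1) := by
    intro x hx
    have h2 : Tendsto (fun k => 2 * δ k) atTop (𝓝 0) := by simpa using hδlim.const_mul 2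
    refine tendsto_const_nhds.congr' ?_
    filter_upwards [h2.eventually_lt_const (norm_pos_iff.2 hx)] with k hk
    exact (cutoff_eq_one (hδ0 k) hk).symm
  -- the faces meet the affine subspace in a null set, by the bound for the area of tubes
  have hfnull : μHE[n - 1] (faces P ∩ {x | S.orthogonalProjectionOnto (x - z) = 0}) = 0 := by
    have hle : ∀ k, (μHE[n - 1] : Measure (E n)).real
        (faces P ∩ {x | S.orthogonalProjectionOnto (x - z) = 0}) ≤ C * (2 * δ k) ^ 2 := fun k => by
      refine le_trans (measureReal_mono ?_ ?_) (hC (2 * δ k) (by have := hδ0 k; positivity) (hδ1 k))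
      · rintro x ⟨hx, hx0⟩
        have hx0 : S.orthogonalProjectionOnto (x - z) = 0 := hx0
        refine ⟨faces_subset_frontier P hx, ?_⟩
        rw [mem_ofPred_eq, hx0, norm_zero]
        linarith [hδ0 k]
      · exact ((measure_mono inter_subset_left).trans_lt hP.measure_frontier_lt_top).ne
    have hlim : Tendsto (fun k => C * (2 * δ k) ^ 2) atTop (𝓝 0) := by
      simpa using (((hδlim.const_mul 2).pow 2).const_mul C)
    have := le_antisymm (ge_of_tendsto' hlim hle) measureReal_nonneg
    exact (measureReal_eq_zero_iff
      ((measure_mono inter_subset_left).trans_lt hP.measure_faces_lt_top).ne).1 this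
  have hae : ∀ {d : ℕ} {A : Set (E n)},
      μHE[d] (A ∩ {x | S.orthogonalProjectionOnto (x - z) = 0}) = 0 → MeasurableSet A →
      ∀ᵐ x ∂(μHE[d] : Measure (E n)).restrict A, S.orthogonalProjectionOnto (x - z) ≠ 0 := by
    intro d A h0 hA
    rw [ae_restrict_iff' hA, ae_iff]
    convert h0 using 2
    ext x
    simp
  -- the limits of the terms of the product rule and of the edge integral
  have lim1 : Tendsto (fun k => ∫ y in faces P, cutoff S z (δ k) y * faceDiv P u w f y ∂μHE[n - 1])
      atTop (𝓝 (∫ y in faces P, faceDiv P u w f y ∂μHE[n - 1])) := by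
    refine tendsto_integral_of_dominated_convergence (fun y => |faceDiv P u w f y|) (fun k => ?_)
      (hP.integrableOn_faceDiv hf u w).abs (fun k => Eventually.of_forall fun y => ?_) ?_
    · exact ((contDiff_cutoff S z (δ k)).continuous.aestronglyMeasurable).mul
        (hP.integrableOn_faceDiv hf u w).aestronglyMeasurable
    · rw [Real.norm_eq_abs, abs_mul]
      exact mul_le_of_le_one_left (abs_nonneg _) (abs_cutoff_le_one S z _ y)
    · filter_upwards [hae hfnull (measurableSet_faces P)] with x hx
      simpa using (hone x hx).mul_const (faceDiv P u w f x)
  have lim2 : Tendsto (fun k => ∫ y in edges P, edgeTerm P u w (fun y => cutoff S z (δ k) y * f y) y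
      ∂μHE[n - 2]) atTop (𝓝 (∫ y in edges P, edgeTerm P u w f y ∂μHE[n - 2])) := by
    have e : ∀ k y, edgeTerm P u w (fun y => cutoff S z (δ k) y * f y) y =
        cutoff S z (δ k) y * edgeTerm P u w f y := fun k y => by simp only [edgeTerm]; ring
    simp_rw [e]
    refine tendsto_integral_of_dominated_convergence (fun y => |edgeTerm P u w f y|) (fun k => ?_)
      (hP.integrableOn_edgeTerm hf.continuous u w).abs
      (fun k => Eventually.of_forall fun y => ?_) ?_
    · exact ((contDiff_cutoff S z (δ k)).continuous.aestronglyMeasurable).mul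
        (hP.integrableOn_edgeTerm hf.continuous u w).aestronglyMeasurable
    · rw [Real.norm_eq_abs, abs_mul]
      exact mul_le_of_le_one_left (abs_nonneg _) (abs_cutoff_le_one S z _ y)
    · filter_upwards [hae hnull (measurableSet_edges P)] with x hx
      simpa using (hone x hx).mul_const (edgeTerm P u w f x)
  have hint : ∀ k, IntegrableOn (fun y => f y * faceDiv P u w (cutoff S z (δ k)) y) (faces P)
      μHE[n - 1] := by
    intro k
    refine (hP.integrableOn_faceDiv (contDiff_cutoff S z (δ k)) u w).bdd_mul (c := M)
      hf.continuous.aestronglyMeasurable ?_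
    filter_upwards [ae_restrict_mem (measurableSet_faces P)] with x hx
    exact hM x (faces_subset_frontier P hx)
  have lim3 : Tendsto (fun k => ∫ y in faces P, f y * faceDiv P u w (cutoff S z (δ k)) y
      ∂μHE[n - 1]) atTop (𝓝 0) := by
    have hbound : ∀ k, ‖∫ y in faces P, f y * faceDiv P u w (cutoff S z (δ k)) y ∂μHE[n - 1]‖ ≤
        (|M| * (K * (2 * ‖u‖ * ‖w‖)) * (C * 4)) * δ k := by
      intro k
      set B := {x : E n | ‖S.orthogonalProjectionOnto (x - z)‖ ≤ 2 * δ k} with hB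
      have hBm : MeasurableSet B :=
        (isClosed_le (by fun_prop) continuous_const).measurableSet
      have hzero : ∀ y ∈ faces P \ B, f y * faceDiv P u w (cutoff S z (δ k)) y = 0 := by
        rintro y ⟨-, hy⟩
        rw [faceDiv, fderiv_cutoff_eq_zero (hδ0 k) (not_le.1 hy)]
        simp
      rw [← integral_inter_add_sdiff hBm (hint k), setIntegral_eq_zero_of_forall_eq_zero hzero,
        add_zero]
      have hfinB : μHE[n - 1] (faces P ∩ B) < ⊤ :=
        (measure_mono inter_subset_left).trans_lt hP.measure_faces_lt_top
      refine (norm_setIntegral_le_of_norm_le_const hfinB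
        (C := |M| * (K * (δ k)⁻¹ * (2 * ‖u‖ * ‖w‖))) fun y hy => ?_).trans ?_
      · rw [norm_mul]
        have h1 := (hM y (faces_subset_frontier P hy.1)).trans (le_abs_self M)
        have h2 := abs_faceDiv_le hy.1 u w (cutoff S z (δ k))
        have h3 := hK (δ k) (hδ0 k) y
        refine mul_le_mul h1 ?_ (norm_nonneg _) (abs_nonneg _)
        rw [Real.norm_eq_abs]
        exact h2.trans (by gcongr)
      · have hmono : (μHE[n - 1] : Measure (E n)).real (faces P ∩ B) ≤ C * (2 * δ k) ^ 2 := by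
          refine le_trans (measureReal_mono ?_ ?_)
            (hC (2 * δ k) (by have := hδ0 k; positivity) (hδ1 k))
          · exact inter_subset_inter_left _ (faces_subset_frontier P)
          · exact ((measure_mono inter_subset_left).trans_lt hP.measure_frontier_lt_top).ne
        have hne := (hδ0 k).ne'
        calc _ ≤ |M| * (K * (δ k)⁻¹ * (2 * ‖u‖ * ‖w‖)) * (C * (2 * δ k) ^ 2) := by
              have := hδ0 k
              gcongr
          _ = _ := by field_simp; ring
    refine squeeze_zero_norm hbound ?_
    simpa using hδlim.const_mul (|M| * (K * (2 * ‖u‖ * ‖w‖)) * (C * 4))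
  have hlim := lim1.add lim3
  rw [add_zero] at hlim
  refine tendsto_nhds_unique hlim (lim2.congr fun k => ?_)
  rw [← h (δ k) (hδ0 k), ← integral_add _ (hint k)]
  · refine integral_congr_ae (Eventually.of_forall fun y => ?_)
    exact faceDiv_mul hf (contDiff_cutoff S z (δ k)) y
  · refine (hP.integrableOn_faceDiv hf u w).bdd_mul (c := 1)
      (contDiff_cutoff S z (δ k)).continuous.aestronglyMeasurable
      (Eventually.of_forall fun x => abs_cutoff_le_one S z _ x)

/-- The divergence theorem, by induction on the number of affine subspaces that contain the
corners. -/
theorem IsPolyhedron.divergence_of_hasCompactSupport (hn : 3 ≤ n) (hP : IsPolyhedron P)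
    {f : E n → ℝ} (hf : ContDiff ℝ 1 f) (hc : HasCompactSupport f) (u w : E n) :
    ∫ y in faces P, faceDiv P u w f y ∂μHE[n - 1] =
      ∫ y in edges P, edgeTerm P u w f y ∂μHE[n - 2] := by
  obtain ⟨T, hT, hrank, hsub⟩ := hP.two_faces
  -- the affine subspaces are removed one at a time, multiplying `f` by a cutoff function
  have key : ∀ T : Set (AffineSubspace ℝ (E n)), T.Finite →
      (∀ L ∈ T, Module.finrank ℝ L.direction + 3 ≤ n) → ∀ f : E n → ℝ, ContDiff ℝ 1 f →
      HasCompactSupport f →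
      (tsupport f ∩ (frontier P \ (faces P ∪ edges P)) ⊆ ⋃ L ∈ T, (L : Set (E n))) →
      ∫ y in faces P, faceDiv P u w f y ∂μHE[n - 1] =
        ∫ y in edges P, edgeTerm P u w f y ∂μHE[n - 2] := by
    intro T hT
    induction T, hT using Set.Finite.induction_on with
    | empty =>
      intro _ f hf hc hsub
      refine divergence_of_tsupport hP hf hc (fun x hx => ?_) u w
      by_contra hcon
      simpa using hsub ⟨hx.1, hx.2, hcon⟩
    | @insert L T _ _ ih =>
      intro hrank f hf hc hsub
      have ih' := ih fun L hL => hrank L (mem_insert_of_mem _ hL)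
      rcases (L : Set (E n)).eq_empty_or_nonempty with h0 | ⟨z, hz⟩
      · refine ih' f hf hc ?_
        rwa [biUnion_insert, h0, empty_union] at hsub
      have hL := hrank L (mem_insert _ _)
      have hmem : ∀ x, L.directionᗮ.orthogonalProjectionOnto (x - z) = 0 ↔ x ∈ L := by
        intro x
        rw [Submodule.orthogonalProjectionOnto_eq_zero_iff, Submodule.orthogonal_orthogonal]
        exact AffineSubspace.vsub_right_mem_direction_iff_mem hz x
      refine hP.divergence_of_cutoff L.directionᗮ ?_ z u w ?_ hf fun δ hδ => ?_
      · have := L.direction.finrank_add_finrank_orthogonal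
        rw [finrank_euclideanSpace_fin] at this
        omega
      · simp_rw [hmem]
        exact measure_mono_null inter_subset_right
          (measure_affineSubspace_eq_zero (d := n - 2) L (by omega))
      · refine ih' _ ((contDiff_cutoff _ _ _).mul hf) hc.mul_left fun x hx => ?_
        have h1 := hsub ⟨tsupport_mul_subset_right hx.1, hx.2⟩
        rw [biUnion_insert] at h1
        refine h1.resolve_left fun hxL => ?_
        have h2 := tsupport_cutoff_subset hδ (tsupport_mul_subset_left hx.1)
        rw [mem_ofPred_eq, (hmem x).2 hxL, norm_zero] at h2
        exact h2.not_gt hδ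
  exact key T hT hrank f hf hc (inter_subset_right.trans hsub)

open scoped Manifold ContDiff in
/-- The divergence theorem on the faces of a polyhedron, for a vector field defined near the
boundary. -/
theorem IsPolyhedron.divergence (hn : 3 ≤ n) (hP : IsPolyhedron P) {U : Set (E n)} (hU : IsOpen U)
    (hPU : frontier P ⊆ U) {f : E n → ℝ} (hf : ContDiffOn ℝ 1 f U) (u w : E n) :
    IntegrableOn (faceDiv P u w f) (faces P) μHE[n - 1] ∧
    IntegrableOn (edgeTerm P u w f) (edges P) μHE[n - 2] ∧
    ∫ y in faces P, faceDiv P u w f y ∂μHE[n - 1] =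
      ∫ y in edges P, edgeTerm P u w f y ∂μHE[n - 2] := by
  -- a cutoff function `η`, equal to `1` near the boundary, extends `f` from `U` to the whole space
  obtain ⟨K, hK, hK1, hK2⟩ := exists_compact_between hP.isCompact_frontier hU hPU
  obtain ⟨K', hK', hK1', hK2'⟩ := exists_compact_between hP.isCompact_frontier isOpen_interior hK1
  obtain ⟨η, hη, -, hη0, hη1⟩ := exists_contMDiff_support_eq_eq_one_iff (n := 1) 𝓘(ℝ, E n)
    isOpen_interior hK'.isClosed hK2'
  have hηd : ContDiff ℝ 1 η := by simpa using hη.contDiff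
  have hsupp : tsupport η ⊆ K := by
    rw [tsupport, hη0]
    exact closure_minimal interior_subset hK.isClosed
  set f' : E n → ℝ := fun y => η y * f y with hf'
  have hf'd : ContDiff ℝ 1 f' := by
    rw [contDiff_iff_contDiffAt]
    intro x
    by_cases hx : x ∈ U
    · exact hηd.contDiffAt.mul (hf.contDiffAt (hU.mem_nhds hx))
    · have : f' =ᶠ[𝓝 x] fun _ => 0 := by
        have hx' : x ∉ tsupport η := fun h => hx (hK2 (hsupp h))
        filter_upwards [(isClosed_tsupport η).isOpen_compl.mem_nhds hx'] with y hy
        simp [hf', image_eq_zero_of_notMem_tsupport hy]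
      exact contDiffAt_const.congr_of_eventuallyEq this
  have hf'c : HasCompactSupport f' :=
    (HasCompactSupport.of_support_subset_isCompact hK
      ((subset_tsupport η).trans hsupp)).mul_right
  have hnear : ∀ x ∈ frontier P, f' =ᶠ[𝓝 x] f := by
    intro x hx
    filter_upwards [isOpen_interior.mem_nhds (hK1' hx)] with y hy
    simp [hf', (hη1 y).1 (interior_subset hy)]
  have e1 : ∀ x ∈ faces P, faceDiv P u w f' x = faceDiv P u w f x := fun x hx => by
    rw [faceDiv, (hnear x (faces_subset_frontier P hx)).fderiv_eq, faceDiv]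
  have e2 : ∀ x ∈ edges P, edgeTerm P u w f' x = edgeTerm P u w f x := fun x hx => by
    rw [edgeTerm, (hnear x (edges_subset_frontier P hx)).eq_of_nhds, edgeTerm]
  refine ⟨(hP.integrableOn_faceDiv hf'd u w).congr_fun e1 (measurableSet_faces P),
    (hP.integrableOn_edgeTerm hf'd.continuous u w).congr_fun e2 (measurableSet_edges P), ?_⟩
  rw [← setIntegral_congr_fun (measurableSet_faces P) e1,
    ← setIntegral_congr_fun (measurableSet_edges P) e2]
  exact hP.divergence_of_hasCompactSupport hn hf'd hf'c u w

end Corners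

/-! ### Perturbation of matrices

The norm of a matrix is the maximum of the `ℓ¹` norms of its rows. -/

section Matrices

open scoped Matrix.Norms.Operator

variable {n : ℕ}

theorem abs_entry_le_norm {m : Type*} [Fintype m] (M : Matrix m m ℝ) (i j : m) : |M i j| ≤ ‖M‖ := by
  have h1 := Matrix.linfty_opNNNorm_def M
  have h2 : ‖M i j‖₊ ≤ ∑ j, ‖M i j‖₊ :=
    Finset.single_le_sum (f := fun j => ‖M i j‖₊) (fun _ _ => zero_le) (Finset.mem_univ j)
  have h3 : (∑ j, ‖M i j‖₊) ≤ ‖M‖₊ := by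
    rw [h1]
    exact Finset.le_sup (f := fun i => ∑ j, ‖M i j‖₊) (Finset.mem_univ i)
  exact_mod_cast h2.trans h3

theorem norm_le_of_abs_entry_le {m : Type*} [Fintype m] {M : Matrix m m ℝ} {r : ℝ} (hr : 0 ≤ r)
    (h : ∀ i j, |M i j| ≤ r) : ‖M‖ ≤ Fintype.card m * r := by
  lift r to NNReal using hr
  have : ‖M‖₊ ≤ Fintype.card m * r := by
    rw [Matrix.linfty_opNNNorm_def]
    refine Finset.sup_le fun i _ => ?_
    have h2 : ∀ j ∈ Finset.univ, ‖M i j‖₊ ≤ r := fun j _ => by exact_mod_cast h i j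
    refine (Finset.sum_le_card_nsmul _ _ _ h2).trans ?_
    simp
  exact_mod_cast this

section Inverse

variable {m : Type*} [Fintype m] [DecidableEq m] {M : Matrix m m ℝ}

theorem isUnit_det_of_norm_sub_one_lt (h : ‖M - 1‖ < 1) : IsUnit M.det := by
  rw [← Matrix.isUnit_iff_isUnit_det]
  have : M = ((Units.oneSub (1 - M) (by rwa [norm_sub_rev]) : (Matrix m m ℝ)ˣ) : Matrix m m ℝ) := by
    simp
  rw [this]
  exact Units.isUnit _

theorem norm_inv_sub_one_le (h : ‖M - 1‖ ≤ 1 / 2) : ‖M⁻¹ - 1‖ ≤ 2 * ‖M - 1‖ := by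
  have hu : IsUnit M.det := isUnit_det_of_norm_sub_one_lt (h.trans_lt (by norm_num))
  have e : M⁻¹ - 1 = -((M⁻¹ - 1) * (M - 1)) - (M - 1) := by
    have := Matrix.nonsing_inv_mul M hu
    noncomm_ring [this]
  have h1 : ‖M⁻¹ - 1‖ ≤ ‖M⁻¹ - 1‖ * ‖M - 1‖ + ‖M - 1‖ := by
    conv_lhs => rw [e]
    refine (norm_sub_le _ _).trans ?_
    rw [norm_neg]
    gcongr
    exact norm_mul_le _ _
  nlinarith [norm_nonneg (M⁻¹ - 1)]

/-- First-order expansion of the inverse of `1 + h`, with a quadratic error. -/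
theorem norm_inv_sub_one_add_le (h : ‖M - 1‖ ≤ 1 / 2) :
    ‖M⁻¹ - 1 + (M - 1)‖ ≤ 2 * ‖M - 1‖ ^ 2 := by
  have hu : IsUnit M.det := isUnit_det_of_norm_sub_one_lt (h.trans_lt (by norm_num))
  have e : M⁻¹ - 1 + (M - 1) = -((M⁻¹ - 1) * (M - 1)) := by
    have := Matrix.nonsing_inv_mul M hu
    noncomm_ring [this]
  rw [e, norm_neg]
  refine (norm_mul_le _ _).trans ?_
  have := norm_inv_sub_one_le h
  nlinarith [norm_nonneg (M - 1)]

end Inverse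

/-- The determinant is Lipschitz at the identity, uniformly over bounded dimensions. -/
theorem exists_abs_det_sub_one_le (n : ℕ) : ∃ C δ : ℝ, 0 ≤ C ∧ 0 < δ ∧ ∀ k ≤ n,
    ∀ M : Matrix (Fin k) (Fin k) ℝ, ‖M - 1‖ ≤ δ → |M.det - 1| ≤ C * ‖M - 1‖ := by
  have key : ∀ k, ∃ C δ : ℝ, 0 ≤ C ∧ 0 < δ ∧
      ∀ M : Matrix (Fin k) (Fin k) ℝ, ‖M - 1‖ ≤ δ → |M.det - 1| ≤ C * ‖M - 1‖ := by
    intro k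
    have hd : Differentiable ℝ (fun M : Matrix (Fin k) (Fin k) ℝ => M.det) := by
      have he : ∀ i j : Fin k, ContDiff ℝ 1 (fun M : Matrix (Fin k) (Fin k) ℝ => M i j) :=
        fun i j => (LinearMap.toContinuousLinearMap (Matrix.entryLinearMap ℝ ℝ i j)).contDiff
      simp_rw [Matrix.det_apply']
      exact (ContDiff.sum fun σ _ => contDiff_const.mul
        (contDiff_prod fun i _ => he (σ i) i)).differentiable one_ne_zero
    obtain ⟨C, hC, hbig⟩ := (hd 1).isBigO_sub.exists_pos
    rw [Asymptotics.isBigOWith_iff] at hbig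
    obtain ⟨δ, hδ, hball⟩ := Metric.eventually_nhds_iff_ball.1 hbig
    refine ⟨C, δ / 2, hC.le, by positivity, fun M hM => ?_⟩
    have := hball M (by rw [mem_ball_iff_norm]; linarith)
    simpa using this
  induction n with
  | zero =>
    obtain ⟨C, δ, h1, h2, h3⟩ := key 0
    refine ⟨C, δ, h1, h2, fun k hk => ?_⟩
    obtain rfl : k = 0 := by omega
    exact h3
  | succ n ih =>
    obtain ⟨C, δ, h1, h2, h3⟩ := key (n + 1)
    obtain ⟨C', δ', h1', h2', h3'⟩ := ih
    refine ⟨max C C', min δ δ', le_max_of_le_left h1, lt_min h2 h2', fun k hk M hM => ?_⟩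
    rcases Nat.le_succ_iff.1 hk with hk | rfl
    · refine (h3' k hk M (hM.trans (min_le_right _ _))).trans ?_
      gcongr
      exact le_max_right _ _
    · refine (h3 M (hM.trans (min_le_left _ _))).trans ?_
      gcongr
      exact le_max_left _ _

/-! ### The metric as a bilinear form -/

theorem abs_coord_le (u : E n) (i : Fin n) : |u i| ≤ ‖u‖ := by
  simpa using PiLp.norm_apply_le u i

theorem metricInner_one (u v : E n) : metricInner 1 u v = inner ℝ u v := by
  simp [metricInner, Matrix.one_apply, PiLp.inner_apply, mul_comm]

theorem metricInner_add_matrix (M N : Matrix (Fin n) (Fin n) ℝ) (u v : E n) :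
    metricInner (M + N) u v = metricInner M u v + metricInner N u v := by
  simp [metricInner, add_mul, Finset.sum_add_distrib]

theorem metricInner_sub_matrix (M N : Matrix (Fin n) (Fin n) ℝ) (u v : E n) :
    metricInner (M - N) u v = metricInner M u v - metricInner N u v := by
  simp [metricInner, sub_mul, Finset.sum_sub_distrib]

theorem metricInner_eq_dotProduct (M : Matrix (Fin n) (Fin n) ℝ) (u v : E n) :
    metricInner M u v = u.ofLp ⬝ᵥ M *ᵥ v.ofLp := by
  simp only [metricInner, dotProduct, Matrix.mulVec, Finset.mul_sum]
  refine Finset.sum_congr rfl fun i _ => Finset.sum_congr rfl fun j _ => by ring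

theorem metricInner_comm {M : Matrix (Fin n) (Fin n) ℝ} (hM : Mᵀ = M) (u v : E n) :
    metricInner M u v = metricInner M v u := by
  rw [metricInner_eq_dotProduct, metricInner_eq_dotProduct, Matrix.dotProduct_mulVec,
    ← Matrix.mulVec_transpose, hM, dotProduct_comm]

theorem metricInner_sub_left (M : Matrix (Fin n) (Fin n) ℝ) (u v w : E n) :
    metricInner M (u - v) w = metricInner M u w - metricInner M v w := by
  simp [metricInner_eq_dotProduct, sub_dotProduct]

theorem metricInner_sub_right (M : Matrix (Fin n) (Fin n) ℝ) (u v w : E n) :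
    metricInner M u (v - w) = metricInner M u v - metricInner M u w := by
  simp [metricInner_eq_dotProduct, Matrix.mulVec_sub]

theorem metricInner_add_left (M : Matrix (Fin n) (Fin n) ℝ) (u v w : E n) :
    metricInner M (u + v) w = metricInner M u w + metricInner M v w := by
  simp [metricInner_eq_dotProduct, add_dotProduct]

theorem metricInner_add_right (M : Matrix (Fin n) (Fin n) ℝ) (u v w : E n) :
    metricInner M u (v + w) = metricInner M u v + metricInner M u w := by
  simp [metricInner_eq_dotProduct, Matrix.mulVec_add]

theorem metricInner_smul_left (M : Matrix (Fin n) (Fin n) ℝ) (r : ℝ) (u v : E n) :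
    metricInner M (r • u) v = r * metricInner M u v := by
  simp [metricInner_eq_dotProduct]

theorem metricInner_smul_right (M : Matrix (Fin n) (Fin n) ℝ) (r : ℝ) (u v : E n) :
    metricInner M u (r • v) = r * metricInner M u v := by
  simp [metricInner_eq_dotProduct, Matrix.mulVec_smul]

theorem abs_metricInner_le (M : Matrix (Fin n) (Fin n) ℝ) {u v : E n} (hu : ‖u‖ = 1)
    (hv : ‖v‖ = 1) : |metricInner M u v| ≤ (n : ℝ) ^ 2 * ‖M‖ := by
  have h : ∀ i j, |M i j * u i * v j| ≤ ‖M‖ := fun i j => by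
    rw [abs_mul, abs_mul]
    have h1 := abs_entry_le_norm M i j
    have h2 := hu ▸ abs_coord_le u i
    have h3 := hv ▸ abs_coord_le v j
    calc _ ≤ ‖M‖ * 1 * 1 := by gcongr
      _ = _ := by ring
  calc |metricInner M u v| ≤ ∑ _i : Fin n, ∑ _j : Fin n, ‖M‖ :=
        (Finset.abs_sum_le_sum_abs _ _).trans (Finset.sum_le_sum fun i _ =>
          (Finset.abs_sum_le_sum_abs _ _).trans (Finset.sum_le_sum fun j _ => h i j))
    _ = _ := by simp; ring

theorem metricInner_self_pos {G : Matrix (Fin n) (Fin n) ℝ} (hG : G.PosDef) {u : E n}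
    (hu : u ≠ 0) : 0 < metricInner G u u := by
  rw [metricInner_eq_dotProduct]
  have := hG.dotProduct_mulVec_pos (x := u.ofLp) (fun h => hu (by ext i; simp [h]))
  simpa using this

/-- The unit normal is `G⁻¹ a`, normalized by the dual norm of `a`. -/
theorem unitNormal_eq (G : Matrix (Fin n) (Fin n) ℝ) (a : E n) :
    unitNormal G a = (Real.sqrt (metricInner G⁻¹ a a))⁻¹ • WithLp.toLp 2 (G⁻¹ *ᵥ a.ofLp) := by
  ext i
  simp [unitNormal, metricInner, Matrix.mulVec, dotProduct, div_eq_inv_mul]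

/-- The unit normal is `G`-orthogonal to the hyperplane: its `G`-product with `u` is a multiple of
the Euclidean product with `a`. -/
theorem metricInner_unitNormal {G : Matrix (Fin n) (Fin n) ℝ} (hG : IsUnit G.det) (u a : E n) :
    metricInner G u (unitNormal G a) = (Real.sqrt (metricInner G⁻¹ a a))⁻¹ * inner ℝ u a := by
  have h : metricInner G u (WithLp.toLp 2 (G⁻¹ *ᵥ a.ofLp)) = inner ℝ u a := by
    rw [metricInner_eq_dotProduct, Matrix.mulVec_mulVec, Matrix.mul_nonsing_inv _ hG,
      ← metricInner_eq_dotProduct, metricInner_one]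
  rw [unitNormal_eq, metricInner_smul_right, h]

theorem inner_unitNormal (G : Matrix (Fin n) (Fin n) ℝ) (a b : E n) :
    inner ℝ (unitNormal G a) b = (Real.sqrt (metricInner G⁻¹ a a))⁻¹ * metricInner G⁻¹ b a := by
  have h : inner ℝ b (WithLp.toLp 2 (G⁻¹ *ᵥ a.ofLp)) = metricInner G⁻¹ b a := by
    rw [← metricInner_one, metricInner_eq_dotProduct, Matrix.one_mulVec,
      metricInner_eq_dotProduct]
  rw [unitNormal_eq, real_inner_smul_left, real_inner_comm, h]

/-- The cosine of the angle between two hyperplanes. -/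
theorem metricInner_unitNormal_unitNormal {G : Matrix (Fin n) (Fin n) ℝ} (hG : IsUnit G.det)
    (a b : E n) : metricInner G (unitNormal G a) (unitNormal G b) =
      metricInner G⁻¹ b a * (Real.sqrt (metricInner G⁻¹ a a))⁻¹ *
        (Real.sqrt (metricInner G⁻¹ b b))⁻¹ := by
  rw [metricInner_unitNormal hG, inner_unitNormal]
  ring

/-- The Cauchy–Schwarz inequality for the unit normals, which makes `normalAngle` an angle rather
than a clamped value of `arccos`. -/
theorem abs_metricInner_unitNormal_le_one {G : Matrix (Fin n) (Fin n) ℝ} (hG : G.PosDef)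
    {a b : E n} (ha : a ≠ 0) (hb : b ≠ 0) :
    |metricInner G (unitNormal G a) (unitNormal G b)| ≤ 1 := by
  have hu : IsUnit G.det := hG.det_pos.ne'.isUnit
  have hsym : Gᵀ = G := by
    rw [← Matrix.conjTranspose_eq_transpose_of_trivial]; exact hG.isHermitian
  have hone : ∀ {a : E n}, a ≠ 0 → metricInner G (unitNormal G a) (unitNormal G a) = 1 := by
    intro a ha
    have hpos := metricInner_self_pos hG.inv ha
    rw [metricInner_unitNormal_unitNormal hu, mul_assoc, ← mul_inv, Real.mul_self_sqrt hpos.le]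
    exact mul_inv_cancel₀ hpos.ne'
  have hnn : ∀ u : E n, 0 ≤ metricInner G u u := fun u => by
    by_cases h : u = 0
    · simp [h, metricInner]
    · exact (metricInner_self_pos hG h).le
  -- expand the squared `G`-norms of the difference and the sum of the unit normals
  have h1 := hnn (unitNormal G a - unitNormal G b)
  have h2 := hnn (unitNormal G a + unitNormal G b)
  rw [metricInner_sub_left, metricInner_sub_right, metricInner_sub_right, hone ha, hone hb,
    metricInner_comm hsym (unitNormal G b)] at h1
  rw [metricInner_add_left, metricInner_add_right, metricInner_add_right, hone ha, hone hb,
    metricInner_comm hsym (unitNormal G b)] at h2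
  exact abs_le.2 ⟨by linarith, by linarith⟩

theorem normalAngle_one {a b : E n} (ha : ‖a‖ = 1) (hb : ‖b‖ = 1) :
    normalAngle 1 a b = Real.arccos (inner ℝ a b) := by
  have h : ∀ {a : E n}, ‖a‖ = 1 → inner ℝ a a = (1 : ℝ) := inner_self_of_norm_one
  rw [normalAngle, metricInner_unitNormal_unitNormal (by simp), inv_one, metricInner_one,
    metricInner_one, metricInner_one, h ha, h hb, real_inner_comm a b]
  simp

/-! ### Volume densities -/

theorem inducedMetric_sub_one (G : Matrix (Fin n) (Fin n) ℝ) (W : Submodule ℝ (E n)) :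
    inducedMetric G W - 1 = inducedMetric (G - 1) W := by
  ext α β
  simp only [inducedMetric, Matrix.sub_apply, Matrix.of_apply, metricInner_sub_matrix,
    metricInner_one]
  congr 1
  have := orthonormal_iff_ite.1 (stdOrthonormalBasis ℝ W).orthonormal α β
  rw [Matrix.one_apply, ← this, Submodule.coe_inner]

theorem norm_stdOrthonormalBasis (W : Submodule ℝ (E n)) (α : Fin (Module.finrank ℝ W)) :
    ‖(stdOrthonormalBasis ℝ W α : E n)‖ = 1 := by
  rw [Submodule.norm_coe]
  exact (stdOrthonormalBasis ℝ W).norm_eq_one α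

theorem finrank_le_dim (W : Submodule ℝ (E n)) : Module.finrank ℝ W ≤ n := by
  simpa using Submodule.finrank_le W

theorem norm_inducedMetric_sub_one_le (G : Matrix (Fin n) (Fin n) ℝ) (W : Submodule ℝ (E n)) :
    ‖inducedMetric G W - 1‖ ≤ (n : ℝ) ^ 3 * ‖G - 1‖ := by
  rw [inducedMetric_sub_one]
  have h := norm_le_of_abs_entry_le (M := inducedMetric (G - 1) W) (r := (n : ℝ) ^ 2 * ‖G - 1‖)
    (by positivity) fun α β => abs_metricInner_le _ (norm_stdOrthonormalBasis W α)
      (norm_stdOrthonormalBasis W β)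
  refine h.trans ?_
  rw [Fintype.card_fin]
  have : (Module.finrank ℝ W : ℝ) ≤ n := by exact_mod_cast finrank_le_dim W
  calc _ ≤ (n : ℝ) * ((n : ℝ) ^ 2 * ‖G - 1‖) := by gcongr
    _ = _ := by ring

theorem exists_abs_volDensity_sub_one_le (n : ℕ) : ∃ C δ : ℝ, 0 ≤ C ∧ 0 < δ ∧
    ∀ (G : Matrix (Fin n) (Fin n) ℝ) (W : Submodule ℝ (E n)), ‖G - 1‖ ≤ δ →
      |volDensity G W - 1| ≤ C * ‖G - 1‖ := by
  obtain ⟨C, δ, hC, hδ, h⟩ := exists_abs_det_sub_one_le n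
  refine ⟨C * n ^ 3, δ / (n ^ 3 + 1), by positivity, by positivity, fun G W hG => ?_⟩
  have h1 := norm_inducedMetric_sub_one_le G W
  rw [le_div_iff₀ (by positivity)] at hG
  have h2 := h _ (finrank_le_dim W) (inducedMetric G W)
    (h1.trans (by nlinarith [norm_nonneg (G - 1)]))
  have h3 : |volDensity G W - 1| ≤ |(inducedMetric G W).det - 1| := by
    have hs : ∀ t : ℝ, |Real.sqrt t - 1| ≤ |t - 1| := by
      intro t
      rcases le_total t 0 with ht | ht
      · rw [Real.sqrt_eq_zero_of_nonpos ht, abs_of_neg (by norm_num), abs_of_neg (by linarith)]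
        linarith
      · have e : t - 1 = (Real.sqrt t - 1) * (Real.sqrt t + 1) := by
          nlinarith [Real.mul_self_sqrt ht]
        rw [e, abs_mul]
        refine le_mul_of_one_le_right (abs_nonneg _) ?_
        rw [abs_of_nonneg (by positivity)]
        linarith [Real.sqrt_nonneg t]
    exact hs _
  calc _ ≤ C * ‖inducedMetric G W - 1‖ := h3.trans h2
    _ ≤ C * ((n : ℝ) ^ 3 * ‖G - 1‖) := by gcongr
    _ = _ := by ring

end Matrices

/-! ### The angle defect -/

section AngleDefect

open scoped Matrix.Norms.Operator

variable {n : ℕ}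

theorem abs_sub_sin_le (δ : ℝ) : |δ - Real.sin δ| ≤ 2 * δ ^ 2 := by
  rcases le_total |δ| 1 with h | h
  · have h1 := Real.sin_bound h
    have e : δ - Real.sin δ = δ ^ 3 / 6 - (Real.sin δ - (δ - δ ^ 3 / 6)) := by ring
    rw [e]
    refine (abs_sub _ _).trans ?_
    have h2 : |δ ^ 3 / 6| ≤ δ ^ 2 := by
      rw [abs_div, abs_pow, ← sq_abs δ, abs_of_pos (by norm_num : (0 : ℝ) < 6)]
      have := abs_nonneg δ
      have : |δ| ^ 3 ≤ |δ| ^ 2 := pow_le_pow_of_le_one this h (by norm_num)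
      linarith [sq_nonneg |δ|]
    have h3 : |δ| ^ 5 / 100 ≤ δ ^ 2 := by
      rw [← sq_abs δ]
      have : |δ| ^ 5 ≤ |δ| ^ 2 := pow_le_pow_of_le_one (abs_nonneg δ) h (by norm_num)
      linarith [sq_nonneg |δ|]
    linarith
  · have h1 : |Real.sin δ| ≤ |δ| := Real.abs_sin_le_abs
    have h2 := abs_sub δ (Real.sin δ)
    rw [← sq_abs δ]
    nlinarith

/-- The modulus of continuity of the angle as a function of its cosine. -/
theorem abs_angle_sub_le {θ φ : ℝ} (hθ : θ ∈ Icc 0 Real.pi) (hφ : φ ∈ Icc 0 Real.pi) :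
    Real.sin φ * |θ - φ| ≤ 4 * |Real.cos θ - Real.cos φ| := by
  -- `cos θ - cos φ = -2 sin ((θ + φ) / 2) sin ((θ - φ) / 2)`, and `sin` is concave on `[0, π]`
  have hmid : Real.sin φ / 2 ≤ Real.sin ((θ + φ) / 2) := by
    have h := strictConcaveOn_sin_Icc.concaveOn.2 hθ hφ (by norm_num : (0 : ℝ) ≤ 1 / 2)
      (by norm_num : (0 : ℝ) ≤ 1 / 2) (by norm_num)
    have h0 := Real.sin_nonneg_of_mem_Icc hθ
    simp only [smul_eq_mul] at h
    rw [show (θ + φ) / 2 = 1 / 2 * θ + 1 / 2 * φ by ring]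
    linarith
  have hhalf : |θ - φ| / 4 ≤ |Real.sin ((θ - φ) / 2)| := by
    have key : ∀ t : ℝ, 0 ≤ t → t ≤ Real.pi → t / 4 ≤ Real.sin (t / 2) := by
      intro t h0 h1
      refine le_trans ?_ (Real.mul_le_sin (by linarith) (by linarith))
      rw [div_mul_div_comm, mul_comm 2 t, mul_div_mul_right _ _ two_ne_zero]
      exact div_le_div_of_nonneg_left h0 Real.pi_pos Real.pi_le_four
    have habs : |Real.sin ((θ - φ) / 2)| = |Real.sin (|θ - φ| / 2)| := by
      rcases abs_choice (θ - φ) with e | e <;> rw [e]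
      rw [neg_div, Real.sin_neg, abs_neg]
    rw [habs]
    have hle : |θ - φ| ≤ Real.pi :=
      abs_le.2 ⟨by linarith [hθ.1, hφ.2], by linarith [hθ.2, hφ.1]⟩
    exact (key _ (abs_nonneg _) hle).trans (le_abs_self _)
  have hs := Real.sin_nonneg_of_mem_Icc hφ
  rw [Real.cos_sub_cos, abs_mul, abs_mul, abs_neg, abs_two]
  have h1 := hmid.trans (le_abs_self _)
  have := mul_le_mul h1 hhalf (by positivity) (abs_nonneg _)
  linarith

/-- The derivative of the angle with respect to its cosine, with a quadratic error. -/
theorem abs_angle_sub_add_le {θ φ : ℝ} (hθ : θ ∈ Icc 0 Real.pi) (hφ : φ ∈ Icc 0 Real.pi)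
    (hs : 0 < Real.sin φ) :
    |θ - φ + (Real.cos θ - Real.cos φ) / Real.sin φ| ≤
      40 * (Real.cos θ - Real.cos φ) ^ 2 / Real.sin φ ^ 3 := by
  set σ := Real.sin φ with hσ
  set δ := θ - φ with hδ
  have hσ1 : σ ≤ 1 := Real.sin_le_one φ
  have e : δ + (Real.cos θ - Real.cos φ) / σ =
      (δ - Real.sin δ) - Real.cos φ * (1 - Real.cos δ) / σ := by
    have : Real.cos θ = Real.cos φ * Real.cos δ - σ * Real.sin δ := by
      rw [hσ, ← Real.cos_add]; congr 1; rw [hδ]; ring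
    rw [this]
    field_simp
    ring
  have h1 := abs_sub_sin_le δ
  have h2 : |Real.cos φ * (1 - Real.cos δ) / σ| ≤ δ ^ 2 / 2 / σ := by
    rw [abs_div, abs_of_pos hs, abs_mul]
    gcongr
    have h3 := Real.abs_cos_le_one φ
    have h4 : |1 - Real.cos δ| ≤ δ ^ 2 / 2 := by
      rw [abs_of_nonneg (by linarith [Real.cos_le_one δ])]
      linarith [Real.one_sub_sq_div_two_le_cos (x := δ)]
    calc _ ≤ 1 * (δ ^ 2 / 2) := by gcongr
      _ = _ := one_mul _
  have h3 : |δ + (Real.cos θ - Real.cos φ) / σ| ≤ 5 / 2 * δ ^ 2 / σ := by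
    rw [e]
    refine (abs_sub _ _).trans ?_
    have : 2 * δ ^ 2 ≤ 2 * δ ^ 2 / σ := by
      rw [le_div_iff₀ hs]
      nlinarith [sq_nonneg δ]
    have e2 : 5 / 2 * δ ^ 2 / σ = 2 * δ ^ 2 / σ + δ ^ 2 / 2 / σ := by ring
    linarith
  refine h3.trans ?_
  have h4 := abs_angle_sub_le hθ hφ
  have h5 : (σ * |δ|) ^ 2 ≤ (4 * |Real.cos θ - Real.cos φ|) ^ 2 := by
    have := abs_nonneg δ
    gcongr
  rw [mul_pow, mul_pow, sq_abs, sq_abs] at h5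
  rw [div_le_div_iff₀ hs (by positivity)]
  nlinarith

/-- First-order expansion of `q ^ (-1/2)` at `1`. -/
theorem abs_inv_sqrt_sub_one_le {q η : ℝ} (hq : |q - 1| ≤ η) (hη : η ≤ 1 / 2) :
    |(Real.sqrt q)⁻¹ - 1| ≤ η ∧ |(Real.sqrt q)⁻¹ - 1 + (q - 1) / 2| ≤ η ^ 2 := by
  obtain ⟨h1, h2⟩ := abs_le.1 hq
  have hq0 : 0 ≤ q := by linarith
  set r := Real.sqrt q with hr
  have hrr : r ^ 2 = q := Real.sq_sqrt hq0
  have hr7 : 0.7 ≤ r := Real.le_sqrt_of_sq_le (by linarith)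
  have hr0 : 0 < r := by linarith
  have hr1 : |r - 1| * (r + 1) = |q - 1| := by
    rw [← hrr, show r ^ 2 - 1 = (r - 1) * (r + 1) by ring, abs_mul,
      abs_of_pos (by linarith : (0 : ℝ) < r + 1)]
  have hle : |r - 1| * 1.7 ≤ η := by
    have := mul_le_mul_of_nonneg_left (by linarith : (1.7 : ℝ) ≤ r + 1) (abs_nonneg (r - 1))
    linarith
  constructor
  · have e : r⁻¹ - 1 = -(r - 1) / r := by field_simp; ring
    rw [e, abs_div, abs_neg, abs_of_pos hr0, div_le_iff₀ hr0]
    nlinarith [abs_nonneg (r - 1)]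
  · have e : r⁻¹ - 1 + (q - 1) / 2 = |r - 1| ^ 2 * ((r + 2) / (2 * r)) := by
      rw [sq_abs, ← hrr]; field_simp; ring
    have h3 : (r + 2) / (2 * r) ≤ 2 := by
      rw [div_le_iff₀ (by positivity)]; linarith
    rw [e, abs_of_nonneg (by positivity)]
    nlinarith [abs_nonneg (r - 1), sq_nonneg |r - 1|]

/-- First-order expansion of the cosine `T = q X Y` of the angle between two hyperplanes, where
`q`, `X`, `Y` are perturbations of `t`, `1`, `1`. -/
theorem abs_cos_expansion_le {t q X Y hab haa hbb η ζ : ℝ} (ht : |t| ≤ 1) (hη : η ≤ 1 / 2)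
    (hq : |q - t| ≤ η) (hX : |X - 1| ≤ η) (hY : |Y - 1| ≤ η) (hq2 : |q - t + hab| ≤ ζ)
    (hX2 : |X - 1 - haa / 2| ≤ η ^ 2 + ζ / 2) (hY2 : |Y - 1 - hbb / 2| ≤ η ^ 2 + ζ / 2) :
    |q * X * Y - t| ≤ 6 * η ∧
      |q * X * Y - t + hab - t * (haa + hbb) / 2| ≤ 2 * ζ + 6 * η ^ 2 := by
  have hη0 : 0 ≤ η := (abs_nonneg _).trans hq
  set e := q - t
  set x := X - 1
  set y := Y - 1
  have hex : |e * x| ≤ η * η := by rw [abs_mul]; gcongr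
  have hey : |e * y| ≤ η * η := by rw [abs_mul]; gcongr
  have htxy : |t * (x * y)| ≤ 1 * (η * η) := by rw [abs_mul, abs_mul]; gcongr
  have hexy : |e * x * y| ≤ η * η * η := by rw [abs_mul]; gcongr
  have htx : |t * x| ≤ 1 * η := by rw [abs_mul]; gcongr
  have hty : |t * y| ≤ 1 * η := by rw [abs_mul]; gcongr
  have htx2 : |t * (x - haa / 2)| ≤ 1 * (η ^ 2 + ζ / 2) := by rw [abs_mul]; gcongr
  have hty2 : |t * (y - hbb / 2)| ≤ 1 * (η ^ 2 + ζ / 2) := by rw [abs_mul]; gcongr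
  have hη3 : η * η * η ≤ η * η / 2 := by nlinarith [mul_nonneg hη0 hη0]
  have hηη : η * η ≤ η / 2 := by nlinarith
  rw [abs_le] at *
  have e1 : q * X * Y - t = e + t * x + t * y + (e * x + e * y + t * (x * y) + e * x * y) := by
    simp only [e, x, y]; ring
  have e2 : q * X * Y - t + hab - t * (haa + hbb) / 2 = (e + hab) + t * (x - haa / 2) +
      t * (y - hbb / 2) + (e * x + e * y + t * (x * y) + e * x * y) := by
    simp only [e, x, y]; ring
  rw [e2, e1, abs_le]
  refine ⟨⟨?_, ?_⟩, ?_, ?_⟩ <;> nlinarith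

theorem metricInner_conormal_left (M : Matrix (Fin n) (Fin n) ℝ) (a b c : E n) :
    metricInner M (conormal a b) c = (Real.sqrt (1 - (inner ℝ a b : ℝ) ^ 2))⁻¹ *
      (metricInner M b c - inner ℝ a b * metricInner M a c) := by
  rw [conormal, metricInner_smul_left, metricInner_sub_left, metricInner_smul_left]

/-- The change of the angle at an edge is, up to a quadratic error, half the flux through the edge
of the tangential parts of `h(ν, ·)`, with `h = G - 1`.  The error involves `(sin φ)⁻³`, from the
second derivative of `arccos`, where `φ` is the Euclidean angle; this is the origin of `c⁻³`. -/
theorem exists_angleDefect_estimate (n : ℕ) : ∃ C δ : ℝ, 0 ≤ C ∧ 0 < δ ∧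
    ∀ (G : Matrix (Fin n) (Fin n) ℝ) (a b : E n) (W : Submodule ℝ (E n)) (c : ℝ), G.PosDef →
      ‖G - 1‖ ≤ δ → ‖a‖ = 1 → ‖b‖ = 1 → 0 < c → c ≤ Real.sin (normalAngle 1 a b) →
      |2 * (normalAngle G a b - normalAngle 1 a b) * volDensity G W -
        (metricInner (G - 1) (conormal a b) a + metricInner (G - 1) (conormal b a) b)| ≤
        C * c⁻¹ ^ 3 * ‖G - 1‖ ^ 2 ∧
      |(normalAngle G a b - normalAngle 1 a b) * volDensity G W| ≤ C * c⁻¹ ^ 3 * ‖G - 1‖ := by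
  obtain ⟨Cv, δv, hCv, hδv, hvol⟩ := exists_abs_volDensity_sub_one_le n
  set N : ℝ := (n : ℝ) ^ 2 with hN
  have hN0 : 0 ≤ N := by positivity
  refine ⟨96 * N * Cv + 11520 * N ^ 2 + 8 * N + 48 * N ^ 2 + 48 * N * (1 + Cv),
    min δv (1 / (4 * (N + 1))), by positivity, lt_min hδv (by positivity), ?_⟩
  intro G a b W c hG hGδ ha hb hc hcs
  set ε := ‖G - 1‖ with hε
  have hε0 : 0 ≤ ε := norm_nonneg _
  have hεN : ε * (4 * (N + 1)) ≤ 1 := (le_div_iff₀ (by positivity)).1 (hGδ.trans (min_le_right _ _))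
  have hε1 : ε ≤ 1 := by nlinarith
  have hε2 : ‖G - 1‖ ≤ 1 / 2 := by rw [← hε]; nlinarith
  have hu : IsUnit G.det := hG.det_pos.ne'.isUnit
  have hsym : (G - 1)ᵀ = G - 1 := by
    rw [Matrix.transpose_sub, Matrix.transpose_one, ← Matrix.conjTranspose_eq_transpose_of_trivial,
      hG.isHermitian]
  set t : ℝ := inner ℝ a b with ht
  have haa := inner_self_of_norm_one ha
  have hbb := inner_self_of_norm_one hb
  have ht1 : |t| ≤ 1 := by simpa [ha, hb] using abs_real_inner_le_norm a b
  obtain ⟨ht1a, ht1b⟩ := abs_le.1 ht1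
  set T := metricInner G (unitNormal G a) (unitNormal G b) with hT
  have hT1 : |T| ≤ 1 := abs_metricInner_unitNormal_le_one hG
    (by rintro rfl; simp at ha) (by rintro rfl; simp at hb)
  obtain ⟨hT1a, hT1b⟩ := abs_le.1 hT1
  set θ := normalAngle G a b with hθ
  set φ := normalAngle 1 a b with hφ
  have hφe : φ = Real.arccos t := normalAngle_one ha hb
  have hcosθ : Real.cos θ = T := Real.cos_arccos hT1a hT1b
  have hcosφ : Real.cos φ = t := by rw [hφe, Real.cos_arccos ht1a ht1b]
  have hθm : θ ∈ Icc 0 Real.pi := ⟨Real.arccos_nonneg _, Real.arccos_le_pi _⟩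
  have hφm : φ ∈ Icc 0 Real.pi := ⟨Real.arccos_nonneg _, Real.arccos_le_pi _⟩
  set σ := Real.sin φ with hσ
  have hσt : Real.sqrt (1 - t ^ 2) = σ := by rw [hσ, hφe, Real.sin_arccos]
  have hσ0 : 0 < σ := hc.trans_le hcs
  have hσ1 : σ ≤ 1 := Real.sin_le_one _
  -- expansion of the inverse metric: `G⁻¹ = 1 - h + O(ε²)` with `h = G - 1`
  have hJ1 := norm_inv_sub_one_le hε2
  have hJ2 := norm_inv_sub_one_add_le hε2
  rw [← hε] at hJ1 hJ2
  have hQ1 : ∀ {u v : E n}, ‖u‖ = 1 → ‖v‖ = 1 →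
      |metricInner G⁻¹ u v - inner ℝ u v| ≤ 2 * N * ε := by
    intro u v hu hv
    rw [← metricInner_one, ← metricInner_sub_matrix]
    refine (abs_metricInner_le _ hu hv).trans ?_
    calc N * ‖G⁻¹ - 1‖ ≤ N * (2 * ε) := by gcongr
      _ = _ := by ring
  have hQ2 : ∀ {u v : E n}, ‖u‖ = 1 → ‖v‖ = 1 →
      |metricInner G⁻¹ u v - inner ℝ u v + metricInner (G - 1) u v| ≤ 2 * N * ε ^ 2 := by
    intro u v hu hv
    rw [← metricInner_one, ← metricInner_sub_matrix, ← metricInner_add_matrix]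
    refine (abs_metricInner_le _ hu hv).trans ?_
    calc N * ‖G⁻¹ - 1 + (G - 1)‖ ≤ N * (2 * ε ^ 2) := by gcongr
      _ = _ := by ring
  have hη : 2 * N * ε ≤ 1 / 2 := by nlinarith
  have hX : ∀ {u : E n}, ‖u‖ = 1 → |(Real.sqrt (metricInner G⁻¹ u u))⁻¹ - 1| ≤ 2 * N * ε ∧
      |(Real.sqrt (metricInner G⁻¹ u u))⁻¹ - 1 - metricInner (G - 1) u u / 2| ≤
        (2 * N * ε) ^ 2 + 2 * N * ε ^ 2 / 2 := by
    intro u hu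
    have h1 := hQ1 hu hu
    have h2 := hQ2 hu hu
    rw [inner_self_of_norm_one hu] at h1 h2
    obtain ⟨h3, h4⟩ := abs_inv_sqrt_sub_one_le h1 hη
    refine ⟨h3, ?_⟩
    have e : (Real.sqrt (metricInner G⁻¹ u u))⁻¹ - 1 - metricInner (G - 1) u u / 2 =
        ((Real.sqrt (metricInner G⁻¹ u u))⁻¹ - 1 + (metricInner G⁻¹ u u - 1) / 2) -
        (metricInner G⁻¹ u u - 1 + metricInner (G - 1) u u) / 2 := by ring
    rw [e]
    refine (abs_sub _ _).trans (add_le_add h4 ?_)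
    rw [abs_div, abs_two]
    gcongr
  have hq1 := hQ1 hb ha
  have hq2 := hQ2 hb ha
  rw [real_inner_comm, ← ht] at hq1 hq2
  obtain ⟨hΔ1, hΔ2⟩ := abs_cos_expansion_le ht1 hη hq1 (hX ha).1 (hX hb).1 hq2 (hX ha).2 (hX hb).2
  rw [← metricInner_unitNormal_unitNormal hu, ← hT] at hΔ1 hΔ2
  -- the flux through the edge is the linear part of the change `T - t` of the cosine
  set κ := metricInner (G - 1) (conormal a b) a + metricInner (G - 1) (conormal b a) b with hκ
  have hκe : κ = (2 * metricInner (G - 1) b a -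
      t * (metricInner (G - 1) a a + metricInner (G - 1) b b)) / σ := by
    rw [hκ, metricInner_conormal_left, metricInner_conormal_left, real_inner_comm a b, ← ht, hσt,
      metricInner_comm hsym a b]
    ring
  have hκΔ : |κ + 2 * (T - t) / σ| ≤ (8 * N + 48 * N ^ 2) * ε ^ 2 / σ := by
    have e : κ + 2 * (T - t) / σ = 2 * (T - t + metricInner (G - 1) b a -
        t * (metricInner (G - 1) a a + metricInner (G - 1) b b) / 2) / σ := by
      rw [hκe]; ring
    rw [e, abs_div, abs_mul, abs_two, abs_of_pos hσ0]
    refine div_le_div_of_nonneg_right ?_ hσ0.le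
    linarith
  have hδ1 : |θ - φ| ≤ 48 * N * ε / σ := by
    rw [le_div_iff₀ hσ0]
    have := abs_angle_sub_le hθm hφm
    rw [hcosθ, hcosφ] at this
    linarith
  have hδ2 := abs_angle_sub_add_le hθm hφm hσ0
  rw [hcosθ, hcosφ] at hδ2
  have hΔsq : (T - t) ^ 2 ≤ 144 * N ^ 2 * ε ^ 2 := by
    rw [← sq_abs]
    calc _ ≤ (6 * (2 * N * ε)) ^ 2 := by gcongr
      _ = _ := by ring
  have hδ3 : |θ - φ + (T - t) / σ| ≤ 5760 * N ^ 2 * ε ^ 2 / σ ^ 3 := by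
    refine hδ2.trans (div_le_div_of_nonneg_right ?_ (by positivity))
    linarith
  have hv := hvol G W (hGδ.trans (min_le_left _ _))
  rw [← hε] at hv
  have hσc : 1 / σ ^ 3 ≤ c⁻¹ ^ 3 := by
    rw [inv_pow, ← one_div]
    gcongr
  have hσc1 : 1 / σ ≤ c⁻¹ ^ 3 := by
    refine le_trans ?_ hσc
    exact one_div_le_one_div_of_le (by positivity) (pow_le_of_le_one hσ0.le hσ1 (by norm_num))
  constructor
  · have e : 2 * (θ - φ) * volDensity G W - κ = 2 * ((θ - φ) * (volDensity G W - 1)) +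
        2 * (θ - φ + (T - t) / σ) - (κ + 2 * (T - t) / σ) := by ring
    rw [e]
    have h1 : |(θ - φ) * (volDensity G W - 1)| ≤ 48 * N * ε / σ * (Cv * ε) := by
      rw [abs_mul]; gcongr
    calc _ ≤ 2 * |(θ - φ) * (volDensity G W - 1)| + 2 * |θ - φ + (T - t) / σ| +
          |κ + 2 * (T - t) / σ| := by
          refine (abs_sub _ _).trans (add_le_add_left ((abs_add_le _ _).trans ?_) _)
          rw [abs_mul 2 ((θ - φ) * _), abs_mul 2 (θ - φ + _), abs_two]
      _ ≤ 2 * (48 * N * ε / σ * (Cv * ε)) + 2 * (5760 * N ^ 2 * ε ^ 2 / σ ^ 3) +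
          (8 * N + 48 * N ^ 2) * ε ^ 2 / σ := by gcongr
      _ = (96 * N * Cv * (1 / σ) + 11520 * N ^ 2 * (1 / σ ^ 3) +
          (8 * N + 48 * N ^ 2) * (1 / σ)) * ε ^ 2 := by ring
      _ ≤ (96 * N * Cv * c⁻¹ ^ 3 + 11520 * N ^ 2 * c⁻¹ ^ 3 +
          (8 * N + 48 * N ^ 2) * c⁻¹ ^ 3) * ε ^ 2 := by gcongr
      _ ≤ (96 * N * Cv * c⁻¹ ^ 3 + 11520 * N ^ 2 * c⁻¹ ^ 3 +
          (8 * N + 48 * N ^ 2) * c⁻¹ ^ 3 + 48 * N * (1 + Cv) * c⁻¹ ^ 3) * ε ^ 2 := by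
          exact mul_le_mul_of_nonneg_right (le_add_of_nonneg_right (by positivity)) (by positivity)
      _ = _ := by ring
  · have hvb : |volDensity G W| ≤ 1 + Cv := by
      have : volDensity G W = 1 + (volDensity G W - 1) := by ring
      rw [this]
      refine (abs_add_le _ _).trans ?_
      rw [abs_one]
      have : Cv * ε ≤ Cv := mul_le_of_le_one_right hCv hε1
      linarith
    rw [abs_mul]
    calc _ ≤ 48 * N * ε / σ * (1 + Cv) := by gcongr
      _ = 48 * N * (1 + Cv) * (1 / σ) * ε := by ring
      _ ≤ 48 * N * (1 + Cv) * c⁻¹ ^ 3 * ε := by gcongr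
      _ ≤ (96 * N * Cv + 11520 * N ^ 2 + 8 * N + 48 * N ^ 2 + 48 * N * (1 + Cv)) *
          c⁻¹ ^ 3 * ε := by
          exact mul_le_mul_of_nonneg_right (mul_le_mul_of_nonneg_right
            (le_add_of_nonneg_left (by positivity)) (by positivity)) hε0

/-! ### The mean curvature of hyperplanes -/

/-- The Christoffel symbols of the first kind `S / 2`, contracted with vectors `u`, `v` and, after
raising the index with `M`, with `a`. -/
noncomputable def contraction (S : Fin n → Fin n → Fin n → ℝ) (M : Matrix (Fin n) (Fin n) ℝ)
    (a u v : E n) : ℝ :=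
  ∑ k, (∑ i, ∑ j, (∑ l, (1 / 2 : ℝ) * M k l * S l i j) * u i * v j) * a k

theorem contraction_sub (S : Fin n → Fin n → Fin n → ℝ) (M N : Matrix (Fin n) (Fin n) ℝ)
    (a u v : E n) :
    contraction S (M - N) a u v = contraction S M a u v - contraction S N a u v := by
  simp only [contraction, ← Finset.sum_sub_distrib, ← sub_mul, Matrix.sub_apply, mul_sub]

theorem abs_contraction_le {S : Fin n → Fin n → Fin n → ℝ} {M : Matrix (Fin n) (Fin n) ℝ}
    {a u v : E n} {m r : ℝ} (ha : ‖a‖ = 1) (hu : ‖u‖ = 1) (hv : ‖v‖ = 1) (hm : 0 ≤ m) (hr : 0 ≤ r)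
    (hM : ∀ i j, |M i j| ≤ m) (hS : ∀ l i j, |S l i j| ≤ 2 * r) :
    |contraction S M a u v| ≤ (n : ℝ) ^ 4 * (m * r) := by
  have sum_le : ∀ {f : Fin n → ℝ} {K : ℝ}, (∀ i, |f i| ≤ K) → |∑ i, f i| ≤ n * K := by
    intro f K h
    refine (Finset.abs_sum_le_sum_abs _ _).trans ((Finset.sum_le_sum fun i _ => h i).trans ?_)
    simp
  have ha' := fun k => ha ▸ abs_coord_le a k
  have hu' := fun k => hu ▸ abs_coord_le u k
  have hv' := fun k => hv ▸ abs_coord_le v k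
  have key : |contraction S M a u v| ≤ n * (n * (n * (n * (1 / 2 * m * (2 * r)) * 1 * 1)) * 1) := by
    refine sum_le fun k => ?_
    rw [abs_mul]
    refine mul_le_mul (sum_le fun i => sum_le fun j => ?_) (ha' k) (abs_nonneg _) (by positivity)
    rw [abs_mul, abs_mul]
    refine mul_le_mul (mul_le_mul (sum_le fun l => ?_) (hu' i) (abs_nonneg _) (by positivity))
      (hv' j) (abs_nonneg _) (by positivity)
    rw [abs_mul, abs_mul, abs_of_pos (by norm_num : (0 : ℝ) < 1 / 2)]
    have := hM k l
    have := hS l i j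
    gcongr
  calc _ ≤ _ := key
    _ = _ := by ring

/-- Twice the Christoffel symbols of the first kind. -/
noncomputable def christoffelFirst (g : E n → Matrix (Fin n) (Fin n) ℝ) (x : E n)
    (l i j : Fin n) : ℝ :=
  pd i (fun y => g y l j) x + pd j (fun y => g y i l) x - pd l (fun y => g y i j) x

theorem secondFundamentalForm_eq {g : E n → Matrix (Fin n) (Fin n) ℝ} {x : E n}
    (hG : IsUnit (g x).det) (a u v : E n) :
    secondFundamentalForm g a x u v = -((Real.sqrt (metricInner (g x)⁻¹ a a))⁻¹ *
      contraction (christoffelFirst g x) (g x)⁻¹ a u v) := by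
  rw [secondFundamentalForm, metricInner_unitNormal hG, real_inner_comm, PiLp.inner_apply]
  simp [christoffel, contraction, christoffelFirst]

/-- The sum over an orthonormal basis of the orthogonal complement of a unit vector `a` of the
products of coordinates is the matrix `1 - a aᵀ` of the orthogonal projection. -/
theorem sum_stdOrthonormalBasis_orthogonal {a : E n} (ha : ‖a‖ = 1) (i j : Fin n) :
    ∑ α, (stdOrthonormalBasis ℝ (ℝ ∙ a)ᗮ α : E n) i * (stdOrthonormalBasis ℝ (ℝ ∙ a)ᗮ α : E n) j =
      (1 : Matrix (Fin n) (Fin n) ℝ) i j - a i * a j := by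
  set K := (ℝ ∙ a)ᗮ with hK
  set e := stdOrthonormalBasis ℝ K with he
  set p : Fin n → K := fun i => K.orthogonalProjectionOnto (EuclideanSpace.single i 1) with hp
  have h1 : ∀ α i, (e α : E n) i = inner ℝ (p i) (e α) := by
    intro α i
    rw [hp, Submodule.inner_orthogonalProjectionOnto_eq_of_mem_right]
    simp [EuclideanSpace.inner_single_left]
  have h2 := e.sum_inner_mul_inner (p i) (p j)
  simp_rw [h1]
  rw [show ∑ α, inner ℝ (p i) (e α) * inner ℝ (p j) (e α) = inner ℝ (p i) (p j) from by
    rw [← h2]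
    exact Finset.sum_congr rfl fun α _ => by rw [real_inner_comm (e α) (p j)]]
  have h3 : ((p j : K) : E n) = EuclideanSpace.single j 1 - a j • a := by
    have := Submodule.starProjection_orthogonal_val (K := ℝ ∙ a) (EuclideanSpace.single j (1 : ℝ))
    have h4 := Submodule.starProjection_unit_singleton ℝ ha (EuclideanSpace.single j (1 : ℝ))
    rw [h4] at this
    rw [hp]
    refine Eq.trans this ?_
    simp [EuclideanSpace.inner_single_right]
  rw [hp, Submodule.inner_orthogonalProjectionOnto_eq_of_mem_right]
  change inner ℝ (EuclideanSpace.single i 1) ((p j : K) : E n) = _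
  rw [h3, EuclideanSpace.inner_single_left]
  simp [Matrix.one_apply, mul_comm]

end AngleDefect

/-! ### Linearization of the mean curvature -/

section MeanCurvature

open scoped Matrix.Norms.Operator

variable {n : ℕ}

theorem abs_sum_le_of_abs_le {ι : Type*} [Fintype ι] {f : ι → ℝ} {K N : ℝ} (hN : Fintype.card ι ≤ N)
    (hK : 0 ≤ K) (h : ∀ i, |f i| ≤ K) : |∑ i, f i| ≤ N * K := by
  refine (Finset.abs_sum_le_sum_abs _ _).trans ((Finset.sum_le_sum fun i _ => h i).trans ?_)
  rw [Finset.sum_const, nsmul_eq_mul, Finset.card_univ]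
  gcongr

/-- The trace over a hyperplane of the linearized second fundamental form. -/
theorem sum_contraction_one {a : E n} (ha : ‖a‖ = 1) (S : Fin n → Fin n → Fin n → ℝ) :
    ∑ α, contraction S 1 a (stdOrthonormalBasis ℝ (ℝ ∙ a)ᗮ α : E n)
      (stdOrthonormalBasis ℝ (ℝ ∙ a)ᗮ α : E n) =
      ∑ k, ∑ i, ∑ j, 1 / 2 * S k i j * ((1 : Matrix (Fin n) (Fin n) ℝ) i j - a i * a j) * a k := by
  have h1 : ∀ k i j, ∑ l, (1 / 2 : ℝ) * (1 : Matrix (Fin n) (Fin n) ℝ) k l * S l i j =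
      1 / 2 * S k i j := by
    intro k i j
    simp [Matrix.one_apply]
  simp only [contraction, h1]
  rw [Finset.sum_comm]
  refine Finset.sum_congr rfl fun k _ => ?_
  rw [← Finset.sum_mul, Finset.sum_comm, Finset.sum_mul]
  refine Finset.sum_congr rfl fun i _ => ?_
  rw [Finset.sum_comm, Finset.sum_mul]
  refine Finset.sum_congr rfl fun j _ => ?_
  rw [← sum_stdOrthonormalBasis_orthogonal ha i j, Finset.mul_sum]
  congr 1
  exact Finset.sum_congr rfl fun α _ => by ring

/-- To first order, the flux density, twice the mean curvature and the tangential divergence of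
the tangential part of `h(ν, ·)` cancel.  Here `D k i j` stands for `∂ₖ gᵢⱼ`. -/
theorem linearized_identity {a : E n} (ha : ‖a‖ = 1) {D S : Fin n → Fin n → Fin n → ℝ}
    (hD : ∀ k i j, D k i j = D k j i) (hS : ∀ l i j, S l i j = D i l j + D j i l - D l i j) :
    ∑ i, ∑ j, (D i i j - D j i i) * a j -
      2 * ∑ α, contraction S 1 a (stdOrthonormalBasis ℝ (ℝ ∙ a)ᗮ α : E n)
        (stdOrthonormalBasis ℝ (ℝ ∙ a)ᗮ α : E n) +
      ∑ i, ∑ j, a j * (D i i j - a i * ∑ k, a k * D k i j) = 0 := by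
  rw [sum_contraction_one ha]
  set X := ∑ i, ∑ j, D i i j * a j with hX
  set Y := ∑ i, ∑ j, D j i i * a j with hY
  set Z := ∑ i, ∑ j, ∑ k, a i * a j * a k * D k i j with hZ
  have e1 : ∑ i, ∑ j, (D i i j - D j i i) * a j = X - Y := by
    simp only [hX, hY, sub_mul, Finset.sum_sub_distrib]
  have e3 : ∑ i, ∑ j, a j * (D i i j - a i * ∑ k, a k * D k i j) = X - Z := by
    simp only [hX, hZ, mul_sub, Finset.sum_sub_distrib, Finset.mul_sum]
    congr 1
    · exact Finset.sum_congr rfl fun i _ => Finset.sum_congr rfl fun j _ => mul_comm _ _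
    · exact Finset.sum_congr rfl fun i _ => Finset.sum_congr rfl fun j _ =>
        Finset.sum_congr rfl fun k _ => by ring
  -- in terms of these sums, the trace is `X - Y / 2 - Z / 2`
  have e2 : ∑ k, ∑ i, ∑ j,
      1 / 2 * S k i j * ((1 : Matrix (Fin n) (Fin n) ℝ) i j - a i * a j) * a k =
      X - Y / 2 - Z / 2 := by
    have h1 : ∀ k, ∑ i, ∑ j, 1 / 2 * S k i j *
        ((1 : Matrix (Fin n) (Fin n) ℝ) i j - a i * a j) * a k =
        ∑ i, D i i k * a k - (∑ i, D k i i * a k) / 2 -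
          (∑ i, ∑ j, a i * a j * a k * S k i j) / 2 := by
      intro k
      rw [Finset.sum_div, Finset.sum_div, ← Finset.sum_sub_distrib, ← Finset.sum_sub_distrib]
      refine Finset.sum_congr rfl fun i _ => ?_
      have h2 : ∑ j, 1 / 2 * S k i j * ((1 : Matrix (Fin n) (Fin n) ℝ) i j - a i * a j) * a k =
          ∑ j, (1 : Matrix (Fin n) (Fin n) ℝ) i j * (1 / 2 * S k i j * a k) -
          (∑ j, a i * a j * a k * S k i j) / 2 := by
        rw [Finset.sum_div, ← Finset.sum_sub_distrib]
        exact Finset.sum_congr rfl fun j _ => by ring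
      rw [h2]
      simp only [Matrix.one_apply, ite_mul, one_mul, zero_mul, Finset.sum_ite_eq, Finset.mem_univ,
        if_true]
      rw [hS, hD i k i]
      ring
    simp only [h1, Finset.sum_sub_distrib, ← Finset.sum_div]
    have hX' : ∑ k, ∑ i, D i i k * a k = X := Finset.sum_comm
    have hY' : ∑ k, ∑ i, D k i i * a k = Y := Finset.sum_comm
    have hZ1 : ∑ k, ∑ i, ∑ j, a i * a j * a k * D k i j = Z := by
      rw [hZ, Finset.sum_comm]
      exact Finset.sum_congr rfl fun i _ => Finset.sum_comm
    have hZ2 : ∑ k, ∑ i, ∑ j, a i * a j * a k * D i k j = Z := by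
      rw [← hZ1, Finset.sum_comm]
      exact Finset.sum_congr rfl fun i _ => Finset.sum_congr rfl fun j _ =>
        Finset.sum_congr rfl fun k _ => by ring
    have hZ3 : ∑ k, ∑ i, ∑ j, a i * a j * a k * D j i k = Z := by
      rw [← hZ2]
      refine Finset.sum_congr rfl fun k _ => ?_
      rw [Finset.sum_comm]
      exact Finset.sum_congr rfl fun i _ => Finset.sum_congr rfl fun j _ => by
        rw [hD i j k]; ring
    have hZS : ∑ k, ∑ i, ∑ j, a i * a j * a k * S k i j = Z := by
      simp only [hS, mul_add, mul_sub, Finset.sum_add_distrib, Finset.sum_sub_distrib]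
      rw [hZ1, hZ2, hZ3]
      ring
    rw [hX', hY', hZS]
  rw [e1, e2, e3]
  ring

/-- The mean curvature of a hyperplane agrees to first order with the trace of its linearized
second fundamental form. -/
theorem exists_meanCurvature_estimate (n : ℕ) : ∃ K K₀ δ : ℝ, 0 ≤ K ∧ 0 ≤ K₀ ∧ 0 < δ ∧
    ∀ (g : E n → Matrix (Fin n) (Fin n) ℝ) (x a : E n) (ε' : ℝ),
      (g x).PosDef → ‖g x - 1‖ ≤ δ → ‖a‖ = 1 → 0 ≤ ε' →
      (∀ k i j, |pd k (fun y => g y i j) x| ≤ ε') →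
      |meanCurvature g a x + ∑ α, contraction (christoffelFirst g x) 1 a
        (stdOrthonormalBasis ℝ (ℝ ∙ a)ᗮ α : E n) (stdOrthonormalBasis ℝ (ℝ ∙ a)ᗮ α : E n)| ≤
        K * (‖g x - 1‖ * ε') ∧
      |∑ α, contraction (christoffelFirst g x) 1 a
        (stdOrthonormalBasis ℝ (ℝ ∙ a)ᗮ α : E n) (stdOrthonormalBasis ℝ (ℝ ∙ a)ᗮ α : E n)| ≤
        K₀ * ε' := by
  set N : ℝ := (n : ℝ) with hN
  have hN0 : 0 ≤ N := by positivity
  set B := N ^ 4 with hB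
  have hB0 : 0 ≤ B := by positivity
  -- bounds of the change of the mean curvature and of the linearized mean curvature
  set K := N * (N * (2 * N ^ 3 * (9 / 2 * B))) + N * ((6 * N ^ 2 + 3) * B) with hK
  set K₀ := N * (3 / 2 * B) with hK₀
  have hK0 : 0 ≤ K := by positivity
  have hK₀0 : 0 ≤ K₀ := by positivity
  refine ⟨K, K₀, 1 / (4 * (N ^ 3 + N ^ 2 + 1)), hK0, hK₀0, by positivity, ?_⟩
  intro g x a ε' hG hGδ ha hε' hpd
  set ε := ‖g x - 1‖ with hε
  have hε0 : 0 ≤ ε := norm_nonneg _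
  have hεN : ε * (4 * (N ^ 3 + N ^ 2 + 1)) ≤ 1 :=
    (le_div_iff₀ (by positivity)).1 hGδ
  have hεN3 : 0 ≤ ε * N ^ 3 := by positivity
  have hεN2 : 0 ≤ ε * N ^ 2 := by positivity
  have hε4 : ε ≤ 1 / 4 := by linarith
  have hu : IsUnit (g x).det := hG.det_pos.ne'.isUnit
  have hJ := norm_inv_sub_one_le (show ‖g x - 1‖ ≤ 1 / 2 by rw [← hε]; linarith)
  rw [← hε] at hJ
  set S := christoffelFirst g x with hSdef
  have hS : ∀ l i j, |S l i j| ≤ 2 * (3 / 2 * ε') := by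
    intro l i j
    have h1 := abs_le.1 (hpd i l j)
    have h2 := abs_le.1 (hpd j i l)
    have h3 := abs_le.1 (hpd l i j)
    rw [hSdef, christoffelFirst, abs_le]
    constructor <;> linarith
  have hr : 0 ≤ 3 / 2 * ε' := by positivity
  have hJe : ∀ i j, |((g x)⁻¹ - 1) i j| ≤ 2 * ε := fun i j => (abs_entry_le_norm _ i j).trans hJ
  have hone : ∀ i j, |(1 : Matrix (Fin n) (Fin n) ℝ) i j| ≤ 1 := by
    intro i j
    rw [Matrix.one_apply]
    split_ifs <;> simp
  have hIe : ∀ i j, |(g x)⁻¹ i j| ≤ 2 := by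
    intro i j
    have e : (g x)⁻¹ i j = ((g x)⁻¹ - 1) i j + (1 : Matrix (Fin n) (Fin n) ℝ) i j := by simp
    rw [e]
    refine (abs_add_le _ _).trans ?_
    linarith [hJe i j, hone i j]
  have hq : |metricInner (g x)⁻¹ a a - 1| ≤ 2 * N ^ 2 * ε := by
    rw [← inner_self_of_norm_one ha, ← metricInner_one, ← metricInner_sub_matrix]
    refine (abs_metricInner_le _ ha ha).trans ?_
    calc N ^ 2 * ‖(g x)⁻¹ - 1‖ ≤ N ^ 2 * (2 * ε) := by gcongr
      _ = _ := by ring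
  have hη : 2 * N ^ 2 * ε ≤ 1 / 2 := by linarith
  obtain ⟨hs, -⟩ := abs_inv_sqrt_sub_one_le hq hη
  set s := (Real.sqrt (metricInner (g x)⁻¹ a a))⁻¹ with hsdef
  have hs1 : |s| ≤ 3 / 2 := by
    have := abs_le.1 hs
    rw [abs_le]
    constructor <;> linarith
  set A := secondFundamentalForm g a x with hA
  have hAe : ∀ u v, A u v = -(s * contraction S (g x)⁻¹ a u v) := fun u v =>
    secondFundamentalForm_eq hu a u v
  have hc1 : ∀ {u v : E n}, ‖u‖ = 1 → ‖v‖ = 1 → |contraction S (g x)⁻¹ a u v| ≤ 3 * B * ε' := by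
    intro u v hu hv
    refine (abs_contraction_le ha hu hv zero_le_two hr hIe hS).trans_eq ?_
    ring
  have hc2 : ∀ {u v : E n}, ‖u‖ = 1 → ‖v‖ = 1 →
      |contraction S ((g x)⁻¹ - 1) a u v| ≤ 3 * B * (ε * ε') := by
    intro u v hu hv
    refine (abs_contraction_le ha hu hv (by positivity) hr hJe hS).trans_eq ?_
    ring
  have hc3 : ∀ {u v : E n}, ‖u‖ = 1 → ‖v‖ = 1 → |contraction S 1 a u v| ≤ 3 / 2 * B * ε' := by
    intro u v hu hv
    refine (abs_contraction_le ha hu hv zero_le_one hr hone hS).trans_eq ?_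
    ring
  have hAb : ∀ {u v : E n}, ‖u‖ = 1 → ‖v‖ = 1 → |A u v| ≤ 9 / 2 * B * ε' := by
    intro u v hu hv
    rw [hAe, abs_neg, abs_mul]
    calc _ ≤ 3 / 2 * (3 * B * ε') := by
          have := hc1 hu hv
          gcongr
      _ = _ := by ring
  have hAd : ∀ {u v : E n}, ‖u‖ = 1 → ‖v‖ = 1 →
      |A u v + contraction S 1 a u v| ≤ (6 * N ^ 2 + 3) * B * (ε * ε') := by
    intro u v hu hv
    have e : A u v + contraction S 1 a u v =
        -((s - 1) * contraction S (g x)⁻¹ a u v + contraction S ((g x)⁻¹ - 1) a u v) := by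
      rw [hAe, contraction_sub]; ring
    rw [e, abs_neg]
    refine (abs_add_le _ _).trans ?_
    rw [abs_mul]
    calc _ ≤ 2 * N ^ 2 * ε * (3 * B * ε') + 3 * B * (ε * ε') := by
          have := hc1 hu hv
          have := hc2 hu hv
          gcongr
      _ = _ := by ring
  set K' := (ℝ ∙ a)ᗮ with hK'
  set b := stdOrthonormalBasis ℝ K' with hb
  set Γ := inducedMetric (g x) K' with hΓ
  have hbn : ∀ α, ‖(b α : E n)‖ = 1 := norm_stdOrthonormalBasis K'
  have hcard : (Fintype.card (Fin (Module.finrank ℝ K')) : ℝ) ≤ N := by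
    rw [Fintype.card_fin]
    exact Nat.cast_le.2 (finrank_le_dim K')
  have hΓ1 : ‖Γ - 1‖ ≤ N ^ 3 * ε := norm_inducedMetric_sub_one_le (g x) K'
  have hΓ2 := norm_inv_sub_one_le (hΓ1.trans (by linarith))
  have hΓe : ∀ α β, |(Γ⁻¹ - 1) α β| ≤ 2 * N ^ 3 * ε := fun α β =>
    (abs_entry_le_norm _ α β).trans (hΓ2.trans (by linarith))
  set H := meanCurvature g a x with hH
  set H₀ := ∑ α, contraction S 1 a (b α : E n) (b α : E n) with hH₀
  have hHd : |H + H₀| ≤ K * (ε * ε') := by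
    have e : H + H₀ = ∑ α, ∑ β, (Γ⁻¹ - 1) α β * A (b α) (b β) +
        ∑ α, (A (b α) (b α) + contraction S 1 a (b α : E n) (b α : E n)) := by
      have h1 : ∑ α, ∑ β, (Γ⁻¹ - 1) α β * A (b α) (b β) = H - ∑ α, A (b α) (b α) := by
        have hH' : H = ∑ α, ∑ β, Γ⁻¹ α β * A (b α) (b β) := rfl
        rw [hH']
        simp only [Matrix.sub_apply, sub_mul, Finset.sum_sub_distrib]
        simp [Matrix.one_apply]
      rw [h1, hH₀, Finset.sum_add_distrib]
      ring
    rw [e]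
    refine (abs_add_le _ _).trans ?_
    have h1 : |∑ α, ∑ β, (Γ⁻¹ - 1) α β * A (b α) (b β)| ≤
        N * (N * (2 * N ^ 3 * ε * (9 / 2 * B * ε'))) := by
      refine abs_sum_le_of_abs_le hcard (by positivity) fun α =>
        abs_sum_le_of_abs_le hcard (by positivity) fun β => ?_
      rw [abs_mul]
      have := hΓe α β
      have := hAb (hbn α) (hbn β)
      gcongr
    have h2 : |∑ α, (A (b α) (b α) + contraction S 1 a (b α : E n) (b α : E n))| ≤
        N * ((6 * N ^ 2 + 3) * B * (ε * ε')) :=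
      abs_sum_le_of_abs_le hcard (by positivity) fun α => hAd (hbn α) (hbn α)
    calc _ ≤ _ := add_le_add h1 h2
      _ = _ := by rw [hK]; ring
  have hH₀b : |H₀| ≤ K₀ * ε' := by
    rw [hH₀]
    refine (abs_sum_le_of_abs_le hcard (by positivity) fun α => hc3 (hbn α) (hbn α)).trans_eq ?_
    rw [hK₀]; ring
  exact ⟨hHd, hH₀b⟩

/-- On a hyperplane, the flux density plus twice the mean curvature is, up to a quadratic error,
minus the tangential divergence of the tangential part of `h(ν, ·)`. -/
theorem exists_curvature_estimate (n : ℕ) : ∃ C δ : ℝ, 0 ≤ C ∧ 0 < δ ∧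
    ∀ (g : E n → Matrix (Fin n) (Fin n) ℝ) (x a : E n) (W : Submodule ℝ (E n)) (ε' : ℝ),
      (g x).PosDef → ‖g x - 1‖ ≤ δ → ‖a‖ = 1 → 0 ≤ ε' →
      (∀ k i j, pd k (fun y => g y i j) x = pd k (fun y => g y j i) x) →
      (∀ k i j, |pd k (fun y => g y i j) x| ≤ ε') →
      |∑ i, ∑ j, (pd i (fun y => g y i j) x - pd j (fun y => g y i i) x) * a j +
        2 * (meanCurvature g a x * volDensity (g x) W) +
        ∑ i, ∑ j, a j * (pd i (fun y => g y i j) x -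
          a i * ∑ k, a k * pd k (fun y => g y i j) x)| ≤ C * (‖g x - 1‖ * ε') ∧
      |meanCurvature g a x * volDensity (g x) W| ≤ C * ε' := by
  obtain ⟨Cv, δv, hCv, hδv, hvol⟩ := exists_abs_volDensity_sub_one_le n
  obtain ⟨K, K₀, δ, hK0, hK₀0, hδ, hH⟩ := exists_meanCurvature_estimate n
  refine ⟨2 * (K * (1 + Cv) + K₀ * Cv) + (K + K₀) * (1 + Cv), min δv (min δ 1), by positivity,
    lt_min hδv (lt_min hδ one_pos), ?_⟩
  intro g x a W ε' hG hGδ ha hε' hsym hpd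
  obtain ⟨hHd, hH₀b⟩ := hH g x a ε' hG (hGδ.trans ((min_le_right _ _).trans (min_le_left _ _)))
    ha hε' hpd
  have hid := linearized_identity ha (D := fun k i j => pd k (fun y => g y i j) x)
    (S := christoffelFirst g x) hsym (fun l i j => rfl)
  have hv := hvol (g x) W (hGδ.trans (min_le_left _ _))
  have hε0 : 0 ≤ ‖g x - 1‖ := norm_nonneg _
  have hε1 : ‖g x - 1‖ ≤ 1 := hGδ.trans ((min_le_right _ _).trans (min_le_right _ _))
  generalize ‖g x - 1‖ = ε at *
  generalize volDensity (g x) W = V at *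
  generalize meanCurvature g a x = H at *
  generalize ∑ α, contraction (christoffelFirst g x) 1 a
        (stdOrthonormalBasis ℝ (ℝ ∙ a)ᗮ α : E n) (stdOrthonormalBasis ℝ (ℝ ∙ a)ᗮ α : E n) = H₀ at *
  have hεC : Cv * ε ≤ Cv := mul_le_of_le_one_right hCv hε1
  have hVb : |V| ≤ 1 + Cv := by
    have := abs_le.1 hv
    rw [abs_le]
    constructor <;> linarith
  constructor
  · have e : ∑ i, ∑ j, (pd i (fun y => g y i j) x - pd j (fun y => g y i i) x) * a j +
        2 * (H * V) + ∑ i, ∑ j, a j * (pd i (fun y => g y i j) x -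
          a i * ∑ k, a k * pd k (fun y => g y i j) x) =
        2 * ((H + H₀) * V + -H₀ * (V - 1)) := by
      linear_combination hid
    rw [e, abs_mul, abs_two]
    calc _ ≤ 2 * (K * (ε * ε') * (1 + Cv) + K₀ * ε' * (Cv * ε)) := by
          have : |(H + H₀) * V| ≤ K * (ε * ε') * (1 + Cv) := by
            rw [abs_mul]; gcongr
          have : |-H₀ * (V - 1)| ≤ K₀ * ε' * (Cv * ε) := by
            rw [abs_mul, abs_neg]; gcongr
          have := abs_add_le ((H + H₀) * V) (-H₀ * (V - 1))
          linarith
      _ = 2 * (K * (1 + Cv) + K₀ * Cv) * (ε * ε') := by ring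
      _ ≤ _ := mul_le_mul_of_nonneg_right (le_add_of_nonneg_right (by positivity)) (by positivity)
  · have hHb : |H| ≤ (K + K₀) * ε' := by
      have h1 : K * (ε * ε') ≤ K * ε' := by
        have : ε * ε' ≤ ε' := mul_le_of_le_one_left hε' hε1
        gcongr
      have h2 := abs_le.1 hHd
      have h3 := abs_le.1 hH₀b
      rw [abs_le]
      constructor <;> linarith
    rw [abs_mul]
    calc _ ≤ (K + K₀) * ε' * (1 + Cv) := by gcongr
      _ = (K + K₀) * (1 + Cv) * ε' := by ring
      _ ≤ _ := mul_le_mul_of_nonneg_right (le_add_of_nonneg_left (by positivity)) hε'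

end MeanCurvature

/-! ### Continuity of the densities -/

section Continuity

variable {n : ℕ}

theorem continuousOn_matrix_inv {m : Type*} [Fintype m] [DecidableEq m] :
    ContinuousOn (fun M : Matrix m m ℝ => M⁻¹) {M | IsUnit M.det} := by
  intro M hM
  refine (continuousAt_matrix_inv M ?_).continuousWithinAt
  rw [Ring.inverse_eq_inv']
  exact continuousAt_inv₀ hM.ne_zero

theorem continuous_metricInner (u v : E n) :
    Continuous fun M : Matrix (Fin n) (Fin n) ℝ => metricInner M u v := by
  unfold metricInner
  fun_prop

theorem continuous_inducedMetric (W : Submodule ℝ (E n)) :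
    Continuous fun M : Matrix (Fin n) (Fin n) ℝ => inducedMetric M W :=
  continuous_matrix fun _ _ => continuous_metricInner _ _

theorem continuous_volDensity (W : Submodule ℝ (E n)) :
    Continuous fun M : Matrix (Fin n) (Fin n) ℝ => volDensity M W :=
  Real.continuous_sqrt.comp (continuous_inducedMetric W).matrix_det

theorem continuousOn_inv_sqrt_metricInner_inv {a : E n} (ha : a ≠ 0) :
    ContinuousOn (fun G : Matrix (Fin n) (Fin n) ℝ => (Real.sqrt (metricInner G⁻¹ a a))⁻¹)
      {G | G.PosDef} := by
  refine ContinuousOn.inv₀ (Real.continuous_sqrt.comp_continuousOn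
    ((continuous_metricInner a a).comp_continuousOn
      (continuousOn_matrix_inv.mono fun G hG => ?_))) fun G hG => ?_
  · exact (Matrix.PosDef.det_pos hG).ne'.isUnit
  · exact (Real.sqrt_pos.2 (metricInner_self_pos (Matrix.PosDef.inv hG) ha)).ne'

theorem continuousOn_normalAngle {a b : E n} (ha : a ≠ 0) (hb : b ≠ 0) :
    ContinuousOn (fun G : Matrix (Fin n) (Fin n) ℝ => normalAngle G a b) {G | G.PosDef} := by
  have hu : ∀ G ∈ {G : Matrix (Fin n) (Fin n) ℝ | G.PosDef}, IsUnit G.det := fun G hG =>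
    (Matrix.PosDef.det_pos hG).ne'.isUnit
  have h : ContinuousOn (fun G : Matrix (Fin n) (Fin n) ℝ => Real.arccos (metricInner G⁻¹ b a *
      (Real.sqrt (metricInner G⁻¹ a a))⁻¹ * (Real.sqrt (metricInner G⁻¹ b b))⁻¹))
      {G | G.PosDef} :=
    Real.continuous_arccos.comp_continuousOn
      ((((continuous_metricInner b a).comp_continuousOn (continuousOn_matrix_inv.mono hu)).mul
        (continuousOn_inv_sqrt_metricInner_inv ha)).mul (continuousOn_inv_sqrt_metricInner_inv hb))
  refine h.congr fun G hG => ?_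
  rw [normalAngle, metricInner_unitNormal_unitNormal (hu G hG)]

theorem continuousOn_meanCurvature {g : E n → Matrix (Fin n) (Fin n) ℝ} {S : Set (E n)} {a : E n}
    (ha : a ≠ 0) (hg : ContinuousOn g S)
    (hd : ∀ i j k, ContinuousOn (pd k fun y => g y i j) S) (hpos : ∀ x ∈ S, (g x).PosDef)
    (hind : ∀ x ∈ S, IsUnit (inducedMetric (g x) (ℝ ∙ a)ᗮ).det) :
    ContinuousOn (meanCurvature g a) S := by
  have hu : ∀ x ∈ S, IsUnit (g x).det := fun x hx => (hpos x hx).det_pos.ne'.isUnit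
  have hJ : ContinuousOn (fun x => (g x)⁻¹) S := continuousOn_matrix_inv.comp hg hu
  have hJe : ∀ k l, ContinuousOn (fun x => (g x)⁻¹ k l) S := fun k l =>
    (continuous_id.matrix_elem k l).comp_continuousOn hJ
  have hΓ : ContinuousOn (fun x => (inducedMetric (g x) (ℝ ∙ a)ᗮ)⁻¹) S :=
    continuousOn_matrix_inv.comp ((continuous_inducedMetric _).comp_continuousOn hg) hind
  have hΓe : ∀ α β, ContinuousOn (fun x => (inducedMetric (g x) (ℝ ∙ a)ᗮ)⁻¹ α β) S := fun α β =>
    (continuous_id.matrix_elem α β).comp_continuousOn hΓ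
  have hs : ContinuousOn (fun x => (Real.sqrt (metricInner (g x)⁻¹ a a))⁻¹) S :=
    (continuousOn_inv_sqrt_metricInner_inv ha).comp hg hpos
  have hA : ∀ u v : E n, ContinuousOn (fun x => secondFundamentalForm g a x u v) S := by
    intro u v
    have hc : ContinuousOn (fun x => contraction (christoffelFirst g x) (g x)⁻¹ a u v) S := by
      unfold contraction christoffelFirst
      refine continuousOn_finsetSum _ fun k _ => ContinuousOn.mul
        (continuousOn_finsetSum _ fun i _ => continuousOn_finsetSum _ fun j _ =>
          ((continuousOn_finsetSum _ fun l _ => ?_).mul continuousOn_const).mul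
            continuousOn_const) continuousOn_const
      exact (continuousOn_const.mul (hJe k l)).mul (((hd l j i).add (hd i l j)).sub (hd i j l))
    exact (hs.mul hc).neg.congr fun x hx => secondFundamentalForm_eq (hu x hx) a u v
  unfold meanCurvature
  exact continuousOn_finsetSum _ fun α _ => continuousOn_finsetSum _ fun β _ =>
    (hΓe α β).mul (hA _ _)

theorem continuousOn_fluxDensity {g : E n → Matrix (Fin n) (Fin n) ℝ} {P : Set (E n)}
    (hd : ∀ i j k, ContinuousOn (pd k fun y => g y i j) (faces P)) :
    ContinuousOn (fluxDensity g P) (faces P) := by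
  refine continuousOn_faces (F := fun a x =>
    ∑ i, ∑ j, (pd i (fun y => g y i j) x - pd j (fun y => g y i i) x) * a j) fun x hx a _ => ?_
  exact (continuousOn_finsetSum _ fun i _ => continuousOn_finsetSum _ fun j _ =>
    ((hd i j i).sub (hd i i j)).mul continuousOn_const) x hx

theorem continuousOn_curvatureDensity {g : E n → Matrix (Fin n) (Fin n) ℝ} {P : Set (E n)}
    (hg : ContinuousOn g (faces P))
    (hd : ∀ i j k, ContinuousOn (pd k fun y => g y i j) (faces P))
    (hpos : ∀ x ∈ faces P, (g x).PosDef)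
    (hind : ∀ x ∈ faces P, ∀ W : Submodule ℝ (E n), IsUnit (inducedMetric (g x) W).det) :
    ContinuousOn (curvatureDensity g P) (faces P) := by
  refine continuousOn_faces (F := fun a x =>
    meanCurvature g a x * volDensity (g x) (ℝ ∙ a)ᗮ) fun x hx a ha => ?_
  have ha0 : a ≠ 0 := by rintro rfl; simpa using ha.1
  exact ((continuousOn_meanCurvature ha0 hg hd hpos fun y hy => hind y hy _).mul
    ((continuous_volDensity _).comp_continuousOn hg)) x hx

theorem angleDefectDensity_eq (g : E n → Matrix (Fin n) (Fin n) ℝ) (P : Set (E n)) (x : E n) :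
    angleDefectDensity g P x = -edgeSign P x *
      ((normalAngle (g x) (edgeNormals P x).1 (edgeNormals P x).2 -
        normalAngle 1 (edgeNormals P x).1 (edgeNormals P x).2) *
        volDensity (g x) (edgeDirection P x)) := by
  rw [angleDefectDensity, dihedralAngle_eq, dihedralAngle_eq]
  ring

theorem continuousOn_angleDefectDensity {g : E n → Matrix (Fin n) (Fin n) ℝ} {P : Set (E n)}
    (hg : ContinuousOn g (edges P)) (hpos : ∀ x ∈ edges P, (g x).PosDef) :
    ContinuousOn (angleDefectDensity g P) (edges P) := by
  refine ContinuousOn.congr ?_ fun x _ => angleDefectDensity_eq g P x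
  refine continuousOn_edges (F := fun s q x => -s * ((normalAngle (g x) q.1 q.2 -
    normalAngle 1 q.1 q.2) * volDensity (g x) (Submodule.span ℝ {q.1, q.2})ᗮ))
    fun x hx s a b h => ?_
  have ha : a ≠ 0 := by rintro rfl; simpa using h.norm_left
  have hb : b ≠ 0 := by rintro rfl; simpa using h.norm_right
  exact (continuousOn_const.mul ((((continuousOn_normalAngle ha hb).comp hg hpos).sub
    continuousOn_const).mul ((continuous_volDensity _).comp_continuousOn hg))) x hx

/-! ### The boundary terms of the metric perturbation -/

theorem pd_pert (g : E n → Matrix (Fin n) (Fin n) ℝ) (i j k : Fin n) (x : E n) :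
    pd k (pert g i j) x = pd k (fun y => g y i j) x := by
  unfold pd
  rw [show pert g i j = fun y => g y i j - (1 : Matrix (Fin n) (Fin n) ℝ) i j from rfl,
    fderiv_sub_const]

theorem fderiv_apply_eq_sum_pd (f : E n → ℝ) (x v : E n) :
    fderiv ℝ f x v = ∑ k, v k * pd k f x := by
  have h : v = ∑ k, v k • EuclideanSpace.single k (1 : ℝ) := by
    simpa using ((EuclideanSpace.basisFun (Fin n) ℝ).sum_repr v).symm
  conv_lhs => rw [h]
  simp [pd]

/-- The divergence of the tangential part of `h(ν, ·)`, where `h = g - 1`, in coordinates. -/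
theorem sum_faceDiv_pert (g : E n → Matrix (Fin n) (Fin n) ℝ) (P : Set (E n)) (x : E n) :
    ∑ i, ∑ j, faceDiv P (EuclideanSpace.single i 1) (EuclideanSpace.single j 1) (pert g i j) x =
      ∑ i, ∑ j, outwardNormal P x j * (pd i (fun y => g y i j) x - outwardNormal P x i *
        ∑ k, outwardNormal P x k * pd k (fun y => g y i j) x) := by
  refine Finset.sum_congr rfl fun i _ => Finset.sum_congr rfl fun j _ => ?_
  have h : fderiv ℝ (pert g i j) x (EuclideanSpace.single i 1) = pd i (pert g i j) x := rfl
  rw [faceDiv, map_sub, map_smul, smul_eq_mul, h, fderiv_apply_eq_sum_pd]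
  simp [EuclideanSpace.inner_single_right, pd_pert]

/-- The flux of the tangential parts of `h(ν, ·)` through an edge, where `h = g - 1`. -/
theorem sum_edgeTerm_pert (g : E n → Matrix (Fin n) (Fin n) ℝ) (P : Set (E n)) (x : E n) :
    ∑ i, ∑ j, edgeTerm P (EuclideanSpace.single i 1) (EuclideanSpace.single j 1) (pert g i j) x =
      edgeSign P x *
        (metricInner (g x - 1) (conormal (edgeNormals P x).1 (edgeNormals P x).2)
          (edgeNormals P x).1 +
        metricInner (g x - 1) (conormal (edgeNormals P x).2 (edgeNormals P x).1)
          (edgeNormals P x).2) := by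
  simp only [metricInner, ← Finset.sum_add_distrib, Finset.mul_sum]
  refine Finset.sum_congr rfl fun i _ => Finset.sum_congr rfl fun j _ => ?_
  simp only [edgeTerm, edgeKernel, EuclideanSpace.inner_single_right, pert, Matrix.sub_apply]
  simp
  ring

end Continuity

/-! ### The flux formula in the asymptotically flat end -/

section FluxFormula

open scoped Matrix.Norms.Operator

variable {n : ℕ} {g : E n → Matrix (Fin n) (Fin n) ℝ} {r₀ p : ℝ} {P : Set (E n)}

theorem IsAsymptoticallyFlatEnd.continuousOn_pd (hg : IsAsymptoticallyFlatEnd g r₀ p)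
    (i j k : Fin n) : ContinuousOn (pd k fun y => g y i j) {x | r₀ < ‖x‖} :=
  ((hg.contDiffOn i j).continuousOn_fderiv_of_isOpen (isOpen_lt continuous_const continuous_norm)
    one_le_two).clm_apply continuousOn_const

theorem IsAsymptoticallyFlatEnd.continuousOn (hg : IsAsymptoticallyFlatEnd g r₀ p) :
    ContinuousOn g {x | r₀ < ‖x‖} :=
  continuousOn_pi.2 fun i => continuousOn_pi.2 fun j => (hg.contDiffOn i j).continuousOn

theorem IsAsymptoticallyFlatEnd.pd_symm (hg : IsAsymptoticallyFlatEnd g r₀ p) {x : E n}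
    (hx : r₀ < ‖x‖) (i j k : Fin n) :
    pd k (fun y => g y i j) x = pd k (fun y => g y j i) x := by
  have h : (fun y => g y i j) =ᶠ[𝓝 x] fun y => g y j i := by
    filter_upwards [(isOpen_lt continuous_const continuous_norm).mem_nhds hx] with y hy
    have := (hg.posDef y hy).isHermitian.apply j i
    simpa using this
  rw [pd, pd, h.fderiv_eq]

theorem IsAsymptoticallyFlatEnd.exists_bounds (hg : IsAsymptoticallyFlatEnd g r₀ p) :
    ∃ K R : ℝ, 0 ≤ K ∧ ∀ x : E n, R ≤ ‖x‖ →
      (∀ i j, |(g x - 1) i j| ≤ K * ‖x‖ ^ (-p)) ∧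
      ∀ i j k, |pd k (fun y => g y i j) x| ≤ K * ‖x‖ ^ (-p - 1) := by
  choose K1 hK1 using fun i j => (hg.decay i j).bound
  choose K2 hK2 using fun i j k => (hg.decay_deriv i j k).bound
  set K := ∑ i, ∑ j, (|K1 i j| + ∑ k, |K2 i j k|) with hK
  have hle : ∀ i j, |K1 i j| + ∑ k, |K2 i j k| ≤ K := fun i j =>
    (Finset.single_le_sum (f := fun j => |K1 i j| + ∑ k, |K2 i j k|)
      (fun _ _ => by positivity) (Finset.mem_univ j)).trans
    (Finset.single_le_sum (f := fun i => ∑ j, (|K1 i j| + ∑ k, |K2 i j k|))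
      (fun _ _ => by positivity) (Finset.mem_univ i))
  have hle1 : ∀ i j, K1 i j ≤ K := fun i j => by
    have : 0 ≤ ∑ k, |K2 i j k| := by positivity
    linarith [hle i j, le_abs_self (K1 i j)]
  have hle2 : ∀ i j k, K2 i j k ≤ K := fun i j k => by
    have := Finset.single_le_sum (f := fun k => |K2 i j k|) (fun _ _ => abs_nonneg _)
      (Finset.mem_univ k)
    linarith [hle i j, le_abs_self (K2 i j k), abs_nonneg (K1 i j)]
  have hev : ∀ᶠ x in Bornology.cobounded (E n),
      (∀ i j, |(g x - 1) i j| ≤ K * ‖x‖ ^ (-p)) ∧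
      ∀ i j k, |pd k (fun y => g y i j) x| ≤ K * ‖x‖ ^ (-p - 1) := by
    refine Filter.Eventually.and ?_ ?_
    · refine eventually_all.2 fun i => eventually_all.2 fun j => ?_
      filter_upwards [hK1 i j] with x hx
      rw [Real.norm_eq_abs, Real.norm_of_nonneg (by positivity)] at hx
      exact hx.trans (mul_le_mul_of_nonneg_right (hle1 i j) (by positivity))
    · refine eventually_all.2 fun i => eventually_all.2 fun j => eventually_all.2 fun k => ?_
      filter_upwards [hK2 i j k] with x hx
      rw [Real.norm_eq_abs, Real.norm_of_nonneg (by positivity), pd_pert] at hx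
      exact hx.trans (mul_le_mul_of_nonneg_right (hle2 i j k) (by positivity))
  obtain ⟨R, -, hR⟩ := hasBasis_cobounded_norm.eventually_iff.1 hev
  exact ⟨K, R, by positivity, fun x hx => hR hx⟩

theorem boundaryRadius_le_norm {x : E n} (hx : x ∈ frontier P) : boundaryRadius P ≤ ‖x‖ :=
  csInf_le ⟨0, by rintro _ ⟨y, -, rfl⟩; exact norm_nonneg y⟩ ⟨x, hx, rfl⟩

/-- Off the faces `outwardNormal` is `0` by convention, so the flux through the boundary is the flux
through the faces. -/
theorem fluxDensity_eq_zero {x : E n} (hx : x ∉ faces P) : fluxDensity g P x = 0 := by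
  have : outwardNormal P x = 0 := dif_neg hx
  simp [fluxDensity, this]

/-- Summation of the divergence theorem over the components of `h = g - 1`, applied to the
coordinate vector fields. -/
theorem IsPolyhedron.divergence_pert (hn : 3 ≤ n) (hP : IsPolyhedron P)
    (hg : IsAsymptoticallyFlatEnd g r₀ p) (hPU : frontier P ⊆ {x | r₀ < ‖x‖}) :
    IntegrableOn (fun x => ∑ i, ∑ j, faceDiv P (EuclideanSpace.single i 1)
      (EuclideanSpace.single j 1) (pert g i j) x) (faces P) μHE[n - 1] ∧
    IntegrableOn (fun x => ∑ i, ∑ j, edgeTerm P (EuclideanSpace.single i 1)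
      (EuclideanSpace.single j 1) (pert g i j) x) (edges P) μHE[n - 2] ∧
    ∫ x in faces P, ∑ i, ∑ j, faceDiv P (EuclideanSpace.single i 1)
      (EuclideanSpace.single j 1) (pert g i j) x ∂μHE[n - 1] =
    ∫ x in edges P, ∑ i, ∑ j, edgeTerm P (EuclideanSpace.single i 1)
      (EuclideanSpace.single j 1) (pert g i j) x ∂μHE[n - 2] := by
  have h := fun i j => hP.divergence hn (isOpen_lt continuous_const continuous_norm) hPU
    (f := pert g i j) (((hg.contDiffOn i j).of_le one_le_two).sub contDiffOn_const)
    (EuclideanSpace.single i 1) (EuclideanSpace.single j 1)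
  refine ⟨integrable_finsetSum _ fun i _ => integrable_finsetSum _ fun j _ => (h i j).1,
    integrable_finsetSum _ fun i _ => integrable_finsetSum _ fun j _ => (h i j).2.1, ?_⟩
  rw [integral_finsetSum _ fun i _ => integrable_finsetSum _ fun j _ => (h i j).1,
    integral_finsetSum _ fun i _ => integrable_finsetSum _ fun j _ => (h i j).2.1]
  refine Finset.sum_congr rfl fun i _ => ?_
  rw [integral_finsetSum _ fun j _ => (h i j).1, integral_finsetSum _ fun j _ => (h i j).2.1]
  exact Finset.sum_congr rfl fun j _ => (h i j).2.2

/-- The flux formula, from pointwise estimates on the faces and on the edges: the divergence of the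
tangential part of `h(ν, ·)` is added to the integrand on the faces and subtracted, as a boundary
term, on the edges. -/
theorem IsPolyhedron.flux_estimate (hn : 3 ≤ n) (hP : IsPolyhedron P)
    (hg : IsAsymptoticallyFlatEnd g r₀ p) (hPU : frontier P ⊆ {x | r₀ < ‖x‖})
    (hind : ∀ x ∈ frontier P, ∀ W : Submodule ℝ (E n), IsUnit (inducedMetric (g x) W).det)
    {Mf Mc Me Bf Be : ℝ}
    (hflux : ∀ x ∈ faces P, |fluxDensity g P x| ≤ Mf)
    (hcurv : ∀ x ∈ faces P, |curvatureDensity g P x| ≤ Mc)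
    (hangle : ∀ x ∈ edges P, |angleDefectDensity g P x| ≤ Me)
    (hface : ∀ x ∈ faces P, |fluxDensity g P x + 2 * curvatureDensity g P x +
      ∑ i, ∑ j, faceDiv P (EuclideanSpace.single i 1) (EuclideanSpace.single j 1)
        (pert g i j) x| ≤ Bf)
    (hedge : ∀ x ∈ edges P, |∑ i, ∑ j, edgeTerm P (EuclideanSpace.single i 1)
      (EuclideanSpace.single j 1) (pert g i j) x + 2 * angleDefectDensity g P x| ≤ Be) :
    IntegrableOn (fluxDensity g P) (frontier P) μHE[n - 1] ∧
    IntegrableOn (curvatureDensity g P) (faces P) μHE[n - 1] ∧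
    IntegrableOn (angleDefectDensity g P) (edges P) μHE[n - 2] ∧
    |flux g P - (-2 * totalMeanCurvature g P + 2 * totalAngleDefect g P)| ≤
      Be * edgeVolume P + Bf * faceVolume P := by
  have hFU : faces P ⊆ {x | r₀ < ‖x‖} := (faces_subset_frontier P).trans hPU
  have hEU : edges P ⊆ {x | r₀ < ‖x‖} := (edges_subset_frontier P).trans hPU
  have hd : ∀ i j k, ContinuousOn (pd k fun y => g y i j) (faces P) := fun i j k =>
    (hg.continuousOn_pd i j k).mono hFU
  have hfluxI : IntegrableOn (fluxDensity g P) (faces P) μHE[n - 1] :=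
    integrableOn_of_continuousOn_of_bounded (measurableSet_faces P) hP.measure_faces_lt_top
      (continuousOn_fluxDensity hd) hflux
  have hcurvI : IntegrableOn (curvatureDensity g P) (faces P) μHE[n - 1] :=
    integrableOn_of_continuousOn_of_bounded (measurableSet_faces P) hP.measure_faces_lt_top
      (continuousOn_curvatureDensity (hg.continuousOn.mono hFU) hd
        (fun x hx => hg.posDef x (hFU hx))
        fun x hx => hind x (faces_subset_frontier P hx)) hcurv
  have hangleI : IntegrableOn (angleDefectDensity g P) (edges P) μHE[n - 2] :=
    integrableOn_of_continuousOn_of_bounded (measurableSet_edges P) hP.measure_edges_lt_top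
      (continuousOn_angleDefectDensity (hg.continuousOn.mono hEU)
        fun x hx => hg.posDef x (hEU hx)) hangle
  obtain ⟨hdF, hdE, hdiv⟩ := hP.divergence_pert hn hg hPU
  have hzero : ∀ x ∈ frontier P \ faces P, fluxDensity g P x = 0 := fun x hx =>
    fluxDensity_eq_zero hx.2
  refine ⟨hfluxI.of_forall_sdiff_eq_zero isClosed_frontier.measurableSet hzero, hcurvI, hangleI,
    ?_⟩
  have hfluxE : flux g P = ∫ x in faces P, fluxDensity g P x ∂μHE[n - 1] :=
    setIntegral_eq_of_subset_of_forall_sdiff_eq_zero isClosed_frontier.measurableSet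
      (faces_subset_frontier P) hzero
  have eF : ∫ x in faces P, (fluxDensity g P x + 2 * curvatureDensity g P x +
        ∑ i, ∑ j, faceDiv P (EuclideanSpace.single i 1) (EuclideanSpace.single j 1)
          (pert g i j) x) ∂μHE[n - 1] = flux g P + 2 * totalMeanCurvature g P +
      ∫ x in faces P, ∑ i, ∑ j, faceDiv P (EuclideanSpace.single i 1)
        (EuclideanSpace.single j 1) (pert g i j) x ∂μHE[n - 1] := by
    rw [integral_add (f := fun x => fluxDensity g P x + 2 * curvatureDensity g P x)
      (hfluxI.add (hcurvI.const_mul 2)) hdF, integral_add hfluxI (hcurvI.const_mul 2),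
      integral_const_mul, hfluxE, totalMeanCurvature]
  have eE : ∫ x in edges P, (∑ i, ∑ j, edgeTerm P (EuclideanSpace.single i 1)
        (EuclideanSpace.single j 1) (pert g i j) x + 2 * angleDefectDensity g P x) ∂μHE[n - 2] =
      ∫ x in edges P, ∑ i, ∑ j, edgeTerm P (EuclideanSpace.single i 1)
        (EuclideanSpace.single j 1) (pert g i j) x ∂μHE[n - 2] + 2 * totalAngleDefect g P := by
    rw [integral_add hdE (hangleI.const_mul 2), integral_const_mul, totalAngleDefect]
  have e : ∀ f h t d d' : ℝ, d = d' → f - (-2 * h + 2 * t) = (f + 2 * h + d) - (d' + 2 * t) := by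
    rintro f h t d _ rfl
    ring
  rw [e _ _ _ _ _ hdiv, ← eF, ← eE, add_comm (Be * _)]
  refine (abs_sub _ _).trans (add_le_add ?_ ?_)
  · rw [← Real.norm_eq_abs]
    refine norm_setIntegral_le_of_norm_le_const hP.measure_faces_lt_top ?_
    exact hface
  · rw [← Real.norm_eq_abs]
    refine norm_setIntegral_le_of_norm_le_const hP.measure_edges_lt_top ?_
    exact hedge

end FluxFormula

end PolyhedralMass

open scoped Matrix.Norms.Operator in
theorem proposition3p1 (n : ℕ) (hn : 3 ≤ n)
    (g : E n → Matrix (Fin n) (Fin n) ℝ) (r₀ p : ℝ) (hg : IsAsymptoticallyFlatEnd g r₀ p) :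
    ∃ C : ℝ, ∀ c : ℝ, 0 < c → c < 1 → ∃ R : ℝ, ∀ P : Set (E n),
      IsPolyhedron P → Metric.ball 0 r₀ ⊆ interior P →
      (∀ x a b : E n, IsEdgePoint P x a b → c ≤ Real.sin (normalAngle 1 a b)) →
      R ≤ boundaryRadius P →
        IntegrableOn (fluxDensity g P) (frontier P) μHE[n - 1] ∧
        IntegrableOn (curvatureDensity g P) (faces P) μHE[n - 1] ∧
        IntegrableOn (angleDefectDensity g P) (edges P) μHE[n - 2] ∧
        |flux g P - (-2 * totalMeanCurvature g P + 2 * totalAngleDefect g P)| ≤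
          C * (c⁻¹ ^ 3 * edgeVolume P * boundaryRadius P ^ (-2 * p) +
            faceVolume P * boundaryRadius P ^ (-2 * p - 1)) := by
  obtain ⟨C1, δ1, hC1, hδ1, hcurv⟩ := exists_curvature_estimate n
  obtain ⟨C2, δ2, hC2, hδ2, hangle⟩ := exists_angleDefect_estimate n
  obtain ⟨K, R1, hK, hbound⟩ := hg.exists_bounds
  have hn3 : (3 : ℝ) ≤ n := by exact_mod_cast hn
  have hp : 0 < p := by have := hg.order; linarith
  set δ := min (min δ1 δ2) (1 / (2 * (n : ℝ) ^ 3)) with hδ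
  have hδ0 : 0 < δ := lt_min (lt_min hδ1 hδ2) (by positivity)
  -- a radius beyond which `g` is `δ`-close to the Euclidean metric
  obtain ⟨R2, hR2⟩ : ∃ R2 : ℝ, ∀ r ≥ R2, n * (K * r ^ (-p)) ≤ δ := by
    have h := ((tendsto_rpow_neg_atTop hp).const_mul K).const_mul (n : ℝ)
    rw [mul_zero, mul_zero] at h
    exact eventually_atTop.1 (h.eventually_le_const hδ0)
  refine ⟨C1 * n * K ^ 2 + C2 * n ^ 2 * K ^ 2, fun c hc _ =>
    ⟨max (max 1 (r₀ + 1)) (max R1 R2), fun P hP _ hsin hR => ?_⟩⟩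
  set r := boundaryRadius P with hr
  obtain ⟨⟨hr1, hr2⟩, hr3, hr4⟩ :
      (1 ≤ r ∧ r₀ + 1 ≤ r) ∧ R1 ≤ r ∧ R2 ≤ r := by simpa using hR
  have hr0 : 0 < r := by linarith
  have hx : ∀ {x}, x ∈ frontier P → r ≤ ‖x‖ := fun h => boundaryRadius_le_norm h
  have hPU : frontier P ⊆ {x | r₀ < ‖x‖} := fun x h => by
    have := hx h
    change r₀ < ‖x‖
    linarith
  -- bounds on `∂P` for the perturbation and for its derivatives
  set ε := n * (K * r ^ (-p)) with hε
  set ε' := K * r ^ (-p - 1) with hε'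
  have hε0 : 0 ≤ ε := by positivity
  have hε'0 : 0 ≤ ε' := by positivity
  have hεδ : ε ≤ δ := hR2 r hr4
  have hgx : ∀ {x}, x ∈ frontier P → ‖g x - 1‖ ≤ ε := by
    intro x h
    have h1 := norm_le_of_abs_entry_le (r := K * r ^ (-p)) (by positivity) fun i j =>
      ((hbound x (hr3.trans (hx h))).1 i j).trans (mul_le_mul_of_nonneg_left
        (Real.rpow_le_rpow_of_nonpos hr0 (hx h) (by linarith)) hK)
    rwa [Fintype.card_fin] at h1
  have hpd : ∀ {x}, x ∈ frontier P → ∀ k i j, |pd k (fun y => g y i j) x| ≤ ε' := fun h k i j =>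
    ((hbound _ (hr3.trans (hx h))).2 i j k).trans (mul_le_mul_of_nonneg_left
      (Real.rpow_le_rpow_of_nonpos hr0 (hx h) (by linarith)) hK)
  have hind : ∀ x ∈ frontier P, ∀ W : Submodule ℝ (E n), IsUnit (inducedMetric (g x) W).det := by
    intro x h W
    refine isUnit_det_of_norm_sub_one_lt ((norm_inducedMetric_sub_one_le (g x) W).trans_lt ?_)
    have h1 : ‖g x - 1‖ ≤ 1 / (2 * (n : ℝ) ^ 3) :=
      (hgx h).trans (hεδ.trans (min_le_right _ _))
    rw [le_div_iff₀ (by positivity)] at h1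
    linarith
  have hface : ∀ x ∈ faces P, ‖outwardNormal P x‖ = 1 := by
    rintro x ⟨a, ha⟩
    rw [outwardNormal_eq ha]
    exact ha.1
  have hF : ∀ x ∈ faces P, _ := fun x h => hcurv g x (outwardNormal P x) (faceDirection P x) ε'
    (hg.posDef x (hPU (faces_subset_frontier P h)))
    ((hgx (faces_subset_frontier P h)).trans
      (hεδ.trans ((min_le_left _ _).trans (min_le_left _ _))))
    (hface x h) hε'0 (fun k i j => hg.pd_symm (hPU (faces_subset_frontier P h)) i j k)
    (hpd (faces_subset_frontier P h))
  have hsE : ∀ x ∈ edges P, IsSignedEdgePoint P (edgeSign P x) x (edgeNormals P x).1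
      (edgeNormals P x).2 := fun x h => by
    obtain ⟨s, a, b, hs⟩ := exists_of_mem_edges h
    rw [hs.edgeSign_eq]
    exact hs.at_edgeNormals
  have hE : ∀ x ∈ edges P, _ := fun x h =>
    hangle (g x) (edgeNormals P x).1 (edgeNormals P x).2 (edgeDirection P x) c
      (hg.posDef x (hPU (edges_subset_frontier P h)))
      ((hgx (edges_subset_frontier P h)).trans
        (hεδ.trans ((min_le_left _ _).trans (min_le_right _ _))))
      (hsE x h).norm_left (hsE x h).norm_right hc (hsin x _ _ (isEdgePoint_iff.2 ⟨_, hsE x h⟩))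
  have hsign : ∀ x ∈ edges P, |edgeSign P x| = 1 := fun x h => by
    rcases (hsE x h).sign_eq with e | e <;> simp [e]
  have hflux : ∀ x ∈ faces P, |fluxDensity g P x| ≤ n * (n * ((ε' + ε') * 1)) := by
    intro x h
    refine abs_sum_le_of_abs_le (by simp) (by positivity) fun i =>
      abs_sum_le_of_abs_le (by simp) (by positivity) fun j => ?_
    rw [abs_mul]
    have j1 := hpd (faces_subset_frontier P h) i i j
    have j2 := hpd (faces_subset_frontier P h) j i i
    have j3 := (hface x h) ▸ abs_coord_le (outwardNormal P x) j
    exact mul_le_mul ((abs_sub _ _).trans (add_le_add j1 j2)) j3 (abs_nonneg _) (by positivity)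
  have hangle' : ∀ x ∈ edges P, |angleDefectDensity g P x| ≤ C2 * c⁻¹ ^ 3 * ε := by
    intro x h
    rw [angleDefectDensity_eq, abs_mul, abs_neg, hsign x h, one_mul]
    refine (hE x h).2.trans ?_
    have := hgx (edges_subset_frontier P h)
    gcongr
  have hface' : ∀ x ∈ faces P, |fluxDensity g P x + 2 * curvatureDensity g P x +
      ∑ i, ∑ j, faceDiv P (EuclideanSpace.single i 1) (EuclideanSpace.single j 1)
        (pert g i j) x| ≤ C1 * (ε * ε') := by
    intro x h
    rw [sum_faceDiv_pert]
    refine (hF x h).1.trans ?_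
    have := hgx (faces_subset_frontier P h)
    gcongr
  have hedge : ∀ x ∈ edges P, |∑ i, ∑ j, edgeTerm P (EuclideanSpace.single i 1)
      (EuclideanSpace.single j 1) (pert g i j) x + 2 * angleDefectDensity g P x| ≤
      C2 * c⁻¹ ^ 3 * ε ^ 2 := by
    intro x h
    rw [sum_edgeTerm_pert, angleDefectDensity_eq]
    have h5 := (hE x h).1
    rw [← abs_neg, ← one_mul |_|, ← hsign x h, ← abs_mul] at h5
    have h6 := hgx (edges_subset_frontier P h)
    calc _ = _ := by congr 1; ring
      _ ≤ _ := h5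
      _ ≤ _ := by gcongr
  obtain ⟨h1, h2, h3, h4⟩ := hP.flux_estimate hn hg hPU hind hflux (fun x h => (hF x h).2) hangle'
    hface' hedge
  refine ⟨h1, h2, h3, h4.trans ?_⟩
  have e1 : ε ^ 2 = n ^ 2 * K ^ 2 * r ^ (-2 * p) := by
    rw [hε, mul_pow, mul_pow, ← Real.rpow_natCast (r ^ (-p)), ← Real.rpow_mul hr0.le, ← mul_assoc]
    congr 2
    push_cast
    ring
  have e2 : ε * ε' = n * K ^ 2 * r ^ (-2 * p - 1) := by
    rw [hε, hε', show -2 * p - 1 = -p + (-p - 1) by ring, Real.rpow_add hr0]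
    ring
  rw [e1, e2]
  have hv1 : 0 ≤ edgeVolume P := measureReal_nonneg
  have hv2 : 0 ≤ faceVolume P := measureReal_nonneg
  have i1 : 0 ≤ C1 * n * K ^ 2 * (c⁻¹ ^ 3 * edgeVolume P * r ^ (-2 * p)) := by positivity
  have i2 : 0 ≤ C2 * n ^ 2 * K ^ 2 * (faceVolume P * r ^ (-2 * p - 1)) := by positivity
  linarith
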